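/- Let $n\ge 3$. Call $(p,q)$ admissible if $p,q\in[2,\infty]$ and $\frac1p+\frac n{2q}=\frac n4$; primes denote conjugate exponents, and for an interval $I$ write $\|u\|_{L^p_IL^q}=\big\|\,\|u(t,\cdot)\|_{L^q(\mathbb R^n)}\big\|_{L^p(I)}$. Let $C_0$ be the optimal constant, depending only on $n$, such that $$\|e^{it\Delta}u_0\|_{L^p_IL^q}\le C_0\|u_0\|_{L^2},\qquad \Big\|\int_0^te^{i(t-s)\Delta}F(s)\,ds\Big\|_{L^p_IL^q}\le C_0\|F\|_{L^{\tilde p'}_IL^{\tilde q'}}$$ for all intervals $I\subseteq\mathbb R$, all admissible $(p,q),(\tilde p,\tilde q)$, all $u_0\in L^2$ and all $F\in L^{\tilde p'}_IL^{\tilde q'}$ (extended by $0$ outside $I$). A real-valued function $W$ on $\mathbb R^n$ is of *Strichartz type* if $\Delta-W$ has a self-adjoint realization $H$ in $L^2(\mathbb R^n)$ (i.e. $H$ is self-adjoint and, for each $f\in D(H)$, $Wf\in L^1_{loc}$ and $Hf=\Delta f-Wf$ in the sense of distributions) such that for every bounded interval $I=[0,T]$ there is a constant $C=C(I,W)$ with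 the following property: for all $u_0\in L^2$, all admissible $(a,b),(\tilde p,\tilde q)$ and all $F\in L^{\tilde p'}_IL^{\tilde q'}$, the function $u(t)=e^{itH}u_0+\int_0^te^{i(t-s)H}F(s)\,ds$ belongs to $C(I;L^2)$ and $$\|u\|_{L^a_IL^b}\le C\|u_0\|_{L^2}+C\|F\|_{L^{\tilde p'}_IL^{\tilde q'}}.$$ (The integral is defined for $F\in L^{\tilde p'}_IL^{\tilde q'}\cap L^1_IL^2$ and in general by density.) Let $V(t,x)$ be real valued and let $I$ be $[0,T]$ with $0<T<\infty$, or $[0,\infty)$. Consider the integral equation $$u(t)=e^{it\Delta}u_0+i\int_0^te^{i(t-s)\Delta}\,[F(s)-V(s)u(s)]\,ds,\qquad t\in I,\tag{1}$$ understood weakly, i.e. tested against Schwartz functions in $x$, for $u\in C(I;L^2)$ such that $u\in L^2_{[0,t]}L^{2n/(n-2)}$ for every $t\in I$. **Theorem.** (Local.) Let $I=[0,T]$, $V\in C(I;L^{n/2}(\mathbb R^n))$, and let $V(t,\cdot)$ be of Strichartz type for every $t\in I$. Then: 1. for all $u_0\in L^2$ and all $F\in L^{\tilde p'}_IL^{\tilde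 q'}$ with $(\tilde p,\tilde q)$ admissible, (1) has exactly one solution $u$ in the above class; 2. there is a finite constant $C_V$, independent of $u_0$, $F$, $u$ and of the admissible pairs, such that $u\in L^p_IL^q$ for all admissible $(p,q)$ and $$\|u\|_{L^p_IL^q}\le C_V\|u_0\|_{L^2}+C_V\|F\|_{L^{\tilde p'}_IL^{\tilde q'}};$$ 3. if $I$ can be partitioned into $k$ subintervals $J$ with $\|V\|_{L^\infty_JL^{n/2}}\le(2C_0)^{-1}$, then the estimate in 2 holds with $C_V=k(1+2C_0)^k$; 4. if $F\equiv0$ then $\|u(t)\|_{L^2}=\|u_0\|_{L^2}$ for all $t\in I$. (Global.) The same conclusions hold for $I=[0,\infty)$ if $V\in C([0,\infty);L^{n/2})$, $V(t,\cdot)$ is of Strichartz type for every $t\ge0$, and there is $T_0>0$ with $\|V(t,\cdot)\|_{L^{n/2}}\le(2C_0)^{-1}$ for all $t>T_0$. -/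

import Mathlib

open MeasureTheory Set Filter Topology
open scoped ENNReal NNReal FourierTransform SchwartzMap ContDiff

noncomputable section

namespace Schrodinger

/-- Physical space `ℝⁿ`. -/
abbrev Space (n : ℕ) : Type := EuclideanSpace ℝ (Fin n)

/-- The complex Hilbert space `L²(ℝⁿ)`. -/
abbrev L2 (n : ℕ) : Type := Lp ℂ 2 (volume : Measure (Space n))

/-- The mixed norm `‖u‖_{L^p(I; L^q(ℝⁿ))}`, with values in `[0, ∞]`. -/
def mixedNorm {n : ℕ} (I : Set ℝ) (p q : ℝ≥0∞) (u : ℝ → Space n → ℂ) : ℝ≥0∞ :=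
  eLpNorm (fun t => eLpNorm (u t) q volume) p (volume.restrict I)

/-- Schrödinger admissible pairs: `1/p + n/(2q) = n/4`, `p, q ∈ [2, ∞]`,
`(n, p, q) ≠ (2, 2, ∞)`. -/
def Admissible (n : ℕ) (p q : ℝ≥0∞) : Prop :=
  2 ≤ p ∧ 2 ≤ q ∧ p⁻¹ + (n : ℝ≥0∞) / (2 * q) = (n : ℝ≥0∞) / 4 ∧ ¬ (n = 2 ∧ p = 2 ∧ q = ⊤)

/-! ### The free propagator -/

/-- `ξ ↦ exp(-4π² i t |ξ|²)`, the symbol of `e^{itΔ}` for the normalization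
`𝓕 f (ξ) = ∫ exp(-2π i x·ξ) f(x) dx` of the Fourier transform. -/
def freeSymbolFun (n : ℕ) (t : ℝ) (ξ : Space n) : ℂ :=
  Complex.exp (-((4 * Real.pi ^ 2 * t * ‖ξ‖ ^ 2 : ℝ) : ℂ) * Complex.I)

theorem memLp_freeSymbolFun (n : ℕ) (t : ℝ) :
    MemLp (freeSymbolFun n t) ⊤ (volume : Measure (Space n)) := by
  refine memLp_top_of_bound (Continuous.aestronglyMeasurable ?_) 1 (ae_of_all _ fun ξ => ?_)
  · unfold freeSymbolFun
    fun_prop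
  · rw [freeSymbolFun, ← Complex.ofReal_neg, Complex.norm_exp_ofReal_mul_I]

/-- The free propagator `e^{itΔ}` on `L²(ℝⁿ)`. -/
def freePropagator (n : ℕ) (t : ℝ) (f : L2 n) : L2 n :=
  𝓕⁻ (((memLp_freeSymbolFun n t).toLp (freeSymbolFun n t) • 𝓕 f : L2 n))

/-- `C` is a Strichartz constant for the free equation: with the same `C` for all admissible pairs
and all time intervals `I`,
`‖e^{itΔ} u₀‖_{L^p_I L^q} ≤ C ‖u₀‖_{L²}` and
`‖∫₀ᵗ e^{i(t-s)Δ} F(s) ds‖_{L^p_I L^q} ≤ C ‖F‖_{L^{p̃'}_I L^{q̃'}}`.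
The second estimate is tested on sources `F ∈ L¹(I; L²)` (extended by zero outside `I`), for which
the integral converges in `L²`; those of finite `L^{p̃'}_I L^{q̃'}` norm are dense in
`L^{p̃'}_I L^{q̃'}`. -/
def IsFreeStrichartzConstant (n : ℕ) (C : ℝ≥0∞) : Prop :=
  ∀ I : Set ℝ, I.OrdConnected → ∀ p q : ℝ≥0∞, Admissible n p q →
    (∀ u₀ : L2 n, mixedNorm I p q (fun t => freePropagator n t u₀) ≤ C * ‖u₀‖ₑ) ∧
    ∀ p₁ q₁ : ℝ≥0∞, Admissible n p₁ q₁ →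
      ∀ F : ℝ → L2 n, Integrable F → (∀ t ∉ I, F t = 0) →
        mixedNorm I p q (fun t => ⇑(∫ s in (0 : ℝ)..t, freePropagator n (t - s) (F s))) ≤
          C * mixedNorm I p₁.conjExponent q₁.conjExponent (fun t => F t)

/-- The (optimal) Strichartz constant `C₀` of the free equation in dimension `n`. -/
def freeStrichartzConstant (n : ℕ) : ℝ≥0∞ :=
  sInf {C | IsFreeStrichartzConstant n C}

/-! ### Potentials of Strichartz type -/

/-- `H` is a self-adjoint realization of `Δ - V` on `L²(ℝⁿ)`: it is self-adjoint, and every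
`f ∈ D(H)` satisfies `V f ∈ L¹_loc` and `H f = Δ f - V f` in the sense of distributions.
When `V ∈ L²_loc` this says exactly that `H` is a self-adjoint extension of `Δ - V` defined on
`C_c^∞(ℝⁿ)`; the formulation also makes sense when `V φ ∉ L²` for test functions `φ`. -/
def IsSelfAdjointRealization {n : ℕ} (V : Space n → ℝ) (H : L2 n →ₗ.[ℂ] L2 n) : Prop :=
  IsSelfAdjoint H ∧
  ∀ f : H.domain,
    LocallyIntegrable (fun x => (V x : ℂ) * (f : L2 n) x) volume ∧
    ∀ φ : Space n → ℂ, ContDiff ℝ ∞ φ → HasCompactSupport φ →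
      ∫ x, (H f) x * φ x =
        (∫ x, (f : L2 n) x * (Laplacian.laplacian φ) x) - ∫ x, (V x : ℂ) * (f : L2 n) x * φ x

/-- `U t = e^{itH}`: the strongly continuous unitary group whose generator is `iH`. For
self-adjoint `H` these properties determine `U` uniquely. -/
structure IsUnitaryGroup {n : ℕ} (H : L2 n →ₗ.[ℂ] L2 n) (U : ℝ → L2 n →L[ℂ] L2 n) : Prop where
  zero : U 0 = ContinuousLinearMap.id ℂ (L2 n)
  add : ∀ s t, U (s + t) = (U s).comp (U t)
  norm_map : ∀ t f, ‖U t f‖ = ‖f‖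
  continuous : ∀ f, Continuous fun t => U t f
  hasDerivAt : ∀ (f : H.domain) (t : ℝ),
    HasDerivAt (fun r => U r (f : L2 n)) (Complex.I • U t (H f)) t

/-- `V` is of Strichartz type: `Δ - V` has a self-adjoint realization `H` such that on each bounded
interval `[0, T]` the functions `u(t) = e^{itH} u₀ + ∫₀ᵗ e^{i(t-s)H} F(s) ds` obey
`‖u‖_{L^a L^b} ≤ C ‖u₀‖_{L²} + C ‖F‖_{L^{p̃'} L^{q̃'}}` for all admissible `(a, b)`, `(p̃, q̃)`, with
`C` depending only on `T` and `V`.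
As above, the sources range over the dense class of `F` that are also in `L¹(0, T; L²)`, where the
formula defines a unique `u ∈ C([0, T]; L²)`; for the other `F` the solution `u` is the limit of
these and inherits the estimates. -/
def IsStrichartzType {n : ℕ} (V : Space n → ℝ) : Prop :=
  ∃ (H : L2 n →ₗ.[ℂ] L2 n) (U : ℝ → L2 n →L[ℂ] L2 n),
    IsSelfAdjointRealization V H ∧ IsUnitaryGroup H U ∧
    ∀ T : ℝ, 0 < T → ∃ C : ℝ≥0, ∀ a b p₁ q₁ : ℝ≥0∞, Admissible n a b → Admissible n p₁ q₁ →
      ∀ (u₀ : L2 n) (F : ℝ → L2 n), IntegrableOn F (Icc 0 T) →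
        mixedNorm (Icc 0 T) a b
            (fun t => ⇑(U t u₀ + ∫ s in (0 : ℝ)..t, U (t - s) (F s))) ≤
          C * ‖u₀‖ₑ +
            C * mixedNorm (Icc 0 T) p₁.conjExponent q₁.conjExponent (fun t => F t)

/-! ### The equation with a time-dependent potential -/

/-- `V ∈ C(I; L^r(ℝⁿ))`. -/
def ContinuousInLp {n : ℕ} (I : Set ℝ) (r : ℝ≥0∞) (V : ℝ → Space n → ℝ) : Prop :=
  ∀ t ∈ I, MemLp (V t) r volume ∧
    Tendsto (fun s => eLpNorm (fun x => V s x - V t x) r volume) (𝓝[I] t) (𝓝 0)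

/-- `F ∈ L^{p'}(I; L^{q'}(ℝⁿ))`, where `p', q'` are the exponents conjugate to `p, q`. -/
def IsSource {n : ℕ} (I : Set ℝ) (p q : ℝ≥0∞) (F : ℝ → Space n → ℂ) : Prop :=
  AEStronglyMeasurable (Function.uncurry F) ((volume.restrict I).prod volume) ∧
    mixedNorm I p.conjExponent q.conjExponent F < ⊤

/-- `u ∈ C(I; L²)` (where `I = [0, T]` or `I = [0, ∞)`) solves the integral equation
`u(t) = e^{itΔ} u₀ + i ∫₀ᵗ e^{i(t-s)Δ} [F(s) - V(s) u(s)] ds`.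
Since `F(s) - V(s) u(s)` is in general not in `L²`, `e^{itΔ}` acts on it by transposition,
`⟨e^{itΔ} g, φ⟩ = ⟨g, e^{itΔ} φ⟩` for Schwartz functions `φ`, where `⟨g, φ⟩ = ∫ g φ dx`, and the
time integral is taken in this weak sense. The local bound in `L² L^{2n/(n-2)}` makes
`V u ∈ L²_loc(I; L^{2n/(n+2)})` when `V ∈ C(I; L^{n/2})`, so that all integrals converge. -/
structure IsMildSolution {n : ℕ} (I : Set ℝ) (V : ℝ → Space n → ℝ) (u₀ : L2 n)
    (F : ℝ → Space n → ℂ) (u : ℝ → L2 n) : Prop where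
  continuousOn : ContinuousOn u I
  finite : ∀ t ∈ I,
    mixedNorm (Icc 0 t) 2 (2 * (n : ℝ≥0∞) / ((n : ℝ≥0∞) - 2)) (fun s => u s) < ⊤
  integral_eq : ∀ t ∈ I, ∀ φ : 𝓢(Space n, ℂ),
    ∫ x, u t x * φ x =
      (∫ x, u₀ x * freePropagator n t (φ.toLp 2) x) +
        Complex.I * ∫ s in (0 : ℝ)..t,
          ∫ x, (F s x - (V s x : ℂ) * u s x) * freePropagator n (t - s) (φ.toLp 2) x

/-- The solutions satisfy the Strichartz estimates
`‖u‖_{L^p_I L^q} ≤ C ‖u₀‖_{L²} + C ‖F‖_{L^{p̃'}_I L^{q̃'}}` for all admissible pairs. -/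
def StrichartzEstimates {n : ℕ} (I : Set ℝ) (V : ℝ → Space n → ℝ) (C : ℝ≥0∞) : Prop :=
  ∀ p q p₁ q₁ : ℝ≥0∞, Admissible n p q → Admissible n p₁ q₁ →
    ∀ (u₀ : L2 n) (F : ℝ → Space n → ℂ) (u : ℝ → L2 n),
      IsSource I p₁ q₁ F → IsMildSolution I V u₀ F u →
        mixedNorm I p q (fun t => u t) ≤
          C * ‖u₀‖ₑ + C * mixedNorm I p₁.conjExponent q₁.conjExponent F

/-- `I` can be partitioned into `k` subintervals `J` with
`‖V‖_{L^∞(J; L^{n/2})} ≤ (2 C₀)⁻¹`. -/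
def SmallPartition {n : ℕ} (I : Set ℝ) (V : ℝ → Space n → ℝ) (k : ℕ) : Prop :=
  ∃ J : Fin k → Set ℝ, (∀ j, (J j).OrdConnected) ∧ Pairwise (Function.onFun Disjoint J) ∧
    (⋃ j, J j) = I ∧
    ∀ j, eLpNorm (fun t => eLpNorm (V t) ((n : ℝ≥0∞) / 2) volume) ⊤ (volume.restrict (J j)) ≤
      (2 * freeStrichartzConstant n)⁻¹

/-- Unique solvability of the integral equation on `I`, for all `u₀ ∈ L²` and all `F` in the dual of
an admissible space; Strichartz estimates with a finite constant `C_V`, which can be taken to be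
`k (1 + 2 C₀)^k` whenever `I` splits into `k` intervals as in `SmallPartition`; and conservation of
the `L²` norm when `F = 0`. -/
structure WellPosed {n : ℕ} (I : Set ℝ) (V : ℝ → Space n → ℝ) : Prop where
  existsUnique : ∀ p₁ q₁ : ℝ≥0∞, Admissible n p₁ q₁ →
    ∀ (u₀ : L2 n) (F : ℝ → Space n → ℂ), IsSource I p₁ q₁ F →
      ∃ u : ℝ → L2 n, IsMildSolution I V u₀ F u ∧
        ∀ v : ℝ → L2 n, IsMildSolution I V u₀ F v → EqOn v u I
  strichartz : ∃ C : ℝ≥0, StrichartzEstimates I V C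
  strichartz_const : ∀ k : ℕ, SmallPartition I V k →
    StrichartzEstimates I V (k * (1 + 2 * freeStrichartzConstant n) ^ k)
  energy : ∀ (u₀ : L2 n) (u : ℝ → L2 n), IsMildSolution I V u₀ (fun _ _ => 0) u →
    ∀ t ∈ I, ‖u t‖ = ‖u₀‖

end Schrodinger

end

noncomputable section
namespace Schrodinger

/-! ### Exponents -/

/-- The endpoint exponent `2n / (n - 2)`. -/
abbrev sobExp (n : ℕ) : ℝ≥0∞ := 2 * (n : ℝ≥0∞) / ((n : ℝ≥0∞) - 2)

theorem conjExponent_top : ENNReal.conjExponent ⊤ = 1 := by simp [ENNReal.conjExponent]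

theorem conjExponent_two : ENNReal.conjExponent 2 = 2 := by
  have : (2 : ℝ≥0∞) - 1 = 1 := by
    rw [← one_add_one_eq_two]; exact ENNReal.add_sub_cancel_right ENNReal.one_ne_top
  simp [ENNReal.conjExponent, this, one_add_one_eq_two]

theorem one_le_conjExponent (p : ℝ≥0∞) : 1 ≤ p.conjExponent := le_self_add

theorem conjExponent_le_two {p : ℝ≥0∞} (hp : 2 ≤ p) : p.conjExponent ≤ 2 := by
  rw [ENNReal.conjExponent, ← one_add_one_eq_two]
  gcongr
  rw [ENNReal.inv_le_one]
  exact ENNReal.le_sub_of_add_le_left ENNReal.one_ne_top (by rwa [one_add_one_eq_two])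

theorem conjExponent_ne_top {p : ℝ≥0∞} (hp : 2 ≤ p) : p.conjExponent ≠ ⊤ :=
  ((conjExponent_le_two hp).trans_lt ENNReal.ofNat_lt_top).ne

theorem conjExponent_ne_zero (p : ℝ≥0∞) : p.conjExponent ≠ 0 :=
  (zero_lt_one.trans_le (one_le_conjExponent p)).ne'

theorem holderConjugate_of_two_le {p : ℝ≥0∞} (hp : 2 ≤ p) : p.HolderConjugate p.conjExponent :=
  .conjExponent (le_trans (by norm_num) hp)

theorem admissible_top_two (n : ℕ) : Admissible n ⊤ 2 := by
  refine ⟨le_top, le_rfl, ?_, by simp⟩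
  norm_num

theorem sobExp_eq {n : ℕ} (hn : 3 ≤ n) :
    sobExp n = ENNReal.ofReal (2 * n / (n - 2)) := by
  have h : (3 : ℝ) ≤ n := by exact_mod_cast hn
  rw [sobExp, ENNReal.ofReal_div_of_pos (by linarith), ENNReal.ofReal_mul (by norm_num),
    ENNReal.ofReal_sub _ (by norm_num)]
  simp

theorem two_le_sobExp {n : ℕ} (hn : 3 ≤ n) : 2 ≤ sobExp n := by
  have h : (3 : ℝ) ≤ n := by exact_mod_cast hn
  rw [sobExp_eq hn, ← ENNReal.ofReal_ofNat]
  apply ENNReal.ofReal_le_ofReal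
  rw [le_div_iff₀ (by linarith)]
  linarith

theorem conjExponent_sobExp {n : ℕ} (hn : 3 ≤ n) :
    (sobExp n).conjExponent = ENNReal.ofReal (2 * n / (n + 2)) := by
  have h : (3 : ℝ) ≤ n := by exact_mod_cast hn
  have : 0 < (2 * n / (n - 2) : ℝ) - 1 := by
    rw [sub_pos, lt_div_iff₀ (by linarith)]; linarith
  rw [ENNReal.conjExponent, sobExp_eq hn, ← ENNReal.ofReal_one, ← ENNReal.ofReal_sub _ (by norm_num),
    ← ENNReal.ofReal_inv_of_pos this, ← ENNReal.ofReal_add (by norm_num) (by positivity)]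
  congr 1
  have h2 : (n - 2 : ℝ) ≠ 0 := by linarith
  have h3 : (n + 2 : ℝ) ≠ 0 := by linarith
  have : (2 * n / (n - 2) : ℝ) - 1 = (n + 2) / (n - 2) := by field_simp; ring
  rw [this, inv_div]
  field_simp; ring

theorem admissible_two_sobExp {n : ℕ} (hn : 3 ≤ n) : Admissible n 2 (sobExp n) := by
  have h : (3 : ℝ) ≤ n := by exact_mod_cast hn
  refine ⟨le_rfl, two_le_sobExp hn, ?_, by simp; omega⟩
  have h2 : (n : ℝ) - 2 ≠ 0 := by linarith
  have hpos : 0 < 2 * (2 * n / (n - 2) : ℝ) := by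
    have : (0 : ℝ) < n - 2 := by linarith
    positivity
  rw [sobExp_eq hn, ← ENNReal.ofReal_natCast, ← ENNReal.ofReal_ofNat 2, ← ENNReal.ofReal_ofNat 4,
    ← ENNReal.ofReal_inv_of_pos (by norm_num), ← ENNReal.ofReal_mul (by norm_num),
    ← ENNReal.ofReal_div_of_pos hpos,
    ← ENNReal.ofReal_div_of_pos (by norm_num), ← ENNReal.ofReal_add (by norm_num) (by positivity)]
  congr 1
  field_simp
  ring

theorem holderTriple_half_sobExp {n : ℕ} (hn : 3 ≤ n) :
    ENNReal.HolderTriple ((n : ℝ≥0∞) / 2) (sobExp n) (sobExp n).conjExponent := by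
  have h : (3 : ℝ) ≤ n := by exact_mod_cast hn
  have h2 : (0 : ℝ) < n - 2 := by linarith
  constructor
  rw [conjExponent_sobExp hn, sobExp_eq hn, ← ENNReal.ofReal_natCast, ← ENNReal.ofReal_ofNat 2,
    ← ENNReal.ofReal_div_of_pos (by norm_num), ← ENNReal.ofReal_inv_of_pos (by positivity),
    ← ENNReal.ofReal_inv_of_pos (by positivity), ← ENNReal.ofReal_inv_of_pos (by positivity),
    ← ENNReal.ofReal_add (by positivity) (by positivity)]
  congr 1
  field_simp
  ring

theorem half_ne_top (n : ℕ) : (n : ℝ≥0∞) / 2 ≠ ⊤ :=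
  ENNReal.div_ne_top (ENNReal.natCast_ne_top n) (by norm_num)

theorem one_le_half {n : ℕ} (hn : 3 ≤ n) : 1 ≤ (n : ℝ≥0∞) / 2 := by
  rw [ENNReal.le_div_iff_mul_le (by simp) (by simp)]
  simp only [one_mul]
  exact_mod_cast (by omega : 2 ≤ n)

/-! ### Lower semicontinuity of `L^q` norms on `L²` -/

variable {n : ℕ}

theorem lowerSemicontinuous_eLpNorm (q : ℝ≥0∞) :
    LowerSemicontinuous fun f : L2 n => eLpNorm f q volume := by
  rw [lowerSemicontinuous_iff_isClosed_preimage]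
  intro c
  rw [← isSeqClosed_iff_isClosed]
  intro x f hx hf
  have hm := tendstoInMeasure_of_tendsto_Lp hf
  obtain ⟨ns, -, hns⟩ := hm.exists_seq_tendsto_ae
  refine (Lp.eLpNorm_lim_le_liminf_eLpNorm (fun i => Lp.aestronglyMeasurable (x (ns i))) _ hns).trans ?_
  exact liminf_le_of_frequently_le' (Frequently.of_forall fun i => hx (ns i))

theorem aemeasurable_eLpNorm {α : Type*} [MeasurableSpace α] {μ : Measure α} {u : α → L2 n}
    (hu : AEStronglyMeasurable u μ) (q : ℝ≥0∞) :
    AEMeasurable (fun t => eLpNorm (u t) q volume) μ := by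
  borelize (L2 n)
  exact (lowerSemicontinuous_eLpNorm q).measurable.comp_aemeasurable hu.aemeasurable

theorem eLpNorm_L2_two (f : L2 n) : eLpNorm f 2 volume = ‖f‖ₑ := (Lp.enorm_def f).symm

theorem eLpNorm_coe_add_le (f g : L2 n) {q : ℝ≥0∞} (hq : 1 ≤ q) :
    eLpNorm (⇑(f + g)) q volume ≤ eLpNorm f q volume + eLpNorm g q volume := by
  rw [eLpNorm_congr_ae (Lp.coeFn_add f g)]
  exact eLpNorm_add_le (Lp.aestronglyMeasurable f) (Lp.aestronglyMeasurable g) hq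

theorem eLpNorm_coe_smul (c : ℂ) (f : L2 n) (q : ℝ≥0∞) :
    eLpNorm (⇑(c • f)) q volume = ‖c‖ₑ * eLpNorm f q volume := by
  rw [eLpNorm_congr_ae (Lp.coeFn_smul c f), eLpNorm_const_smul]

theorem eLpNorm_coe_neg (f : L2 n) (q : ℝ≥0∞) :
    eLpNorm (⇑(-f)) q volume = eLpNorm f q volume := by
  rw [eLpNorm_congr_ae (Lp.coeFn_neg f), eLpNorm_neg]

/-! ### Mixed norms -/

theorem mixedNorm_congr_ae {I : Set ℝ} {p q : ℝ≥0∞} {u v : ℝ → Space n → ℂ}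
    (h : ∀ᵐ t ∂volume.restrict I, u t =ᵐ[volume] v t) :
    mixedNorm I p q u = mixedNorm I p q v := by
  refine eLpNorm_congr_ae ?_
  filter_upwards [h] with t ht using eLpNorm_congr_ae ht

theorem mixedNorm_mono_set {I J : Set ℝ} (h : J ⊆ I) (p q : ℝ≥0∞) (u : ℝ → Space n → ℂ) :
    mixedNorm J p q u ≤ mixedNorm I p q u :=
  eLpNorm_mono_measure _ (Measure.restrict_mono h le_rfl)

theorem mixedNorm_add_le {I : Set ℝ} {p q : ℝ≥0∞} (hp : 1 ≤ p) (hq : 1 ≤ q) {u v : ℝ → L2 n}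
    (hu : AEStronglyMeasurable u (volume.restrict I))
    (hv : AEStronglyMeasurable v (volume.restrict I)) :
    mixedNorm I p q (fun t => ⇑(u t + v t)) ≤
      mixedNorm I p q (fun t => u t) + mixedNorm I p q (fun t => v t) := by
  refine le_trans ?_ (eLpNorm_add_le (aemeasurable_eLpNorm hu q).aestronglyMeasurable
    (aemeasurable_eLpNorm hv q).aestronglyMeasurable hp)
  refine eLpNorm_mono_enorm fun t => ?_
  simpa using eLpNorm_coe_add_le (u t) (v t) hq

theorem mixedNorm_neg (I : Set ℝ) (p q : ℝ≥0∞) (u : ℝ → L2 n) :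
    mixedNorm I p q (fun t => ⇑(-u t)) = mixedNorm I p q (fun t => u t) := by
  simp only [mixedNorm, eLpNorm_coe_neg]

theorem mixedNorm_smul_of_norm_one (I : Set ℝ) (p q : ℝ≥0∞) (u : ℝ → L2 n) {c : ℂ} (hc : ‖c‖ = 1) :
    mixedNorm I p q (fun t => ⇑(c • u t)) = mixedNorm I p q (fun t => u t) := by
  have : ‖c‖ₑ = 1 := by rw [← ofReal_norm, hc, ENNReal.ofReal_one]
  simp only [mixedNorm, eLpNorm_coe_smul, this, one_mul]

theorem mixedNorm_union_le {I J : Set ℝ} {p q : ℝ≥0∞} (hp : 1 ≤ p) {u : ℝ → L2 n}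
    (hI : MeasurableSet I) (hJ : MeasurableSet J)
    (hu : AEStronglyMeasurable u (volume.restrict (I ∪ J))) :
    mixedNorm (I ∪ J) p q (fun t => u t) ≤
      mixedNorm I p q (fun t => u t) + mixedNorm J p q (fun t => u t) := by
  set f := fun t => eLpNorm (u t) q volume
  have hf : AEStronglyMeasurable f (volume.restrict (I ∪ J)) :=
    (aemeasurable_eLpNorm hu q).aestronglyMeasurable
  have h1 : eLpNorm f p (volume.restrict (I ∪ J)) ≤
      eLpNorm (I.indicator f + J.indicator f) p (volume.restrict (I ∪ J)) := by
    refine eLpNorm_mono_enorm_ae ?_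
    filter_upwards [ae_restrict_mem (hI.union hJ)] with t ht
    rcases ht with h | h <;> simp [indicator, h]
  refine h1.trans ((eLpNorm_add_le (hf.indicator hI) (hf.indicator hJ) hp).trans ?_)
  rw [eLpNorm_indicator_eq_eLpNorm_restrict hI, eLpNorm_indicator_eq_eLpNorm_restrict hJ,
    Measure.restrict_restrict hI, Measure.restrict_restrict hJ,
    inter_eq_left.2 subset_union_left, inter_eq_left.2 subset_union_right]
  rfl

/-- Fatou's lemma for `L^p` norms of `[0, ∞]`-valued functions. -/
theorem eLpNorm_le_of_le_liminf {α : Type*} [MeasurableSpace α] {μ : Measure α} {p : ℝ≥0∞}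
    {f : α → ℝ≥0∞} {g : ℕ → α → ℝ≥0∞} (hg : ∀ k, AEMeasurable (g k) μ)
    (h : ∀ᵐ t ∂μ, f t ≤ liminf (fun k => g k t) atTop) :
    eLpNorm f p μ ≤ liminf (fun k => eLpNorm (g k) p μ) atTop := by
  rcases eq_or_ne p 0 with rfl | hp0
  · simp
  rcases eq_or_ne p ⊤ with rfl | hpt
  · simp only [eLpNorm_exponent_top]
    exact le_trans (essSup_mono_ae h) (ENNReal.essSup_liminf_le _)
  · have hp : 0 < p.toReal := ENNReal.toReal_pos hp0 hpt
    have hmono : ∀ v : ℕ → ℝ≥0∞, ∀ {r : ℝ}, 0 < r →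
        (liminf v atTop) ^ r = liminf (fun k => v k ^ r) atTop := fun v r hr => by
      refine ((ENNReal.strictMono_rpow_of_pos hr).orderIsoOfSurjective _
        (ENNReal.rpow_left_bijective hr.ne').2).liminf_apply ?_ ?_ ?_ ?_
      all_goals isBoundedDefault
    simp only [eLpNorm_eq_lintegral_rpow_enorm_toReal hp0 hpt, enorm_eq_self]
    rw [← hmono _ (by positivity : 0 < 1 / p.toReal)]
    gcongr
    refine le_trans (lintegral_mono_ae ?_) (lintegral_liminf_le' fun k => (hg k).pow_const _)
    filter_upwards [h] with t ht
    rw [← hmono _ hp]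
    gcongr

theorem mixedNorm_le_of_tendsto {I : Set ℝ} {p q : ℝ≥0∞} {u : ℝ → L2 n} {v : ℕ → ℝ → L2 n}
    {B : ℝ≥0∞}
    (hv : ∀ k, AEStronglyMeasurable (v k) (volume.restrict I))
    (h : ∀ᵐ t ∂volume.restrict I, Tendsto (fun k => v k t) atTop (𝓝 (u t)))
    (hB : ∃ᶠ k in atTop, mixedNorm I p q (fun t => v k t) ≤ B) :
    mixedNorm I p q (fun t => u t) ≤ B := by
  refine (eLpNorm_le_of_le_liminf (fun k => aemeasurable_eLpNorm (hv k) q) ?_).trans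
    (liminf_le_of_frequently_le' hB)
  filter_upwards [h] with t ht
  refine ((lowerSemicontinuous_eLpNorm q).lowerSemicontinuousAt (u t)).le_liminf.trans ?_
  exact liminf_le_liminf_of_le ht

theorem enorm_le_mixedNorm_top {a b : ℝ} (hab : a < b) {u : ℝ → L2 n}
    (hu : ContinuousOn u (Icc a b)) {t : ℝ} (ht : t ∈ Icc a b) :
    ‖u t‖ₑ ≤ mixedNorm (Icc a b) ⊤ 2 (fun s => u s) := by
  set c := mixedNorm (Icc a b) ⊤ 2 (fun s => u s) with hc
  have h1 : ∀ᵐ s ∂volume.restrict (Icc a b), ‖u s‖ₑ ≤ c := by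
    have := enorm_ae_le_eLpNormEssSup (fun s => eLpNorm (u s) 2 volume) (volume.restrict (Icc a b))
    filter_upwards [this] with s hs
    simpa [hc, mixedNorm, eLpNorm_L2_two] using hs
  have h2 : (fun s => min ‖u s‖ₑ c) =ᵐ[volume.restrict (Icc a b)] fun s => ‖u s‖ₑ := by
    filter_upwards [h1] with s hs using min_eq_left hs
  have h3 := Measure.eqOn_Icc_of_ae_eq volume hab.ne h2 (hu.enorm.inf continuousOn_const) hu.enorm ht
  exact min_eq_left_iff.1 h3

theorem mixedNorm_top_le {I : Set ℝ} (hI : MeasurableSet I) {u : ℝ → L2 n} {c : ℝ≥0∞}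
    (h : ∀ t ∈ I, ‖u t‖ₑ ≤ c) : mixedNorm I ⊤ 2 (fun s => u s) ≤ c := by
  rw [mixedNorm, eLpNorm_exponent_top]
  refine eLpNormEssSup_le_of_ae_enorm_bound ?_
  filter_upwards [ae_restrict_mem hI] with t ht
  simpa [eLpNorm_L2_two] using h t ht

theorem mixedNorm_one_le {a b : ℝ} (p q : ℝ≥0∞) (hp : 1 ≤ p) {u : ℝ → Space n → ℂ}
    (hu : AEMeasurable (fun t => eLpNorm (u t) q volume) (volume.restrict (Icc a b))) :
    ∫⁻ t in Icc a b, eLpNorm (u t) q volume ≤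
      mixedNorm (Icc a b) p q u * (ENNReal.ofReal (b - a)) ^ (1 - 1 / p.toReal) := by
  have := eLpNorm_le_eLpNorm_mul_rpow_measure_univ hp hu.aestronglyMeasurable
  simpa [eLpNorm_one_eq_lintegral_enorm, mixedNorm] using this

theorem mixedNorm_Ici_le {p q : ℝ≥0∞} {u : ℝ → L2 n} {B : ℝ≥0∞}
    (hu : AEStronglyMeasurable u (volume.restrict (Ici 0)))
    (h : ∀ T : ℝ, 0 < T → mixedNorm (Icc 0 T) p q (fun t => u t) ≤ B) :
    mixedNorm (Ici 0) p q (fun t => u t) ≤ B := by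
  have : eLpNorm (fun t => eLpNorm (u t) q volume) p (volume.restrict (Ici 0)) ≤
      liminf (fun k : ℕ => eLpNorm ((Icc 0 (k + 1 : ℝ)).indicator
        (fun t => eLpNorm (u t) q volume)) p (volume.restrict (Ici 0))) atTop := by
    refine eLpNorm_le_of_le_liminf
      (fun k => (aemeasurable_eLpNorm hu q).indicator measurableSet_Icc) ?_
    filter_upwards [ae_restrict_mem measurableSet_Ici] with t ht
    refine le_of_eq (Tendsto.liminf_eq ?_).symm
    refine tendsto_const_nhds.congr' ?_
    obtain ⟨k, hk⟩ := exists_nat_ge t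
    filter_upwards [eventually_ge_atTop k] with j hj
    have : (k : ℝ) ≤ j := by exact_mod_cast hj
    rw [indicator_of_mem]
    exact ⟨ht, by linarith⟩
  refine this.trans (liminf_le_of_frequently_le' (Frequently.of_forall fun k => ?_))
  rw [eLpNorm_indicator_eq_eLpNorm_restrict measurableSet_Icc,
    Measure.restrict_restrict measurableSet_Icc, inter_eq_left.2 Icc_subset_Ici_self]
  exact h _ (by positivity)

/-! ### The free group -/

theorem norm_freeSymbolFun (t : ℝ) (ξ : Space n) : ‖freeSymbolFun n t ξ‖ = 1 := by
  rw [freeSymbolFun, ← Complex.ofReal_neg, Complex.norm_exp_ofReal_mul_I]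

theorem hasTemperateGrowth_exp_mul_I :
    Function.HasTemperateGrowth fun s : ℝ => Complex.exp (s * Complex.I) := by
  have hc : ContDiff ℝ ∞ fun s : ℝ => Complex.exp (s * Complex.I) := by
    have : ContDiff ℝ ∞ fun s : ℝ => (s : ℂ) := Complex.ofRealCLM.contDiff
    exact (this.mul contDiff_const).cexp
  refine ⟨hc, fun k => ⟨0, 1, fun x => ?_⟩⟩
  have h : ∀ k : ℕ, iteratedDeriv k (fun s : ℝ => Complex.exp (s * Complex.I)) =
      fun s : ℝ => Complex.I ^ k * Complex.exp (s * Complex.I) := by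
    intro k
    induction k with
    | zero => simp
    | succ k ih =>
      rw [iteratedDeriv_succ, ih]
      funext s
      have h1 : HasDerivAt (fun s : ℝ => (s : ℂ) * Complex.I) (1 * Complex.I) s :=
        Complex.ofRealCLM.hasDerivAt.mul_const _
      rw [(h1.cexp.const_mul (Complex.I ^ k)).deriv]
      ring
  rw [norm_iteratedFDeriv_eq_norm_iteratedDeriv, h]
  simp [Complex.norm_exp_ofReal_mul_I]

theorem hasTemperateGrowth_freeSymbolFun (t : ℝ) :
    (freeSymbolFun n t).HasTemperateGrowth := by
  have h : Function.HasTemperateGrowth fun ξ : Space n => -(4 * Real.pi ^ 2 * t) * ‖ξ‖ ^ 2 :=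
    (Function.HasTemperateGrowth.const _).mul (Function.hasTemperateGrowth_norm_sq _)
  have := hasTemperateGrowth_exp_mul_I.comp h
  have h' : freeSymbolFun n t = (fun s : ℝ => Complex.exp (s * Complex.I)) ∘
      fun ξ : Space n => -(4 * Real.pi ^ 2 * t) * ‖ξ‖ ^ 2 := by
    funext ξ
    simp [freeSymbolFun]
  rwa [h']

theorem coeFn_freeSymbol_smul (t : ℝ) (g : L2 n) :
    ⇑((memLp_freeSymbolFun n t).toLp (freeSymbolFun n t) • g : L2 n) =ᵐ[volume]
      fun ξ => freeSymbolFun n t ξ * g ξ := by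
  filter_upwards [Lp.coeFn_lpSMul ((memLp_freeSymbolFun n t).toLp (freeSymbolFun n t)) g (r := 2),
    (memLp_freeSymbolFun n t).coeFn_toLp] with ξ h1 h2
  rw [h1, Pi.smul_apply', h2, smul_eq_mul]

theorem norm_freePropagator (t : ℝ) (f : L2 n) : ‖freePropagator n t f‖ = ‖f‖ := by
  have h1 : ∀ g : L2 n, ‖𝓕⁻ g‖ = ‖g‖ := (Lp.fourierTransformₗᵢ (Space n) ℂ).symm.norm_map
  rw [freePropagator, h1, ← Lp.norm_fourier_eq f, Lp.norm_def, Lp.norm_def]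
  congr 1
  refine eLpNorm_congr_norm_ae ?_
  filter_upwards [coeFn_freeSymbol_smul t (𝓕 f)] with ξ h
  rw [h, norm_mul, norm_freeSymbolFun, one_mul]

/-- The free propagator as a bounded operator. -/
def freeGroup (n : ℕ) (t : ℝ) : L2 n →L[ℂ] L2 n :=
  LinearMap.mkContinuous
    { toFun := freePropagator n t
      map_add' := fun f g => by
        simp only [freePropagator, FourierTransform.fourier_add, Lp.add_smul,
          FourierTransform.fourierInv_add]
      map_smul' := fun c f => by
        simp only [freePropagator, FourierTransform.fourier_smul, RingHom.id_apply]
        rw [← Lp.smul_comm, FourierTransform.fourierInv_smul] } 1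
    (fun f => by rw [one_mul]; exact (norm_freePropagator t f).le)

theorem freeGroup_apply (t : ℝ) (f : L2 n) : freeGroup n t f = freePropagator n t f := rfl

theorem norm_freeGroup (t : ℝ) (f : L2 n) : ‖freeGroup n t f‖ = ‖f‖ := norm_freePropagator t f

theorem fourier_freeGroup (t : ℝ) (f : L2 n) :
    𝓕 (freeGroup n t f) = ((memLp_freeSymbolFun n t).toLp (freeSymbolFun n t) • 𝓕 f : L2 n) := by
  rw [freeGroup_apply, freePropagator, FourierTransform.fourier_fourierInv_eq]

theorem fourier_L2_injective : Function.Injective (𝓕 : L2 n → L2 n) :=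
  (Lp.fourierTransformₗᵢ (Space n) ℂ).injective

theorem freeGroup_zero (f : L2 n) : freeGroup n 0 f = f := by
  apply fourier_L2_injective
  rw [fourier_freeGroup]
  apply Lp.ext
  filter_upwards [coeFn_freeSymbol_smul 0 (𝓕 f)] with ξ h
  simp [h, freeSymbolFun]

theorem freeGroup_add (s t : ℝ) (f : L2 n) :
    freeGroup n (s + t) f = freeGroup n s (freeGroup n t f) := by
  apply fourier_L2_injective
  rw [fourier_freeGroup, fourier_freeGroup, fourier_freeGroup]
  apply Lp.ext
  filter_upwards [coeFn_freeSymbol_smul (s + t) (𝓕 f), coeFn_freeSymbol_smul t (𝓕 f),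
    coeFn_freeSymbol_smul s ((memLp_freeSymbolFun n t).toLp (freeSymbolFun n t) • 𝓕 f : L2 n)]
    with ξ h1 h2 h3
  rw [h1, h3, h2, ← mul_assoc]
  congr 1
  simp only [freeSymbolFun, ← Complex.exp_add]
  congr 1
  push_cast
  ring

theorem freeGroup_neg_self (t : ℝ) (f : L2 n) : freeGroup n (-t) (freeGroup n t f) = f := by
  rw [← freeGroup_add, neg_add_cancel, freeGroup_zero]

theorem freeGroup_self_neg (t : ℝ) (f : L2 n) : freeGroup n t (freeGroup n (-t) f) = f := by
  rw [← freeGroup_add, add_neg_cancel, freeGroup_zero]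

/-- The inclusion of Schwartz functions in `L²`. -/
def schL2 (n : ℕ) : 𝓢(Space n, ℂ) →L[ℂ] L2 n :=
  SchwartzMap.toLpCLM ℂ ℂ 2 volume

theorem coeFn_schL2 (φ : 𝓢(Space n, ℂ)) : schL2 n φ =ᵐ[volume] φ := φ.coeFn_toLp 2

theorem fourier_schL2 (φ : 𝓢(Space n, ℂ)) : 𝓕 (schL2 n φ) = schL2 n (𝓕 φ) :=
  SchwartzMap.toLp_fourier_eq φ

theorem denseRange_schL2 (n : ℕ) : DenseRange (schL2 n) :=
  SchwartzMap.denseRange_toLpCLM (E := Space n) (F := ℂ) (p := 2) ENNReal.ofNat_ne_top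

/-- The free evolution of a Schwartz function. -/
def freeSchwartz (n : ℕ) (t : ℝ) : 𝓢(Space n, ℂ) →L[ℂ] 𝓢(Space n, ℂ) :=
  SchwartzMap.fourierMultiplierCLM ℂ (freeSymbolFun n t)

theorem fourier_freeSchwartz_apply (t : ℝ) (φ : 𝓢(Space n, ℂ)) (ξ : Space n) :
    𝓕 (freeSchwartz n t φ) ξ = freeSymbolFun n t ξ * 𝓕 φ ξ := by
  rw [freeSchwartz, SchwartzMap.fourierMultiplierCLM_apply, FourierTransform.fourier_fourierInv_eq,
    SchwartzMap.smulLeftCLM_apply_apply (hasTemperateGrowth_freeSymbolFun t), smul_eq_mul]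

theorem freeGroup_schL2 (t : ℝ) (φ : 𝓢(Space n, ℂ)) :
    freeGroup n t (schL2 n φ) = schL2 n (freeSchwartz n t φ) := by
  apply fourier_L2_injective
  rw [fourier_freeGroup, fourier_schL2, fourier_schL2]
  apply Lp.ext
  filter_upwards [coeFn_freeSymbol_smul t (schL2 n (𝓕 φ)), coeFn_schL2 (𝓕 φ),
    coeFn_schL2 (𝓕 (freeSchwartz n t φ))] with ξ h1 h2 h3
  rw [h1, h2, h3, fourier_freeSchwartz_apply]

theorem fourier_laplacian_apply (φ : 𝓢(Space n, ℂ)) (ξ : Space n) :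
    𝓕 (Laplacian.laplacian φ) ξ = -((4 * Real.pi ^ 2 * ‖ξ‖ ^ 2 : ℝ) : ℂ) * 𝓕 φ ξ := by
  have h : Function.HasTemperateGrowth fun ξ : Space n => ‖ξ‖ ^ 2 :=
    Function.hasTemperateGrowth_norm_sq _
  have e : 𝓕 (Laplacian.laplacian φ) =
      (-(2 * Real.pi) ^ 2 : ℝ) • SchwartzMap.smulLeftCLM ℂ (fun ξ : Space n => ‖ξ‖ ^ 2) (𝓕 φ) := by
    rw [SchwartzMap.laplacian_eq_fourierMultiplierCLM, SchwartzMap.fourierMultiplierCLM_apply]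
    rw [← FourierTransform.fourierInv_smul, FourierTransform.fourier_fourierInv_eq]
  rw [e, _root_.smul_apply, SchwartzMap.smulLeftCLM_apply_apply h]
  simp only [Complex.real_smul]
  push_cast
  ring

theorem norm_exp_sub_one_sub_le (θ : ℝ) :
    ‖Complex.exp (θ * Complex.I) - 1 - θ * Complex.I‖ ≤ 3 * θ ^ 2 := by
  rcases le_total |θ| 1 with h | h
  · have := Complex.norm_exp_sub_one_sub_id_le (x := θ * Complex.I) (by simpa using h)
    refine this.trans ?_
    simp only [norm_mul, Complex.norm_real, Complex.norm_I, mul_one, Real.norm_eq_abs, sq_abs]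
    nlinarith [sq_nonneg θ]
  · calc _ ≤ ‖Complex.exp (θ * Complex.I)‖ + ‖(1 : ℂ)‖ + ‖θ * Complex.I‖ :=
        (norm_sub_le _ _).trans (add_le_add_left (norm_sub_le _ _) _)
      _ = 2 + |θ| := by
        rw [Complex.norm_exp_ofReal_mul_I]; simp; norm_num
      _ ≤ 3 * θ ^ 2 := by
        rw [← sq_abs]
        nlinarith

theorem norm_schL2_le_of_fourier_le {φ ψ : 𝓢(Space n, ℂ)} {c : ℝ}
    (h : ∀ ξ, ‖𝓕 φ ξ‖ ≤ c * ‖𝓕 ψ ξ‖) : ‖schL2 n φ‖ ≤ c * ‖schL2 n ψ‖ := by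
  rw [← Lp.norm_fourier_eq, ← Lp.norm_fourier_eq (schL2 n ψ), fourier_schL2,
    fourier_schL2]
  refine Lp.norm_le_mul_norm_of_ae_le_mul ?_
  filter_upwards [coeFn_schL2 (𝓕 φ), coeFn_schL2 (𝓕 ψ)] with ξ h1 h2
  rw [h1, h2]
  exact h ξ

theorem fourier_schwartz_sub (φ ψ : 𝓢(Space n, ℂ)) : 𝓕 (φ - ψ) = 𝓕 φ - 𝓕 ψ :=
  map_sub (SchwartzMap.fourierTransformCLM ℂ) φ ψ

theorem hasDerivAt_freeGroup_schL2 (φ : 𝓢(Space n, ℂ)) (t : ℝ) :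
    HasDerivAt (fun r => freeGroup n r (schL2 n φ))
      (Complex.I • freeGroup n t (schL2 n (Laplacian.laplacian φ))) t := by
  set ψ := Laplacian.laplacian (Laplacian.laplacian φ) with hψ
  have key : ∀ h : ℝ, ‖freeGroup n h (schL2 n φ) - schL2 n φ -
      h • Complex.I • schL2 n (Laplacian.laplacian φ)‖ ≤ 3 * h ^ 2 * ‖schL2 n ψ‖ := by
    intro h
    have e : freeGroup n h (schL2 n φ) - schL2 n φ -
        h • Complex.I • schL2 n (Laplacian.laplacian φ) =
        schL2 n (freeSchwartz n h φ - φ - (h * Complex.I) • Laplacian.laplacian φ) := by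
      rw [freeGroup_schL2]
      have hs : h • Complex.I • schL2 n (Laplacian.laplacian φ) =
        ((h : ℂ) * Complex.I) • schL2 n (Laplacian.laplacian φ) := by
        rw [mul_smul]; rfl
      rw [hs]
      simp only [map_sub, map_smul]
    rw [e]
    refine norm_schL2_le_of_fourier_le fun ξ => ?_
    rw [hψ, fourier_laplacian_apply, fourier_laplacian_apply]
    have e2 : 𝓕 (freeSchwartz n h φ - φ - (h * Complex.I) • Laplacian.laplacian φ) ξ =
        (Complex.exp ((-(4 * Real.pi ^ 2 * h * ‖ξ‖ ^ 2) : ℝ) * Complex.I) - 1 -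
          (-(4 * Real.pi ^ 2 * h * ‖ξ‖ ^ 2) : ℝ) * Complex.I) * 𝓕 φ ξ := by
      rw [fourier_schwartz_sub, fourier_schwartz_sub,
        FourierTransform.fourier_smul, _root_.sub_apply, _root_.sub_apply,
        _root_.smul_apply, fourier_freeSchwartz_apply, fourier_laplacian_apply]
      simp only [freeSymbolFun, smul_eq_mul]
      push_cast
      ring
    rw [e2, norm_mul]
    have := norm_exp_sub_one_sub_le (-(4 * Real.pi ^ 2 * h * ‖ξ‖ ^ 2))
    refine (mul_le_mul_of_nonneg_right this (norm_nonneg _)).trans_eq ?_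
    rw [norm_mul, norm_mul, norm_neg, Complex.norm_real, Real.norm_of_nonneg (by positivity)]
    ring
  rw [hasDerivAt_iff_isLittleO_nhds_zero]
  have hO : (fun h : ℝ => freeGroup n (t + h) (schL2 n φ) - freeGroup n t (schL2 n φ) -
      h • Complex.I • freeGroup n t (schL2 n (Laplacian.laplacian φ))) =O[𝓝 0]
      fun h : ℝ => h ^ 2 := by
    refine Asymptotics.IsBigO.of_bound (3 * ‖schL2 n ψ‖) (Eventually.of_forall fun h => ?_)
    have : freeGroup n (t + h) (schL2 n φ) - freeGroup n t (schL2 n φ) -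
      h • Complex.I • freeGroup n t (schL2 n (Laplacian.laplacian φ)) =
      freeGroup n t (freeGroup n h (schL2 n φ) - schL2 n φ -
      h • Complex.I • schL2 n (Laplacian.laplacian φ)) := by
      rw [freeGroup_add, map_sub, map_sub, ContinuousLinearMap.map_smul_of_tower, map_smul]
    rw [this, norm_freeGroup]
    refine (key h).trans_eq ?_
    rw [Real.norm_of_nonneg (by positivity)]
    ring
  refine hO.trans_isLittleO ?_
  simpa using Asymptotics.isLittleO_pow_id (𝕜 := ℝ) (n := 2) (by norm_num)

theorem continuous_freeGroup_apply (f : L2 n) : Continuous fun t => freeGroup n t f := by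
  refine continuous_of_uniform_approx_of_continuous fun u hu => ?_
  obtain ⟨ε, hε, h⟩ := Metric.mem_uniformity_dist.1 hu
  obtain ⟨φ, hφ⟩ := (denseRange_schL2 n).exists_dist_lt f hε
  refine ⟨fun t => freeGroup n t (schL2 n φ),
    continuous_iff_continuousAt.2 fun t => (hasDerivAt_freeGroup_schL2 φ t).continuousAt,
    fun t => h ?_⟩
  rwa [dist_eq_norm, ← map_sub, norm_freeGroup, ← dist_eq_norm]

/-- A strongly continuous family of isometries is jointly continuous. -/
theorem continuous_uncurry_of_isometry {U : ℝ → L2 n →L[ℂ] L2 n} (hU : ∀ t f, ‖U t f‖ = ‖f‖)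
    (hc : ∀ f, Continuous fun t => U t f) : Continuous fun x : ℝ × L2 n => U x.1 x.2 := by
  rw [continuous_iff_continuousAt]
  rintro ⟨t, f⟩
  rw [ContinuousAt, tendsto_iff_norm_sub_tendsto_zero]
  have h1 : Tendsto (fun x : ℝ × L2 n => ‖x.2 - f‖ + ‖U x.1 f - U t f‖) (𝓝 (t, f)) (𝓝 0) := by
    have ha : Continuous fun x : ℝ × L2 n => ‖x.2 - f‖ + ‖U x.1 f - U t f‖ :=
      (continuous_snd.sub continuous_const).norm.add
        (((hc f).comp continuous_fst).sub continuous_const).norm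
    simpa using ha.tendsto (t, f)
  refine squeeze_zero (fun _ => norm_nonneg _) (fun x => ?_) h1
  calc ‖U x.1 x.2 - U t f‖ = ‖U x.1 (x.2 - f) + (U x.1 f - U t f)‖ := by
        rw [map_sub]; congr 1; abel
    _ ≤ ‖x.2 - f‖ + ‖U x.1 f - U t f‖ := by
        refine (norm_add_le _ _).trans_eq ?_
        rw [hU]

theorem inner_freeGroup_left (t : ℝ) (f g : L2 n) :
    inner ℂ (freeGroup n t f) g = inner ℂ f (freeGroup n (-t) g) := by
  have h : ∀ f g : L2 n, inner ℂ (freeGroup n t f) (freeGroup n t g) = inner ℂ f g :=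
    (LinearIsometry.mk (freeGroup n t).toLinearMap (norm_freeGroup t)).inner_map_map
  conv_lhs => rw [← freeGroup_self_neg t g, h]

/-- The bilinear pairing `∫ f g`. -/
def pair (n : ℕ) : L2 n →L[ℂ] L2 n →L[ℂ] ℂ :=
  (ContinuousLinearMap.mul ℂ ℂ).lpPairing volume 2 2

theorem pair_apply (f g : L2 n) : pair n f g = ∫ x, f x * g x :=
  ContinuousLinearMap.lpPairing_eq_integral _ f g

theorem pair_schL2 (φ ψ : 𝓢(Space n, ℂ)) : pair n (schL2 n φ) (schL2 n ψ) = ∫ x, φ x * ψ x := by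
  rw [pair_apply]
  refine integral_congr_ae ?_
  filter_upwards [coeFn_schL2 φ, coeFn_schL2 ψ] with x h1 h2
  rw [h1, h2]

theorem pair_freeGroup (t : ℝ) (f g : L2 n) :
    pair n (freeGroup n t f) g = pair n f (freeGroup n t g) := by
  refine (denseRange_schL2 n).induction_on₂
    (p := fun f g => pair n (freeGroup n t f) g = pair n f (freeGroup n t g)) ?_ ?_ f g
  · refine isClosed_eq ?_ ?_ <;> fun_prop
  · intro φ ψ
    rw [freeGroup_schL2, freeGroup_schL2, pair_schL2, pair_schL2]
    have h1 : ∀ φ ψ : 𝓢(Space n, ℂ), ∫ x, freeSchwartz n t φ x * ψ x =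
        ∫ ξ, freeSymbolFun n t ξ * (𝓕 φ ξ * 𝓕 ψ (-ξ)) := by
      intro φ ψ
      rw [freeSchwartz, SchwartzMap.fourierMultiplierCLM_apply,
        SchwartzMap.integral_fourierInv_mul_eq]
      refine integral_congr_ae (ae_of_all _ fun ξ => ?_)
      simp only [SchwartzMap.smulLeftCLM_apply_apply (hasTemperateGrowth_freeSymbolFun t),
        smul_eq_mul]
      rw [mul_assoc]
      congr 2
    simp_rw [mul_comm (φ _)]
    rw [h1, h1, ← integral_neg_eq_self]
    refine integral_congr_ae (ae_of_all _ fun ξ => ?_)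
    simp only [neg_neg]
    rw [mul_comm (𝓕 ψ ξ)]
    simp [freeSymbolFun]

theorem norm_freeSchwartz_le (φ : 𝓢(Space n, ℂ)) :
    ∃ K : ℝ, 0 ≤ K ∧ ∀ t x, ‖freeSchwartz n t φ x‖ ≤ K := by
  refine ⟨∫ ξ, ‖𝓕 φ ξ‖, by positivity, fun t x => ?_⟩
  set a := SchwartzMap.smulLeftCLM ℂ (freeSymbolFun n t) (𝓕 φ) with ha
  have h1 : freeSchwartz n t φ x = 𝓕 a (-x) := rfl
  rw [h1]
  refine (SchwartzMap.norm_fourier_apply_le_toLp_one a (-x)).trans_eq ?_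
  rw [SchwartzMap.norm_toLp_one]
  refine integral_congr_ae (ae_of_all _ fun ξ => ?_)
  simp only [ha, SchwartzMap.smulLeftCLM_apply_apply (hasTemperateGrowth_freeSymbolFun t),
    smul_eq_mul, norm_mul, norm_freeSymbolFun, one_mul]

theorem eLpNorm_le_of_norm_le {f : Space n → ℂ} {K : ℝ≥0} (hf : ∀ᵐ x, ‖f x‖ₑ ≤ K) {q : ℝ≥0∞}
    (hq : 2 ≤ q) (hqt : q ≠ ⊤) :
    eLpNorm f q volume ≤ ((K : ℝ≥0∞) ^ (q.toReal - 2) * (eLpNorm f 2 volume) ^ 2) ^ (1 / q.toReal) := by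
  have hq0 : q ≠ 0 := (lt_of_lt_of_le (by norm_num) hq).ne'
  have hq2 : (2 : ℝ) ≤ q.toReal := by
    simpa using (ENNReal.toReal_le_toReal (by norm_num) hqt).2 hq
  rw [eLpNorm_eq_lintegral_rpow_enorm_toReal hq0 hqt,
    eLpNorm_eq_lintegral_rpow_enorm_toReal (by norm_num) (by norm_num)]
  gcongr
  have : ((∫⁻ x, ‖f x‖ₑ ^ (2 : ℝ≥0∞).toReal) ^ (1 / (2 : ℝ≥0∞).toReal)) ^ 2 =
      ∫⁻ x, ‖f x‖ₑ ^ (2 : ℝ) := by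
    rw [← ENNReal.rpow_natCast, ← ENNReal.rpow_mul]
    norm_num
  rw [this, ← lintegral_const_mul' _ _ (ENNReal.rpow_ne_top_of_nonneg (by linarith) (by simp))]
  refine lintegral_mono_ae ?_
  filter_upwards [hf] with x hx
  have h2 : ‖f x‖ₑ ^ q.toReal = ‖f x‖ₑ ^ (q.toReal - 2) * ‖f x‖ₑ ^ (2 : ℝ) := by
    rw [← ENNReal.rpow_add_of_nonneg _ _ (by linarith) (by norm_num)]
    ring_nf
  rw [h2]
  gcongr

theorem exists_eLpNorm_freeGroup_schL2_le (φ : 𝓢(Space n, ℂ)) {q : ℝ≥0∞} (hq : 2 ≤ q) :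
    ∃ K : ℝ≥0, ∀ t, eLpNorm (freeGroup n t (schL2 n φ)) q volume ≤ K := by
  obtain ⟨K, hK0, hK⟩ := norm_freeSchwartz_le φ
  have h1 : ∀ t, ∀ᵐ x, ‖freeGroup n t (schL2 n φ) x‖ₑ ≤ K.toNNReal := by
    intro t
    rw [freeGroup_schL2]
    filter_upwards [coeFn_schL2 (freeSchwartz n t φ)] with x hx
    rw [hx, ← ofReal_norm]
    exact ENNReal.ofReal_le_ofReal (hK t x)
  rcases eq_or_ne q ⊤ with rfl | hqt
  · refine ⟨K.toNNReal, fun t => ?_⟩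
    rw [eLpNorm_exponent_top]
    exact eLpNormEssSup_le_of_ae_enorm_bound (h1 t)
  · have hq2 : (2 : ℝ) ≤ q.toReal := by
      simpa using (ENNReal.toReal_le_toReal (by norm_num) hqt).2 hq
    set B : ℝ≥0∞ := ((K.toNNReal : ℝ≥0∞) ^ (q.toReal - 2) * ‖schL2 n φ‖ₑ ^ 2) ^ (1 / q.toReal)
    have hB : B ≠ ⊤ := by
      refine ENNReal.rpow_ne_top_of_nonneg (by positivity) (ENNReal.mul_ne_top ?_ ?_)
      · exact ENNReal.rpow_ne_top_of_nonneg (by linarith) (by simp)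
      · exact ENNReal.pow_ne_top enorm_ne_top
    refine ⟨B.toNNReal, fun t => ?_⟩
    rw [ENNReal.coe_toNNReal hB]
    refine (eLpNorm_le_of_norm_le (h1 t) hq hqt).trans_eq ?_
    rw [eLpNorm_L2_two, ← ofReal_norm, norm_freeGroup, ofReal_norm]

/-! ### Dominated convergence in `L^p` -/

theorem tendsto_eLpNorm_zero_of_dominated {α : Type*} [MeasurableSpace α] {μ : Measure α}
    {p : ℝ≥0∞} (hp0 : p ≠ 0) (hpt : p ≠ ⊤) {f : ℕ → α → ℝ≥0∞} {G : α → ℝ≥0∞}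
    (hf : ∀ k, AEMeasurable (f k) μ) (hG : eLpNorm G p μ ≠ ⊤)
    (hle : ∀ k, ∀ᵐ x ∂μ, f k x ≤ G x) (hlim : ∀ᵐ x ∂μ, Tendsto (fun k => f k x) atTop (𝓝 0)) :
    Tendsto (fun k => eLpNorm (f k) p μ) atTop (𝓝 0) := by
  have hp : 0 < p.toReal := ENNReal.toReal_pos hp0 hpt
  simp only [eLpNorm_eq_lintegral_rpow_enorm_toReal hp0 hpt, enorm_eq_self] at hG ⊢
  have h1 : Tendsto (fun k => ∫⁻ x, f k x ^ p.toReal ∂μ) atTop (𝓝 (∫⁻ _, 0 ∂μ)) := by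
    refine tendsto_lintegral_of_dominated_convergence' (fun x => G x ^ p.toReal)
      (fun k => (hf k).pow_const _) (fun k => ?_) ?_ ?_
    · filter_upwards [hle k] with x hx
      gcongr
    · intro h
      rw [h] at hG
      exact hG (ENNReal.top_rpow_of_pos (by positivity))
    · filter_upwards [hlim] with x hx
      have := hx.ennrpow_const p.toReal
      rwa [ENNReal.zero_rpow_of_pos hp] at this
  have h2 := h1.ennrpow_const (1 / p.toReal)
  rwa [lintegral_zero, ENNReal.zero_rpow_of_pos (by positivity)] at h2

theorem tendsto_eLpNorm_sub_of_dominated {E : Type*} [NormedAddCommGroup E] {α : Type*}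
    [MeasurableSpace α] {μ : Measure α}
    {p : ℝ≥0∞} (hp0 : p ≠ 0) (hpt : p ≠ ⊤) {f : ℕ → α → E} {g : α → E} {G : α → ℝ≥0∞}
    (hf : ∀ k, AEStronglyMeasurable (f k) μ) (hg : AEStronglyMeasurable g μ)
    (hG : eLpNorm G p μ ≠ ⊤)
    (hle : ∀ k, ∀ᵐ x ∂μ, ‖f k x - g x‖ₑ ≤ G x)
    (hlim : ∀ᵐ x ∂μ, Tendsto (fun k => f k x) atTop (𝓝 (g x))) :
    Tendsto (fun k => eLpNorm (fun x => f k x - g x) p μ) atTop (𝓝 0) := by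
  have := tendsto_eLpNorm_zero_of_dominated hp0 hpt
    (f := fun k x => ‖f k x - g x‖ₑ) (G := G) (μ := μ) (fun k => ((hf k).sub hg).enorm) hG hle ?_
  · simpa only [eLpNorm_enorm] using this
  · filter_upwards [hlim] with x hx
    have h := (hx.sub_const (g x)).enorm
    simpa using h

/-! ### Truncated potentials -/

/-- Truncation of a real number to `[-M, M]`. -/
def clip (M : ℝ≥0) (v : ℝ) : ℝ := max (-(M : ℝ)) (min v M)

theorem continuous_clip (M : ℝ≥0) : Continuous (clip M) := by unfold clip; fun_prop

theorem abs_clip_le (M : ℝ≥0) (v : ℝ) : |clip M v| ≤ M := by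
  have := M.coe_nonneg
  rw [abs_le]
  exact ⟨le_max_left _ _, max_le (by linarith) (min_le_right _ _)⟩

theorem clip_of_abs_le {M : ℝ≥0} {v : ℝ} (h : |v| ≤ M) : clip M v = v := by
  rw [abs_le] at h
  rw [clip, min_eq_left h.2, max_eq_right h.1]

theorem clip_zero (v : ℝ) : clip 0 v = 0 := by
  simpa using abs_clip_le 0 v

theorem clip_cases (M : ℝ≥0) (v : ℝ) :
    (v < -M ∧ clip M v = -M) ∨ (-M ≤ v ∧ v ≤ M ∧ clip M v = v) ∨ (M < v ∧ clip M v = M) := by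
  have := M.coe_nonneg
  rcases lt_or_ge v (-M) with h | h
  · left
    exact ⟨h, by rw [clip, max_eq_left]; exact (min_le_left _ _).trans h.le⟩
  · rcases le_or_gt v M with h' | h'
    · exact Or.inr (Or.inl ⟨h, h', clip_of_abs_le (abs_le.2 ⟨h, h'⟩)⟩)
    · refine Or.inr (Or.inr ⟨h', ?_⟩)
      rw [clip, min_eq_right h'.le, max_eq_right (by linarith)]

theorem abs_clip_sub_clip_le {M K : ℝ≥0} (h : M ≤ K) (v : ℝ) :
    |clip K v - clip M v| ≤ |v - clip M v| := by
  have h' : (M : ℝ) ≤ K := by exact_mod_cast h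
  have := M.coe_nonneg
  have hK := clip_cases K v
  have hM := clip_cases M v
  grind

theorem abs_sub_clip_le (M : ℝ≥0) (v : ℝ) : |v - clip M v| ≤ |v| := by
  have := M.coe_nonneg
  have hM := clip_cases M v
  grind

theorem abs_sub_clip_anti {M K : ℝ≥0} (h : M ≤ K) (v : ℝ) :
    |v - clip K v| ≤ |v - clip M v| := by
  have h' : (M : ℝ) ≤ K := by exact_mod_cast h
  have := M.coe_nonneg
  have hK := clip_cases K v
  have hM := clip_cases M v
  grind

theorem abs_sub_clip_le_add (M : ℝ≥0) (v w : ℝ) :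
    |v - clip M v| ≤ |w - clip M w| + |v - w| := by
  have := M.coe_nonneg
  have hK := clip_cases M v
  have hM := clip_cases M w
  grind

/-- Size of the part of `W` above the level `M`. -/
def tail (M : ℝ≥0) (W : Space n → ℝ) : ℝ≥0∞ :=
  eLpNorm (fun x => W x - clip M (W x)) ((n : ℝ≥0∞) / 2) volume

theorem tail_zero (W : Space n → ℝ) : tail 0 W = eLpNorm W ((n : ℝ≥0∞) / 2) volume := by
  simp [tail, clip_zero]

theorem tail_anti {M K : ℝ≥0} (h : M ≤ K) (W : Space n → ℝ) : tail K W ≤ tail M W :=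
  eLpNorm_mono fun x => abs_sub_clip_anti h (W x)

theorem tail_le (M : ℝ≥0) (W : Space n → ℝ) :
    tail M W ≤ eLpNorm W ((n : ℝ≥0∞) / 2) volume := by
  rw [← tail_zero]; exact tail_anti zero_le W

theorem tendsto_tail (hn : 3 ≤ n) {W : Space n → ℝ} (hW : MemLp W ((n : ℝ≥0∞) / 2) volume) :
    Tendsto (fun k : ℕ => tail k W) atTop (𝓝 0) := by
  have h0 : (n : ℝ≥0∞) / 2 ≠ 0 := (zero_lt_one.trans_le (one_le_half hn)).ne'
  have := tendsto_eLpNorm_sub_of_dominated h0 (half_ne_top n) (μ := (volume : Measure (Space n)))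
    (f := fun (k : ℕ) x => W x - clip k (W x)) (g := fun _ => (0 : ℝ)) (G := fun x => ‖W x‖ₑ)
    (fun k => hW.1.sub ((continuous_clip k).comp_aestronglyMeasurable hW.1))
    aestronglyMeasurable_const (by simpa only [eLpNorm_enorm] using hW.2.ne)
    (fun k => ae_of_all _ fun x => ?_) (ae_of_all _ fun x => ?_)
  · simpa [tail] using this
  · rw [sub_zero, enorm_le_iff_norm_le]
    exact abs_sub_clip_le _ _
  · refine tendsto_const_nhds.congr' ?_
    obtain ⟨k, hk⟩ := exists_nat_ge |W x|
    filter_upwards [eventually_ge_atTop k] with j hj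
    have : (k : ℝ) ≤ j := by exact_mod_cast hj
    rw [clip_of_abs_le (by simpa using hk.trans this), sub_self]

theorem memLp_clip_mul (M : ℝ≥0) {W : Space n → ℝ} (hW : AEStronglyMeasurable W volume) (f : L2 n) :
    MemLp (fun x => (clip M (W x) : ℂ) * f x) 2 volume := by
  refine (Lp.memLp f).of_le_mul (c := M) ?_ (ae_of_all _ fun x => ?_)
  · exact (Complex.continuous_ofReal.comp_aestronglyMeasurable
      ((continuous_clip M).comp_aestronglyMeasurable hW)).mul (Lp.aestronglyMeasurable f)
  · rw [norm_mul, Complex.norm_real]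
    gcongr
    exact abs_clip_le M (W x)

open Classical in
/-- Multiplication by the truncation of `W` at level `M`, on `L²`. -/
def clipMul (M : ℝ≥0) (W : Space n → ℝ) : L2 n →L[ℂ] L2 n :=
  if hW : AEStronglyMeasurable W volume then
    LinearMap.mkContinuous
      { toFun := fun f => (memLp_clip_mul M hW f).toLp _
        map_add' := fun f g => by
          rw [← MemLp.toLp_add]
          refine MemLp.toLp_congr _ _ ?_
          filter_upwards [Lp.coeFn_add f g] with x hx
          rw [hx, Pi.add_apply, Pi.add_apply, mul_add]
        map_smul' := fun c f => by
          rw [RingHom.id_apply, ← MemLp.toLp_const_smul]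
          refine MemLp.toLp_congr _ _ ?_
          filter_upwards [Lp.coeFn_smul c f] with x hx
          simp [hx]
          ring } M
      (fun f => by
        refine Lp.norm_le_mul_norm_of_ae_le_mul ?_
        filter_upwards [(memLp_clip_mul M hW f).coeFn_toLp] with x hx
        rw [LinearMap.coe_mk, AddHom.coe_mk, hx, norm_mul, Complex.norm_real]
        gcongr
        exact abs_clip_le M (W x))
  else 0

theorem coeFn_clipMul (M : ℝ≥0) {W : Space n → ℝ} (hW : AEStronglyMeasurable W volume) (f : L2 n) :
    clipMul M W f =ᵐ[volume] fun x => (clip M (W x) : ℂ) * f x := by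
  rw [clipMul, dif_pos hW]
  exact (memLp_clip_mul M hW f).coeFn_toLp

theorem norm_clipMul_le (M : ℝ≥0) (W : Space n → ℝ) (f : L2 n) :
    ‖clipMul M W f‖ ≤ M * ‖f‖ := by
  by_cases hW : AEStronglyMeasurable W volume
  · refine Lp.norm_le_mul_norm_of_ae_le_mul ?_
    filter_upwards [coeFn_clipMul M hW f] with x hx
    rw [hx, norm_mul, Complex.norm_real]
    gcongr
    exact abs_clip_le M (W x)
  · rw [clipMul, dif_neg hW]
    simp
    positivity

theorem inner_clipMul (M : ℝ≥0) (W : Space n → ℝ) (f g : L2 n) :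
    inner ℂ (clipMul M W f) g = inner ℂ f (clipMul M W g) := by
  by_cases hW : AEStronglyMeasurable W volume
  · rw [L2.inner_def, L2.inner_def]
    refine integral_congr_ae ?_
    filter_upwards [coeFn_clipMul M hW f, coeFn_clipMul M hW g] with x h1 h2
    rw [h1, h2]
    simp
    ring
  · rw [clipMul, dif_neg hW]
    simp

/-- Hölder's inequality for a potential acting on a function. -/
theorem eLpNorm_mul_le (hn : 3 ≤ n) {W : Space n → ℝ} (hW : AEStronglyMeasurable W volume)
    {f : Space n → ℂ} (hf : AEStronglyMeasurable f volume) :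
    eLpNorm (fun x => (W x : ℂ) * f x) (sobExp n).conjExponent volume ≤
      eLpNorm W ((n : ℝ≥0∞) / 2) volume * eLpNorm f (sobExp n) volume := by
  have := holderTriple_half_sobExp hn
  have h := eLpNorm_smul_le_mul_eLpNorm (p := (n : ℝ≥0∞) / 2) (q := sobExp n)
    (r := (sobExp n).conjExponent) hf (Complex.continuous_ofReal.comp_aestronglyMeasurable hW)
  refine h.trans_eq ?_
  congr 1
  exact eLpNorm_congr_norm_ae (ae_of_all _ fun x => by simp)

theorem eLpNorm_clipMul_sub_le (hn : 3 ≤ n) {M K : ℝ≥0} (h : M ≤ K) {W : Space n → ℝ}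
    (hW : AEStronglyMeasurable W volume) (f : L2 n) :
    eLpNorm (⇑(clipMul K W f - clipMul M W f)) (sobExp n).conjExponent volume ≤
      tail M W * eLpNorm f (sobExp n) volume := by
  have hWM : AEStronglyMeasurable (fun x => W x - clip M (W x)) volume :=
    hW.sub ((continuous_clip M).comp_aestronglyMeasurable hW)
  refine le_trans ?_ (eLpNorm_mul_le hn hWM (Lp.aestronglyMeasurable f))
  refine eLpNorm_mono_ae ?_
  filter_upwards [Lp.coeFn_sub (clipMul K W f) (clipMul M W f), coeFn_clipMul K hW f,
    coeFn_clipMul M hW f] with x h1 h2 h3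
  rw [h1, Pi.sub_apply, h2, h3, ← sub_mul, norm_mul, norm_mul, ← Complex.ofReal_sub,
    Complex.norm_real, Complex.norm_real]
  gcongr
  exact abs_clip_sub_clip_le h (W x)

theorem eLpNorm_sub_clipMul_le (hn : 3 ≤ n) (M : ℝ≥0) {W : Space n → ℝ}
    (hW : AEStronglyMeasurable W volume) (f : L2 n) :
    eLpNorm (fun x => (W x : ℂ) * f x - clipMul M W f x) (sobExp n).conjExponent volume ≤
      tail M W * eLpNorm f (sobExp n) volume := by
  have hWM : AEStronglyMeasurable (fun x => W x - clip M (W x)) volume :=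
    hW.sub ((continuous_clip M).comp_aestronglyMeasurable hW)
  refine le_trans ?_ (eLpNorm_mul_le hn hWM (Lp.aestronglyMeasurable f))
  refine eLpNorm_mono_ae ?_
  filter_upwards [coeFn_clipMul M hW f] with x h3
  rw [h3, ← sub_mul, ← Complex.ofReal_sub]

theorem continuousOn_clipMul {I : Set ℝ} (hn : 3 ≤ n) {V : ℝ → Space n → ℝ}
    (hV : ContinuousInLp I ((n : ℝ≥0∞) / 2) V) (M : ℝ≥0) (f : L2 n) :
    ContinuousOn (fun t => clipMul M (V t) f) I := by
  intro t ht
  refine tendsto_of_subseq_tendsto fun s hs => ?_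
  have h0 : (n : ℝ≥0∞) / 2 ≠ 0 := (zero_lt_one.trans_le (one_le_half hn)).ne'
  obtain ⟨j₀, hj₀⟩ := eventually_atTop.1 (hs.eventually self_mem_nhdsWithin)
  have hsI : ∀ j, s (j + j₀) ∈ I := fun j => hj₀ _ (by omega)
  have hs' := hs.comp (tendsto_add_atTop_nat j₀)
  have hmeas := tendstoInMeasure_of_tendsto_eLpNorm h0 (μ := (volume : Measure (Space n)))
    (f := fun j => V (s (j + j₀))) (g := V t) (fun j => (hV _ (hsI j)).1.1) (hV t ht).1.1
    ((hV t ht).2.comp hs')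
  obtain ⟨ns, -, hns⟩ := hmeas.exists_seq_tendsto_ae
  refine ⟨fun j => ns j + j₀, ?_⟩
  rw [Lp.tendsto_Lp_iff_tendsto_eLpNorm']
  have := tendsto_eLpNorm_sub_of_dominated (p := 2) (by norm_num) (by norm_num)
    (μ := (volume : Measure (Space n)))
    (f := fun j => ⇑(clipMul M (V (s (ns j + j₀))) f)) (g := ⇑(clipMul M (V t) f))
    (G := fun x => ‖(2 * M : ℝ) • f x‖ₑ)
    (fun j => Lp.aestronglyMeasurable _) (Lp.aestronglyMeasurable _) ?_ (fun j => ?_) ?_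
  · exact this
  · rw [eLpNorm_enorm]
    exact ((Lp.memLp f).const_smul (2 * M : ℝ)).2.ne
  · filter_upwards [coeFn_clipMul M (hV _ (hsI (ns j))).1.1 f, coeFn_clipMul M (hV t ht).1.1 f]
      with x h1 h2
    rw [h1, h2, enorm_le_iff_norm_le, ← sub_mul, norm_mul, norm_smul, ← Complex.ofReal_sub,
      Complex.norm_real]
    gcongr
    refine (norm_sub_le _ _).trans ?_
    have := M.coe_nonneg
    rw [Real.norm_of_nonneg (by positivity : (0 : ℝ) ≤ 2 * M)]
    have h3 := abs_clip_le M (V (s (ns j + j₀)) x)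
    have h4 := abs_clip_le M (V t x)
    simp only [Real.norm_eq_abs]
    linarith
  · have h5 : ∀ᵐ x, ∀ j, clipMul M (V (s (ns j + j₀))) f x = (clip M (V (s (ns j + j₀)) x) : ℂ) * f x :=
      ae_all_iff.2 fun j => coeFn_clipMul M (hV _ (hsI (ns j))).1.1 f
    filter_upwards [h5, coeFn_clipMul M (hV t ht).1.1 f, hns] with x h1 h2 h3
    simp only [h1, h2]
    refine Tendsto.mul_const _ ?_
    exact (Complex.continuous_ofReal.tendsto _).comp (((continuous_clip M).tendsto _).comp h3)

/-! ### Unitary groups and their generators -/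

theorem IsUnitaryGroup.apply_add {H : L2 n →ₗ.[ℂ] L2 n} {U : ℝ → L2 n →L[ℂ] L2 n}
    (hU : IsUnitaryGroup H U) (s t : ℝ) (f : L2 n) : U (s + t) f = U s (U t f) := by
  rw [hU.add]; rfl

theorem IsUnitaryGroup.apply_zero {H : L2 n →ₗ.[ℂ] L2 n} {U : ℝ → L2 n →L[ℂ] L2 n}
    (hU : IsUnitaryGroup H U) (f : L2 n) : U 0 f = f := by
  rw [hU.zero]; rfl

theorem IsUnitaryGroup.inner_left {H : L2 n →ₗ.[ℂ] L2 n} {U : ℝ → L2 n →L[ℂ] L2 n}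
    (hU : IsUnitaryGroup H U) (t : ℝ) (f g : L2 n) :
    inner ℂ (U t f) g = inner ℂ f (U (-t) g) := by
  have h : ∀ f g : L2 n, inner ℂ (U t f) (U t g) = inner ℂ f g :=
    (LinearIsometry.mk (U t).toLinearMap (hU.norm_map t)).inner_map_map
  have e : U t (U (-t) g) = g := by rw [← hU.apply_add, add_neg_cancel, hU.apply_zero]
  conv_lhs => rw [← e, h]

theorem IsUnitaryGroup.mem_domain {H : L2 n →ₗ.[ℂ] L2 n} {U : ℝ → L2 n →L[ℂ] L2 n}
    (hU : IsUnitaryGroup H U) (hH : IsSelfAdjoint H) (t : ℝ) (f : H.domain) :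
    ∃ h : U t (f : L2 n) ∈ H.domain, H ⟨U t f, h⟩ = U t (H f) := by
  have key : ∀ x : H.domain, inner ℂ (U t (H f)) (x : L2 n) = inner ℂ (U t (f : L2 n)) (H x) := by
    intro x
    have h1 : HasDerivAt (fun r => inner ℂ (f : L2 n) (U r (x : L2 n)))
        (inner ℂ (f : L2 n) (Complex.I • U (-t) (H x))) (-t) := by
      have := (hasDerivAt_const (-t) (f : L2 n)).inner ℂ (hU.hasDerivAt x (-t))
      simpa using this
    have h2 : HasDerivAt (fun r => inner ℂ (U (-r) (f : L2 n)) (x : L2 n))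
        (inner ℂ (-(Complex.I • U t (H f))) (x : L2 n)) (-t) := by
      have h3 := hU.hasDerivAt f (- -t)
      have h4 : HasDerivAt (fun r : ℝ => -r) (-1) (-t) := hasDerivAt_neg _
      have h5 := h3.scomp (-t) h4
      have := h5.inner ℂ (hasDerivAt_const (-t) (x : L2 n))
      simpa using this
    have h6 : (fun r => inner ℂ (U (-r) (f : L2 n)) (x : L2 n)) =
        fun r => inner ℂ (f : L2 n) (U r (x : L2 n)) := by
      funext r
      rw [hU.inner_left, neg_neg]
    rw [h6] at h2
    have h7 := h1.unique h2
    rw [inner_smul_right, inner_neg_left, inner_smul_left, Complex.conj_I, neg_mul, neg_neg,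
      ← hU.inner_left] at h7
    exact (mul_left_cancel₀ Complex.I_ne_zero h7).symm
  have hd : Dense (H.domain : Set (L2 n)) := hH.dense_domain
  have hm : U t (f : L2 n) ∈ H.adjoint.domain := H.mem_adjoint_domain_of_exists _ ⟨_, key⟩
  have h8 : ∃ h : U t (f : L2 n) ∈ H.adjoint.domain, H.adjoint ⟨U t f, h⟩ = U t (H f) :=
    ⟨hm, LinearPMap.adjoint_apply_eq hd ⟨_, hm⟩ key⟩
  rwa [LinearPMap.isSelfAdjoint_def.1 hH] at h8

/-! ### Extension of the distributional identity to Schwartz functions -/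

theorem lintegral_enorm_mul_le {f g : Space n → ℂ} {p q : ℝ≥0∞} (hpq : p.HolderConjugate q)
    (hf : AEStronglyMeasurable f volume) (hg : AEStronglyMeasurable g volume) :
    ∫⁻ x, ‖f x * g x‖ₑ ≤ eLpNorm f p volume * eLpNorm g q volume := by
  have := eLpNorm_smul_le_mul_eLpNorm (p := p) (q := q) (r := 1) hg hf
  rwa [eLpNorm_one_eq_lintegral_enorm] at this

theorem integrable_mul_of_holder {f g : Space n → ℂ} {p q : ℝ≥0∞} (hpq : p.HolderConjugate q)
    (hf : MemLp f p volume) (hg : MemLp g q volume) : Integrable (fun x => f x * g x) volume :=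
  ⟨hf.1.mul hg.1, (lintegral_enorm_mul_le hpq hf.1 hg.1).trans_lt (ENNReal.mul_lt_top hf.2 hg.2)⟩

theorem holderConjugate_two_two : (2 : ℝ≥0∞).HolderConjugate 2 := by
  have := holderConjugate_of_two_le (le_refl (2 : ℝ≥0∞))
  rwa [conjExponent_two] at this

theorem memLp_two_norm_iteratedFDeriv (ψ : 𝓢(Space n, ℂ)) (i : ℕ) :
    MemLp (fun x => ‖iteratedFDeriv ℝ i ψ x‖) 2 (volume : Measure (Space n)) := by
  have h1 : Integrable (fun x => ‖iteratedFDeriv ℝ i ψ x‖) (volume : Measure (Space n)) := by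
    simpa using ψ.integrable_pow_mul_iteratedFDeriv (μ := (volume : Measure (Space n))) 0 i
  obtain ⟨C, hC⟩ := ψ.decay' 0 i
  have hC' : ∀ x, ‖iteratedFDeriv ℝ i ψ x‖ ≤ C := fun x => by
    have := hC x
    rw [pow_zero, one_mul] at this
    exact this
  rw [memLp_two_iff_integrable_sq h1.1]
  refine (h1.const_mul C).mono' (h1.1.pow 2) (ae_of_all _ fun x => ?_)
  rw [Real.norm_of_nonneg (by positivity), sq]
  exact mul_le_mul_of_nonneg_right (hC' x) (norm_nonneg _)

/-- Smooth compactly supported approximations of a Schwartz function. -/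
theorem exists_cutoff (ψ : 𝓢(Space n, ℂ)) :
    ∃ (χ : ℕ → Space n → ℂ) (G : Space n → ℝ), MemLp G 2 volume ∧
      (∀ k, ContDiff ℝ ∞ (χ k)) ∧ (∀ k, HasCompactSupport (χ k)) ∧
      (∀ k x, ‖χ k x‖ ≤ ‖ψ x‖) ∧ (∀ k x, ‖Laplacian.laplacian (χ k) x‖ ≤ G x) ∧
      (∀ x, ∀ᶠ k in atTop, χ k x = ψ x) ∧
      (∀ x, ∀ᶠ k in atTop, Laplacian.laplacian (χ k) x = Laplacian.laplacian (ψ : Space n → ℂ) x) := by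
  let b : ContDiffBump (0 : Space n) := ⟨1, 2, by norm_num, by norm_num⟩
  have hb : ContDiff ℝ ∞ b := b.contDiff
  choose K hK using fun i : ℕ => (b.hasCompactSupport.iteratedFDeriv i (𝕜 := ℝ)).exists_bound_of_continuous
    (hb.continuous_iteratedFDeriv (by exact_mod_cast le_top))
  set a : ℕ → ℝ := fun k => ((k : ℝ) + 1)⁻¹ with ha
  have ha0 : ∀ k, 0 < a k := fun k => by positivity
  have ha1 : ∀ k, a k ≤ 1 := fun k => inv_le_one_of_one_le₀ (by simp)
  have hbk : ∀ k, ContDiff ℝ ∞ fun x : Space n => b (a k • x) :=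
    fun k => hb.comp (contDiff_const_smul (a k))
  have hder : ∀ k i x, ‖iteratedFDeriv ℝ i (fun x : Space n => b (a k • x)) x‖ ≤ K i := by
    intro k i x
    rw [iteratedFDeriv_comp_const_smul (a k) (hb.of_le (by exact_mod_cast le_top)), norm_smul]
    calc _ ≤ 1 * K i := by
          refine mul_le_mul ?_ (hK i _) (norm_nonneg _) zero_le_one
          rw [norm_pow, Real.norm_of_nonneg (ha0 k).le]
          exact pow_le_one₀ (ha0 k).le (ha1 k)
      _ = K i := one_mul _
  have hnear : ∀ x : Space n, ∀ᶠ k in atTop, ∀ᶠ y in 𝓝 x, b (a k • y) = 1 := by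
    intro x
    obtain ⟨k₀, hk₀⟩ := exists_nat_ge ‖x‖
    filter_upwards [eventually_ge_atTop k₀] with k hk
    have h1 : (k₀ : ℝ) ≤ k := by exact_mod_cast hk
    have h2 : ∀ᶠ y in 𝓝 x, ‖y‖ < k + 1 :=
      continuous_norm.continuousAt.eventually_lt continuousAt_const (by linarith)
    filter_upwards [h2] with y hy
    refine b.one_of_mem_closedBall ?_
    rw [mem_closedBall_zero_iff, norm_smul, Real.norm_of_nonneg (ha0 k).le, ha]
    change _ ≤ (1 : ℝ)
    rw [inv_mul_le_iff₀ (by positivity)]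
    linarith
  refine ⟨fun k x => b (a k • x) • ψ x, fun x => ∑ _j : Fin (Module.finrank ℝ (Space n)),
    ∑ i ∈ Finset.range (2 + 1),
      (((2 : ℕ).choose i : ℝ) * K i) * ‖iteratedFDeriv ℝ (2 - i) ψ x‖, ?_, fun k => ?_, fun k => ?_,
      fun k x => ?_, fun k x => ?_, fun x => ?_, fun x => ?_⟩
  · refine memLp_finsetSum _ fun _ _ => memLp_finsetSum _ fun i _ => ?_
    exact (memLp_two_norm_iteratedFDeriv ψ (2 - i)).const_mul _
  · exact (hbk k).smul (ψ.smooth ⊤)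
  · have h1 : HasCompactSupport fun x : Space n => b (a k • x) :=
      b.hasCompactSupport.comp_smul (ha0 k).ne'
    exact h1.smul_right
  · rw [norm_smul, Real.norm_of_nonneg b.nonneg]
    exact mul_le_of_le_one_left (norm_nonneg _) b.le_one
  · rw [InnerProductSpace.laplacian_eq_iteratedFDeriv_stdOrthonormalBasis]
    refine (norm_sum_le _ _).trans (Finset.sum_le_sum fun j _ => ?_)
    refine (ContinuousMultilinearMap.le_opNorm _ _).trans ?_
    have h1 : ∏ i : Fin 2, ‖(![(stdOrthonormalBasis ℝ (Space n)) j,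
        (stdOrthonormalBasis ℝ (Space n)) j] : Fin 2 → Space n) i‖ = 1 := by
      simp [Fin.prod_univ_two]
    rw [h1, mul_one]
    refine (norm_iteratedFDeriv_smul_le (hbk k) (ψ.smooth ⊤) x (n := 2)
      (WithTop.coe_le_coe.2 (le_top : (2 : ℕ∞) ≤ ⊤))).trans ?_
    refine Finset.sum_le_sum fun i _ => ?_
    gcongr
    exact hder k i x
  · filter_upwards [hnear x] with k hk
    rw [hk.self_of_nhds, one_smul]
  · filter_upwards [hnear x] with k hk
    refine (InnerProductSpace.laplacian_congr_nhds ?_).self_of_nhds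
    filter_upwards [hk] with y hy
    rw [hy, one_smul]

theorem integral_realization {W : Space n → ℝ} {H : L2 n →ₗ.[ℂ] L2 n} (hn : 3 ≤ n)
    (hW : MemLp W ((n : ℝ≥0∞) / 2) volume) (hH : IsSelfAdjointRealization W H) (f : H.domain)
    (hf : eLpNorm (f : L2 n) (sobExp n) volume < ⊤) (ψ : 𝓢(Space n, ℂ)) :
    ∫ x, (H f) x * ψ x = (∫ x, (f : L2 n) x * (Laplacian.laplacian ψ) x) -
      ∫ x, (W x : ℂ) * (f : L2 n) x * ψ x := by
  obtain ⟨χ, G, hG, hsmooth, hcpt, hle, hlapG, hlim, hlapl⟩ := exists_cutoff ψ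
  have hid := fun k => (hH.2 f).2 (χ k) (hsmooth k) (hcpt k)
  have hfm := Lp.aestronglyMeasurable (f : L2 n)
  have hWf : MemLp (fun x => (W x : ℂ) * (f : L2 n) x) (sobExp n).conjExponent volume :=
    ⟨(Complex.continuous_ofReal.comp_aestronglyMeasurable hW.1).mul hfm,
      (eLpNorm_mul_le hn hW.1 hfm).trans_lt (ENNReal.mul_lt_top hW.2 hf)⟩
  have t1 : Tendsto (fun k => ∫ x, (H f) x * χ k x) atTop (𝓝 (∫ x, (H f) x * ψ x)) := by
    refine tendsto_integral_of_dominated_convergence (fun x => ‖(H f) x * ψ x‖)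
      (fun k => (Lp.aestronglyMeasurable _).mul (hsmooth k).continuous.aestronglyMeasurable)
      (integrable_mul_of_holder holderConjugate_two_two (Lp.memLp _) (ψ.memLp 2)).norm
      (fun k => ae_of_all _ fun x => ?_) (ae_of_all _ fun x => ?_)
    · rw [norm_mul, norm_mul]
      gcongr
      exact hle k x
    · refine tendsto_const_nhds.congr' ?_
      filter_upwards [hlim x] with k hk
      rw [hk]
  have t2 : Tendsto (fun k => ∫ x, (f : L2 n) x * Laplacian.laplacian (χ k) x) atTop
      (𝓝 (∫ x, (f : L2 n) x * Laplacian.laplacian ψ x)) := by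
    refine tendsto_integral_of_dominated_convergence (fun x => ‖(f : L2 n) x * (G x : ℂ)‖)
      (fun k => hfm.mul ?_)
      (integrable_mul_of_holder holderConjugate_two_two (Lp.memLp _) hG.ofReal).norm
      (fun k => ae_of_all _ fun x => ?_) (ae_of_all _ fun x => ?_)
    · have := SchwartzMap.continuous (Laplacian.laplacian ((hcpt k).toSchwartzMap (hsmooth k)))
      refine Continuous.aestronglyMeasurable ?_
      convert! this using 1
      funext x
      rw [SchwartzMap.laplacian_apply]
      rfl
    · rw [norm_mul, norm_mul]
      gcongr
      refine (hlapG k x).trans ?_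
      rw [Complex.norm_real]
      exact le_abs_self _
    · refine tendsto_const_nhds.congr' ?_
      filter_upwards [hlapl x] with k hk
      rw [hk, SchwartzMap.laplacian_apply]
  have t3 : Tendsto (fun k => ∫ x, (W x : ℂ) * (f : L2 n) x * χ k x) atTop
      (𝓝 (∫ x, (W x : ℂ) * (f : L2 n) x * ψ x)) := by
    refine tendsto_integral_of_dominated_convergence (fun x => ‖(W x : ℂ) * (f : L2 n) x * ψ x‖)
      (fun k => hWf.1.mul (hsmooth k).continuous.aestronglyMeasurable)
      (integrable_mul_of_holder (holderConjugate_of_two_le (two_le_sobExp hn)).symm hWf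
        (ψ.memLp _)).norm
      (fun k => ae_of_all _ fun x => ?_) (ae_of_all _ fun x => ?_)
    · rw [norm_mul, norm_mul _ (ψ x)]
      gcongr
      exact hle k x
    · refine tendsto_const_nhds.congr' ?_
      filter_upwards [hlim x] with k hk
      rw [hk]
  exact tendsto_nhds_unique t1 ((t2.sub t3).congr fun k => (hid k).symm)

/-- The complex conjugate of a Schwartz function. -/
def conjSchwartz (ψ : 𝓢(Space n, ℂ)) : 𝓢(Space n, ℂ) :=
  SchwartzMap.postcompCLM (𝕜 := ℝ) (Complex.conjCLE : ℂ →L[ℝ] ℂ) ψ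

theorem conjSchwartz_apply (ψ : 𝓢(Space n, ℂ)) (x : Space n) :
    conjSchwartz ψ x = (starRingEnd ℂ) (ψ x) := rfl

theorem laplacian_conjSchwartz (ψ : 𝓢(Space n, ℂ)) (x : Space n) :
    Laplacian.laplacian (conjSchwartz ψ) x = (starRingEnd ℂ) (Laplacian.laplacian ψ x) := by
  rw [SchwartzMap.laplacian_apply, SchwartzMap.laplacian_apply]
  exact congrFun (InnerProductSpace.laplacian_CLE_comp_left (E := Space n) (F := ℂ) (G := ℂ)
    (l := Complex.conjCLE) (f := ⇑ψ)) x

theorem inner_realization {W : Space n → ℝ} {H : L2 n →ₗ.[ℂ] L2 n} (hn : 3 ≤ n)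
    (hW : MemLp W ((n : ℝ≥0∞) / 2) volume) (hH : IsSelfAdjointRealization W H) (f : H.domain)
    (hf : eLpNorm (f : L2 n) (sobExp n) volume < ⊤) (ψ : 𝓢(Space n, ℂ)) :
    inner ℂ (H f) (schL2 n ψ) = inner ℂ (f : L2 n) (schL2 n (Laplacian.laplacian ψ)) -
      ∫ x, (starRingEnd ℂ) ((f : L2 n) x) * ((W x : ℂ) * schL2 n ψ x) := by
  have h := congrArg (starRingEnd ℂ) (integral_realization hn hW hH f hf (conjSchwartz ψ))
  rw [map_sub, ← integral_conj, ← integral_conj, ← integral_conj] at h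
  have e1 : inner ℂ (H f) (schL2 n ψ) = ∫ x, (starRingEnd ℂ) ((H f) x * conjSchwartz ψ x) := by
    rw [L2.inner_def]
    refine integral_congr_ae ?_
    filter_upwards [coeFn_schL2 ψ] with x hx
    rw [hx, conjSchwartz_apply, map_mul, Complex.conj_conj]
    simp [mul_comm]
  have e2 : inner ℂ (f : L2 n) (schL2 n (Laplacian.laplacian ψ)) =
      ∫ x, (starRingEnd ℂ) ((f : L2 n) x * Laplacian.laplacian (conjSchwartz ψ) x) := by
    rw [L2.inner_def]
    refine integral_congr_ae ?_
    filter_upwards [coeFn_schL2 (Laplacian.laplacian ψ)] with x hx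
    rw [hx, laplacian_conjSchwartz, map_mul, Complex.conj_conj]
    simp [mul_comm]
  have e3 : ∫ x, (starRingEnd ℂ) ((f : L2 n) x) * ((W x : ℂ) * schL2 n ψ x) =
      ∫ x, (starRingEnd ℂ) ((W x : ℂ) * (f : L2 n) x * conjSchwartz ψ x) := by
    refine integral_congr_ae ?_
    filter_upwards [coeFn_schL2 ψ] with x hx
    rw [hx, conjSchwartz_apply, map_mul, map_mul, Complex.conj_conj, Complex.conj_ofReal]
    ring
  rw [e1, e2, e3, h]

theorem freeSchwartz_laplacian (t : ℝ) (φ : 𝓢(Space n, ℂ)) :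
    freeSchwartz n t (Laplacian.laplacian φ) = Laplacian.laplacian (freeSchwartz n t φ) := by
  apply (FourierTransform.fourierEquiv ℂ 𝓢(Space n, ℂ)).injective
  ext ξ
  change 𝓕 (freeSchwartz n t (Laplacian.laplacian φ)) ξ =
    𝓕 (Laplacian.laplacian (freeSchwartz n t φ)) ξ
  rw [fourier_freeSchwartz_apply, fourier_laplacian_apply, fourier_laplacian_apply,
    fourier_freeSchwartz_apply]
  ring

/-! ### Duhamel's formula relating the free group to the perturbed group -/

/-- The error in Duhamel's formula for `e^{itΔ}` in terms of `U` when the potential is truncated. -/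
def defect (U : ℝ → L2 n →L[ℂ] L2 n) (M : ℝ≥0) (W : Space n → ℝ) (t : ℝ) (f : L2 n) : L2 n :=
  freeGroup n t f - U t f -
    Complex.I • ∫ s in (0 : ℝ)..t, U (t - s) (clipMul M W (freeGroup n s f))

theorem IsUnitaryGroup.continuous_comp {H : L2 n →ₗ.[ℂ] L2 n} {U : ℝ → L2 n →L[ℂ] L2 n}
    (hU : IsUnitaryGroup H U) {α : Type*} [TopologicalSpace α] {g : α → ℝ} {f : α → L2 n}
    (hg : Continuous g) (hf : Continuous f) : Continuous fun a => U (g a) (f a) :=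
  (continuous_uncurry_of_isometry hU.norm_map hU.continuous).comp (hg.prodMk hf)

theorem enorm_inner_defect_le {W : Space n → ℝ} {H : L2 n →ₗ.[ℂ] L2 n}
    {U : ℝ → L2 n →L[ℂ] L2 n} (hn : 3 ≤ n)
    (hW : MemLp W ((n : ℝ≥0∞) / 2) volume) (hH : IsSelfAdjointRealization W H)
    (hU : IsUnitaryGroup H U) (h : H.domain) (φ : 𝓢(Space n, ℂ)) {K : ℝ≥0}
    (hK : ∀ s, eLpNorm (freeGroup n s (schL2 n φ)) (sobExp n) volume ≤ K) (M : ℝ≥0) {t : ℝ}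
    (ht : 0 ≤ t)
    (hfin : ∀ᵐ s ∂volume.restrict (Icc 0 t), eLpNorm (U (s - t) (h : L2 n)) (sobExp n) volume < ⊤) :
    ‖inner ℂ (h : L2 n) (defect U M W t (schL2 n φ))‖ₑ ≤
      tail M W * K * ∫⁻ s in Icc 0 t, eLpNorm (U (s - t) (h : L2 n)) (sobExp n) volume := by
  set w : ℝ → L2 n := fun s => freeGroup n s (schL2 n φ) with hw
  have hwc : Continuous w := continuous_freeGroup_apply _
  set g : ℝ → ℂ := fun s => inner ℂ (U (s - t) (h : L2 n)) (w s) with hg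
  set g' : ℝ → ℂ := fun s =>
    inner ℂ (U (s - t) (h : L2 n)) (Complex.I • freeGroup n s (schL2 n (Laplacian.laplacian φ))) +
      inner ℂ (Complex.I • U (s - t) (H h)) (w s) with hg'
  have hsub : Continuous fun s : ℝ => s - t := continuous_id.sub continuous_const
  have hder : ∀ s, HasDerivAt g (g' s) s := by
    intro s
    have h1 : HasDerivAt (fun r => U (r - t) (h : L2 n)) (Complex.I • U (s - t) (H h)) s := by
      simpa using (hU.hasDerivAt h (s - t)).comp_sub_const s t
    exact h1.inner ℂ (hasDerivAt_freeGroup_schL2 φ s)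
  have hg'c : Continuous g' := by
    refine Continuous.add ?_ ?_
    · exact (hU.continuous_comp hsub continuous_const).inner
        ((continuous_freeGroup_apply _).fun_const_smul _)
    · exact ((hU.continuous_comp hsub continuous_const).fun_const_smul _).inner hwc
  have hftc : ∫ s in (0 : ℝ)..t, g' s = g t - g 0 :=
    intervalIntegral.integral_eq_sub_of_hasDerivAt (fun s _ => hder s)
      (hg'c.intervalIntegrable _ _)
  set k : ℝ → L2 n := fun s => U (t - s) (clipMul M W (w s)) with hk
  have hkc : Continuous k :=
    hU.continuous_comp (continuous_const.sub continuous_id) ((clipMul M W).continuous.comp hwc)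
  have hIntg : inner ℂ (h : L2 n) (∫ s in (0 : ℝ)..t, k s) =
      ∫ s in (0 : ℝ)..t, inner ℂ (U (s - t) (h : L2 n)) (clipMul M W (w s)) := by
    have := (innerSL ℂ (h : L2 n)).intervalIntegral_comp_comm (hkc.intervalIntegrable (μ := volume) 0 t)
    simp only [innerSL_apply_apply] at this
    rw [← this]
    refine intervalIntegral.integral_congr fun s _ => ?_
    simp only [hk]
    rw [hU.inner_left, neg_sub]
  have hcc : Continuous fun s => inner ℂ (U (s - t) (h : L2 n)) (clipMul M W (w s)) :=
    (hU.continuous_comp hsub continuous_const).inner ((clipMul M W).continuous.comp hwc)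
  have hcc' : Continuous fun s =>
      Complex.I * inner ℂ (U (s - t) (h : L2 n)) (clipMul M W (w s)) := continuous_const.mul hcc
  have heq : inner ℂ (h : L2 n) (defect U M W t (schL2 n φ)) = ∫ s in (0 : ℝ)..t,
      (g' s - Complex.I * inner ℂ (U (s - t) (h : L2 n)) (clipMul M W (w s))) := by
    rw [intervalIntegral.integral_sub (hg'c.intervalIntegrable _ _)
      (hcc'.intervalIntegrable _ _), hftc,
      intervalIntegral.integral_const_mul, ← hIntg, defect, inner_sub_right, inner_sub_right,
      inner_smul_right, hg]
    simp only [sub_self, zero_sub, hw, freeGroup_zero, hU.apply_zero]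
    rw [hU.inner_left, neg_neg]
  rw [heq, intervalIntegral.integral_of_le ht, ← integral_Icc_eq_integral_Ioc]
  refine (enorm_integral_le_lintegral_enorm _).trans ?_
  rw [← lintegral_const_mul' _ _ (ENNReal.mul_ne_top ((tail_le M W).trans_lt hW.2).ne (by simp))]
  refine lintegral_mono_ae ?_
  filter_upwards [hfin] with s hs
  obtain ⟨hmem, hHU⟩ := hU.mem_domain hH.1 (s - t) h
  have hre := inner_realization hn hW hH ⟨_, hmem⟩ hs (freeSchwartz n s φ)
  have hws : w s = schL2 n (freeSchwartz n s φ) := freeGroup_schL2 s φ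
  set f : L2 n := U (s - t) (h : L2 n) with hf
  have hfm := Lp.aestronglyMeasurable f
  have hfc : MemLp (fun x => (starRingEnd ℂ) (f x)) (sobExp n) volume := by
    refine ⟨Complex.continuous_conj.comp_aestronglyMeasurable hfm, ?_⟩
    rwa [eLpNorm_congr_norm_ae (g := f) (ae_of_all _ fun x => by simp)]
  have hfc2 : MemLp (fun x => (starRingEnd ℂ) (f x)) 2 volume := by
    refine ⟨Complex.continuous_conj.comp_aestronglyMeasurable hfm, ?_⟩
    rw [eLpNorm_congr_norm_ae (g := f) (ae_of_all _ fun x => by simp)]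
    exact (Lp.memLp f).2
  have hwm := Lp.aestronglyMeasurable (w s)
  have hWw : MemLp (fun x => (W x : ℂ) * w s x) (sobExp n).conjExponent volume :=
    ⟨(Complex.continuous_ofReal.comp_aestronglyMeasurable hW.1).mul hwm,
      (eLpNorm_mul_le hn hW.1 hwm).trans_lt (ENNReal.mul_lt_top hW.2
        ((hK s).trans_lt ENNReal.coe_lt_top))⟩
  have hconj := holderConjugate_of_two_le (two_le_sobExp hn)
  have hval : g' s - Complex.I * inner ℂ f (clipMul M W (w s)) =
      Complex.I * ∫ x, (starRingEnd ℂ) (f x) * ((W x : ℂ) * w s x - clipMul M W (w s) x) := by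
    have e1 : ∫ x, (starRingEnd ℂ) (f x) * ((W x : ℂ) * w s x - clipMul M W (w s) x) =
        (∫ x, (starRingEnd ℂ) (f x) * ((W x : ℂ) * w s x)) - inner ℂ f (clipMul M W (w s)) := by
      rw [L2.inner_def, ← integral_sub (integrable_mul_of_holder hconj hfc hWw)]
      · refine integral_congr_ae (ae_of_all _ fun x => ?_)
        simp only [RCLike.inner_apply]
        ring
      · refine (integrable_mul_of_holder holderConjugate_two_two hfc2
          (Lp.memLp (clipMul M W (w s)))).congr (ae_of_all _ fun x => ?_)
        simp only [RCLike.inner_apply]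
        ring
    rw [e1, mul_sub, sub_left_inj]
    simp only [hg']
    rw [← hHU, freeGroup_schL2, freeSchwartz_laplacian, inner_smul_right, inner_smul_left,
      Complex.conj_I, hws, hre]
    ring
  rw [hval, enorm_mul]
  have hI : ‖Complex.I‖ₑ = 1 := by rw [← ofReal_norm, Complex.norm_I, ENNReal.ofReal_one]
  rw [hI, one_mul]
  refine (enorm_integral_le_lintegral_enorm _).trans ((lintegral_enorm_mul_le hconj hfc.1
    (hWw.1.sub (Lp.aestronglyMeasurable _))).trans ?_)
  rw [mul_comm, eLpNorm_congr_norm_ae (f := fun x => (starRingEnd ℂ) (f x)) (g := f)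
    (ae_of_all _ fun x => by simp)]
  gcongr
  refine (eLpNorm_sub_clipMul_le hn M hW.1 (w s)).trans ?_
  gcongr
  exact hK s

theorem mixedNorm_le_of_tendsto_of_le {I : Set ℝ} {p q : ℝ≥0∞} {u : ℝ → L2 n} {v : ℕ → ℝ → L2 n}
    {b : ℕ → ℝ≥0∞} {B : ℝ≥0∞}
    (hv : ∀ k, AEStronglyMeasurable (v k) (volume.restrict I))
    (h : ∀ᵐ t ∂volume.restrict I, Tendsto (fun k => v k t) atTop (𝓝 (u t)))
    (hb : ∀ k, mixedNorm I p q (fun t => v k t) ≤ b k) (hB : Tendsto b atTop (𝓝 B)) :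
    mixedNorm I p q (fun t => u t) ≤ B := by
  refine (eLpNorm_le_of_le_liminf (fun k => aemeasurable_eLpNorm (hv k) q) ?_).trans
    ((liminf_le_liminf (Eventually.of_forall hb)).trans_eq hB.liminf_eq)
  filter_upwards [h] with t ht
  refine ((lowerSemicontinuous_eLpNorm q).lowerSemicontinuousAt (u t)).le_liminf.trans ?_
  exact liminf_le_liminf_of_le ht

theorem mixedNorm_indicator (I : Set ℝ) {S : Set ℝ} (hS : MeasurableSet S) (p q : ℝ≥0∞)
    (F : ℝ → L2 n) :
    mixedNorm I p q (fun t => ⇑(S.indicator F t)) = mixedNorm (S ∩ I) p q (fun t => F t) := by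
  have h : (fun t => eLpNorm (⇑(S.indicator F t)) q volume) =
      S.indicator fun t => eLpNorm (F t) q volume := by
    funext t
    by_cases ht : t ∈ S
    · simp [ht]
    · simp only [ht, not_false_eq_true, indicator_of_notMem]
      rw [eLpNorm_congr_ae (Lp.coeFn_zero ..), eLpNorm_zero]
  rw [mixedNorm, h, eLpNorm_indicator_eq_eLpNorm_restrict hS, Measure.restrict_restrict hS]
  rfl

/-! ### Strongly continuous groups of isometries and Duhamel integrals -/

/-- A strongly continuous one-parameter group of isometries. -/
structure IsometricGroup (U : ℝ → L2 n →L[ℂ] L2 n) : Prop where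
  zero : ∀ f, U 0 f = f
  add : ∀ s t f, U (s + t) f = U s (U t f)
  norm_map : ∀ t f, ‖U t f‖ = ‖f‖
  continuous : ∀ f, Continuous fun t => U t f

theorem isometricGroup_freeGroup (n : ℕ) : IsometricGroup (freeGroup n) :=
  ⟨freeGroup_zero, freeGroup_add, norm_freeGroup, continuous_freeGroup_apply⟩

theorem IsUnitaryGroup.isometricGroup {H : L2 n →ₗ.[ℂ] L2 n} {U : ℝ → L2 n →L[ℂ] L2 n}
    (hU : IsUnitaryGroup H U) : IsometricGroup U :=
  ⟨hU.apply_zero, hU.apply_add, hU.norm_map, hU.continuous⟩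

/-- The Duhamel integral `∫₀ᵗ U(t-s) F(s) ds`. -/
def duhamel (U : ℝ → L2 n →L[ℂ] L2 n) (F : ℝ → L2 n) (t : ℝ) : L2 n :=
  ∫ s in (0 : ℝ)..t, U (t - s) (F s)

namespace IsometricGroup
variable {U : ℝ → L2 n →L[ℂ] L2 n}

theorem continuous_uncurry (hU : IsometricGroup U) : Continuous fun x : ℝ × L2 n => U x.1 x.2 :=
  continuous_uncurry_of_isometry hU.norm_map hU.continuous

theorem continuous_comp (hU : IsometricGroup U) {α : Type*} [TopologicalSpace α] {g : α → ℝ}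
    {f : α → L2 n} (hg : Continuous g) (hf : Continuous f) : Continuous fun a => U (g a) (f a) :=
  hU.continuous_uncurry.comp (hg.prodMk hf)

theorem continuousOn_comp (hU : IsometricGroup U) {α : Type*} [TopologicalSpace α] {g : α → ℝ}
    {f : α → L2 n} {s : Set α} (hg : ContinuousOn g s) (hf : ContinuousOn f s) :
    ContinuousOn (fun a => U (g a) (f a)) s :=
  hU.continuous_uncurry.comp_continuousOn (hg.prodMk hf)

theorem aestronglyMeasurable_comp (hU : IsometricGroup U) {α : Type*} [MeasurableSpace α]
    {μ : Measure α} {g : α → ℝ} {f : α → L2 n} (hg : AEStronglyMeasurable g μ)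
    (hf : AEStronglyMeasurable f μ) : AEStronglyMeasurable (fun a => U (g a) (f a)) μ :=
  hU.continuous_uncurry.comp_aestronglyMeasurable (hg.prodMk hf)

theorem integrable_comp (hU : IsometricGroup U) {α : Type*} [MeasurableSpace α]
    {μ : Measure α} {g : α → ℝ} {f : α → L2 n} (hg : AEStronglyMeasurable g μ)
    (hf : Integrable f μ) : Integrable (fun a => U (g a) (f a)) μ :=
  hf.mono (hU.aestronglyMeasurable_comp hg hf.1) (ae_of_all _ fun _ => (hU.norm_map _ _).le)

theorem intervalIntegrable_comp (hU : IsometricGroup U) {g : ℝ → ℝ} (hg : Continuous g)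
    {F : ℝ → L2 n} {a b : ℝ} (hF : IntervalIntegrable F volume a b) :
    IntervalIntegrable (fun s => U (g s) (F s)) volume a b :=
  ⟨hU.integrable_comp hg.aestronglyMeasurable hF.1, hU.integrable_comp hg.aestronglyMeasurable hF.2⟩

theorem duhamel_eq (hU : IsometricGroup U) {F : ℝ → L2 n} {t : ℝ}
    (hF : IntervalIntegrable F volume 0 t) :
    duhamel U F t = U t (∫ s in (0 : ℝ)..t, U (-s) (F s)) := by
  rw [← (U t).intervalIntegral_comp_comm (hU.intervalIntegrable_comp continuous_neg hF)]
  refine intervalIntegral.integral_congr fun s _ => ?_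
  beta_reduce
  rw [← hU.add, sub_eq_add_neg]

theorem continuousOn_duhamel (hU : IsometricGroup U) {F : ℝ → L2 n} {T : ℝ}
    (hF : IntegrableOn F (Icc 0 T)) : ContinuousOn (duhamel U F) (Icc 0 T) := by
  have h1 : ContinuousOn (fun t => U t (∫ s in (0 : ℝ)..t, U (-s) (F s))) (Icc 0 T) := by
    refine hU.continuousOn_comp continuousOn_id ?_
    rcases lt_or_ge T 0 with h | h
    · rw [Icc_eq_empty h.not_ge]
      exact continuousOn_empty _
    · refine (intervalIntegral.continuousOn_primitive_interval ?_).mono Icc_subset_uIcc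
      rw [uIcc_of_le h]
      exact hU.integrable_comp continuous_neg.aestronglyMeasurable hF
  refine h1.congr fun t ht => hU.duhamel_eq ?_
  rw [intervalIntegrable_iff_integrableOn_Icc_of_le ht.1]
  exact hF.mono_set (Icc_subset_Icc_right ht.2)

theorem norm_duhamel_le (hU : IsometricGroup U) (F : ℝ → L2 n) {t : ℝ} (ht : 0 ≤ t) :
    ‖duhamel U F t‖ₑ ≤ ∫⁻ s in Icc 0 t, ‖F s‖ₑ := by
  rw [duhamel, intervalIntegral.integral_of_le ht, ← integral_Icc_eq_integral_Ioc]
  refine (enorm_integral_le_lintegral_enorm _).trans_eq ?_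
  refine lintegral_congr fun s => ?_
  rw [← ofReal_norm, hU.norm_map, ofReal_norm]

end IsometricGroup

theorem intervalIntegrable_of_integrableOn {F : ℝ → L2 n} {T t : ℝ}
    (hF : IntegrableOn F (Icc 0 T)) (ht : t ∈ Icc 0 T) : IntervalIntegrable F volume 0 t := by
  rw [intervalIntegrable_iff_integrableOn_Icc_of_le ht.1]
  exact hF.mono_set (Icc_subset_Icc_right ht.2)

theorem duhamel_add {U : ℝ → L2 n →L[ℂ] L2 n} (hU : IsometricGroup U) {F G : ℝ → L2 n} {T t : ℝ}
    (hF : IntegrableOn F (Icc 0 T)) (hG : IntegrableOn G (Icc 0 T)) (ht : t ∈ Icc 0 T) :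
    duhamel U (fun s => F s + G s) t = duhamel U F t + duhamel U G t := by
  have hc : Continuous fun s : ℝ => t - s := continuous_const.sub continuous_id
  rw [duhamel, duhamel, duhamel, ← intervalIntegral.integral_add
    (hU.intervalIntegrable_comp hc (intervalIntegrable_of_integrableOn hF ht))
    (hU.intervalIntegrable_comp hc (intervalIntegrable_of_integrableOn hG ht))]
  simp only [map_add]

theorem duhamel_smul (U : ℝ → L2 n →L[ℂ] L2 n) (c : ℂ) (F : ℝ → L2 n) (t : ℝ) :
    duhamel U (fun s => c • F s) t = c • duhamel U F t := by
  simp only [duhamel, map_smul, intervalIntegral.integral_smul]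

theorem duhamel_sub {U : ℝ → L2 n →L[ℂ] L2 n} (hU : IsometricGroup U) {F G : ℝ → L2 n} {T t : ℝ}
    (hF : IntegrableOn F (Icc 0 T)) (hG : IntegrableOn G (Icc 0 T)) (ht : t ∈ Icc 0 T) :
    duhamel U (fun s => F s - G s) t = duhamel U F t - duhamel U G t := by
  have hc : Continuous fun s : ℝ => t - s := continuous_const.sub continuous_id
  rw [duhamel, duhamel, duhamel, ← intervalIntegral.integral_sub
    (hU.intervalIntegrable_comp hc (intervalIntegrable_of_integrableOn hF ht))
    (hU.intervalIntegrable_comp hc (intervalIntegrable_of_integrableOn hG ht))]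
  simp only [map_sub]

theorem duhamel_congr (U : ℝ → L2 n →L[ℂ] L2 n) {F G : ℝ → L2 n} {t : ℝ} (ht : 0 ≤ t)
    (h : ∀ᵐ s ∂volume.restrict (Icc 0 t), F s = G s) : duhamel U F t = duhamel U G t := by
  rw [duhamel, duhamel, intervalIntegral.integral_of_le ht, intervalIntegral.integral_of_le ht,
    ← integral_Icc_eq_integral_Ioc, ← integral_Icc_eq_integral_Ioc]
  refine integral_congr_ae ?_
  filter_upwards [h] with s hs
  rw [hs]

/-! ### Strichartz estimates for a group -/

/-- Strichartz estimates for `U` on `[0, T]` with constant `C`. -/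
def StrichartzOn (U : ℝ → L2 n →L[ℂ] L2 n) (T : ℝ) (C : ℝ≥0∞) : Prop :=
  ∀ a b p₁ q₁ : ℝ≥0∞, Admissible n a b → Admissible n p₁ q₁ →
    ∀ (u₀ : L2 n) (F : ℝ → L2 n), IntegrableOn F (Icc 0 T) →
      mixedNorm (Icc 0 T) a b (fun t => ⇑(U t u₀ + duhamel U F t)) ≤
        C * ‖u₀‖ₑ + C * mixedNorm (Icc 0 T) p₁.conjExponent q₁.conjExponent (fun t => F t)

theorem Admissible.one_le_left {p q : ℝ≥0∞} (h : Admissible n p q) : 1 ≤ p :=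
  le_trans (by norm_num) h.1

theorem Admissible.one_le_right {p q : ℝ≥0∞} (h : Admissible n p q) : 1 ≤ q :=
  le_trans (by norm_num) h.2.1

theorem StrichartzOn.mono {U : ℝ → L2 n →L[ℂ] L2 n} {T T' : ℝ} {C : ℝ≥0∞}
    (h : StrichartzOn U T C) (hT : T' ≤ T) : StrichartzOn U T' C := by
  intro a b p₁ q₁ hab hpq u₀ F hF
  set G := (Icc 0 T').indicator F with hG
  have hGi : IntegrableOn G (Icc 0 T) := (hF.integrable_indicator measurableSet_Icc).integrableOn
  have := h a b p₁ q₁ hab hpq u₀ G hGi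
  have e1 : mixedNorm (Icc 0 T') a b (fun t => ⇑(U t u₀ + duhamel U F t)) =
      mixedNorm (Icc 0 T') a b (fun t => ⇑(U t u₀ + duhamel U G t)) := by
    refine mixedNorm_congr_ae ?_
    filter_upwards [ae_restrict_mem measurableSet_Icc] with t ht
    rw [duhamel_congr U ht.1 (F := F) (G := G)]
    filter_upwards [ae_restrict_mem measurableSet_Icc] with s hs
    rw [hG, indicator_of_mem (Icc_subset_Icc_right ht.2 hs)]
  rw [e1]
  refine (mixedNorm_mono_set (Icc_subset_Icc_right hT) _ _ _).trans (this.trans ?_)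
  gcongr
  rw [hG, mixedNorm_indicator _ measurableSet_Icc]
  exact mixedNorm_mono_set inter_subset_left _ _ _

theorem mixedNorm_zero (I : Set ℝ) (p q : ℝ≥0∞) :
    mixedNorm I p q (fun _ => ⇑(0 : L2 n)) = 0 := by
  have h : (fun _ : ℝ => eLpNorm (⇑(0 : L2 n)) q volume) = 0 := by
    funext t
    rw [eLpNorm_congr_ae (Lp.coeFn_zero ..), eLpNorm_zero]
    rfl
  rw [mixedNorm, h, eLpNorm_zero]

theorem mixedNorm_one_two (I : Set ℝ) (F : ℝ → L2 n) :
    mixedNorm I 1 2 (fun t => F t) = ∫⁻ t in I, ‖F t‖ₑ := by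
  rw [mixedNorm, eLpNorm_one_eq_lintegral_enorm]
  simp only [eLpNorm_L2_two, enorm_eq_self]

theorem duhamel_zero (U : ℝ → L2 n →L[ℂ] L2 n) (t : ℝ) : duhamel U (fun _ => 0) t = 0 := by
  simp [duhamel]

namespace StrichartzOn
variable {U : ℝ → L2 n →L[ℂ] L2 n} {T : ℝ} {C : ℝ≥0∞} {a b p₁ q₁ : ℝ≥0∞}

theorem homogeneous (h : StrichartzOn U T C) (hab : Admissible n a b) (f : L2 n) :
    mixedNorm (Icc 0 T) a b (fun t => U t f) ≤ C * ‖f‖ₑ := by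
  have := h a b ⊤ 2 hab (admissible_top_two n) f (fun _ => 0) integrableOn_zero
  simpa only [duhamel_zero, add_zero, mixedNorm_zero, mul_zero] using this

theorem inhomogeneous (h : StrichartzOn U T C) (hab : Admissible n a b)
    (hpq : Admissible n p₁ q₁) {F : ℝ → L2 n} (hF : IntegrableOn F (Icc 0 T)) :
    mixedNorm (Icc 0 T) a b (fun t => duhamel U F t) ≤
      C * mixedNorm (Icc 0 T) p₁.conjExponent q₁.conjExponent (fun t => F t) := by
  have := h a b p₁ q₁ hab hpq 0 F hF
  simpa only [map_zero, zero_add, enorm_zero, mul_zero] using this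

end StrichartzOn

theorem continuousOn_clipMul_comp {I : Set ℝ} (hn : 3 ≤ n) {V : ℝ → Space n → ℝ}
    (hV : ContinuousInLp I ((n : ℝ≥0∞) / 2) V) (M : ℝ≥0) {w : ℝ → L2 n} (hw : ContinuousOn w I) :
    ContinuousOn (fun t => clipMul M (V t) (w t)) I := by
  intro t ht
  have h1 : Tendsto (fun s => clipMul M (V s) (w s - w t)) (𝓝[I] t) (𝓝 0) := by
    refine squeeze_zero_norm (fun s => norm_clipMul_le M (V s) _) ?_
    have : Tendsto (fun s => (M : ℝ) * ‖w s - w t‖) (𝓝[I] t) (𝓝 (M * ‖w t - w t‖)) :=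
      (((hw t ht).sub tendsto_const_nhds).norm).const_mul _
    simpa using this
  have h2 := h1.add (continuousOn_clipMul hn hV M (w t) t ht)
  rw [ContinuousWithinAt]
  simpa only [map_sub, sub_add_cancel, zero_add] using h2

theorem mixedNorm_mul_le {I : Set ℝ} {p q q' : ℝ≥0∞} {u v : ℝ → L2 n} {ε : ℝ≥0}
    (h : ∀ᵐ t ∂volume.restrict I, eLpNorm (u t) q volume ≤ ε * eLpNorm (v t) q' volume) :
    mixedNorm I p q (fun t => u t) ≤ ε * mixedNorm I p q' (fun t => v t) :=
  eLpNorm_le_nnreal_smul_eLpNorm_of_ae_le_mul' (by simpa only [enorm_eq_self] using h) p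

/-- A priori bound for the limit `w` of `U(t) u₀ + ∫₀ᵗ U(t-s) (G_k + c V_k w) ds`, where `V_k` are
the truncations of `V`. -/
theorem mixedNorm_le_of_tendsto_duhamel (hn : 3 ≤ n) {U : ℝ → L2 n →L[ℂ] L2 n}
    (hU : IsometricGroup U) {T : ℝ} {C : ℝ≥0∞} (hS : StrichartzOn U T C) {V : ℝ → Space n → ℝ}
    (hV : ContinuousInLp (Icc 0 T) ((n : ℝ≥0∞) / 2) V) {w : ℝ → L2 n}
    (hw : ContinuousOn w (Icc 0 T)) {u₀ : L2 n} {G : ℕ → ℝ → L2 n}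
    (hG : ∀ k, IntegrableOn (G k) (Icc 0 T)) {B : ℝ≥0∞}
    (hB : ∀ k a b, Admissible n a b →
      mixedNorm (Icc 0 T) a b (fun t => duhamel U (G k) t) ≤ C * B)
    {c : ℂ} (hc : ‖c‖ = 1)
    (hlim : ∀ t ∈ Icc 0 T, Tendsto (fun k : ℕ => U t u₀ + duhamel U (G k) t +
      c • duhamel U (fun s => clipMul k (V s) (w s)) t) atTop (𝓝 (w t)))
    {M ε : ℝ≥0} (hε : ∀ᵐ t ∂volume.restrict (Icc 0 T), tail M (V t) ≤ ε)
    {a b : ℝ≥0∞} (hab : Admissible n a b) :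
    mixedNorm (Icc 0 T) a b (fun t => w t) ≤ C * ‖u₀‖ₑ + C * B +
      C * (M * ∫⁻ t in Icc 0 T, ‖w t‖ₑ) + C * (ε * mixedNorm (Icc 0 T) 2 (sobExp n) (fun t => w t)) := by
  have hcl : ∀ K : ℝ≥0, ContinuousOn (fun s => clipMul K (V s) (w s)) (Icc 0 T) := fun K =>
    continuousOn_clipMul_comp hn hV K hw
  have hci : ∀ K : ℝ≥0, IntegrableOn (fun s => clipMul K (V s) (w s)) (Icc 0 T) := fun K =>
    (hcl K).integrableOn_compact isCompact_Icc
  have hUu : Continuous fun t => U t u₀ := hU.continuous u₀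
  have hDc : ∀ {F : ℝ → L2 n}, IntegrableOn F (Icc 0 T) →
      AEStronglyMeasurable (duhamel U F) (volume.restrict (Icc 0 T)) := fun hF =>
    (hU.continuousOn_duhamel hF).aestronglyMeasurable measurableSet_Icc
  have hDs : ∀ K : ℝ≥0, AEStronglyMeasurable (fun t =>
      c • duhamel U (fun s => clipMul K (V s) (w s)) t) (volume.restrict (Icc 0 T)) := fun K =>
    (hDc (hci K)).const_smul c
  refine mixedNorm_le_of_tendsto (v := fun (k : ℕ) t => U t u₀ + duhamel U (G k) t +
      c • duhamel U (fun s => clipMul k (V s) (w s)) t) (fun k => ?_) ?_ ?_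
  · exact (hUu.aestronglyMeasurable.add (hDc (hG k))).add (hDs k)
  · filter_upwards [ae_restrict_mem measurableSet_Icc] with t ht using hlim t ht
  refine Eventually.frequently ?_
  filter_upwards [eventually_ge_atTop ⌈M⌉₊] with k hk
  have hMk : M ≤ (k : ℝ≥0) := (Nat.le_ceil M).trans (by exact_mod_cast hk)
  have hdiff : IntegrableOn (fun s => clipMul k (V s) (w s) - clipMul M (V s) (w s)) (Icc 0 T) :=
    (hci k).sub (hci M)
  have e : mixedNorm (Icc 0 T) a b (fun t => ⇑(U t u₀ + duhamel U (G k) t +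
      c • duhamel U (fun s => clipMul k (V s) (w s)) t)) =
      mixedNorm (Icc 0 T) a b (fun t => ⇑((U t u₀ + duhamel U (G k) t +
        c • duhamel U (fun s => clipMul M (V s) (w s)) t) +
        c • duhamel U (fun s => clipMul k (V s) (w s) - clipMul M (V s) (w s)) t)) := by
    refine mixedNorm_congr_ae ?_
    filter_upwards [ae_restrict_mem measurableSet_Icc] with t ht
    rw [duhamel_sub hU (hci k) (hci M) ht, smul_sub, add_assoc (_ + _), add_sub_cancel]
  rw [e]
  have ha := hab.one_le_left
  have hb := hab.one_le_right
  refine (mixedNorm_add_le ha hb ((hUu.aestronglyMeasurable.add (hDc (hG k))).add (hDs M))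
    ((hDc hdiff).const_smul c)).trans (add_le_add ?_ ?_)
  · refine (mixedNorm_add_le ha hb (hUu.aestronglyMeasurable.add (hDc (hG k))) (hDs M)).trans
      (add_le_add ?_ ?_)
    · exact (mixedNorm_add_le ha hb hUu.aestronglyMeasurable (hDc (hG k))).trans
        (add_le_add (hS.homogeneous hab u₀) (hB k a b hab))
    · rw [mixedNorm_smul_of_norm_one _ _ _ _ hc]
      refine (hS.inhomogeneous hab (admissible_top_two n) (hci M)).trans ?_
      rw [conjExponent_top, conjExponent_two, mixedNorm_one_two]
      gcongr
      rw [← lintegral_const_mul' _ _ ENNReal.coe_ne_top]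
      refine lintegral_mono fun t => ?_
      rw [← ofReal_norm, ← ofReal_norm, ← ENNReal.ofReal_coe_nnreal, ← ENNReal.ofReal_mul (by simp)]
      exact ENNReal.ofReal_le_ofReal (norm_clipMul_le M (V t) (w t))
  · simp only [Pi.smul_apply]
    rw [mixedNorm_smul_of_norm_one _ _ _ _ hc]
    refine (hS.inhomogeneous hab (admissible_two_sobExp hn) hdiff).trans ?_
    gcongr
    rw [conjExponent_two]
    refine mixedNorm_mul_le ?_
    filter_upwards [hε, ae_restrict_mem measurableSet_Icc] with t h1 ht
    refine (eLpNorm_clipMul_sub_le hn hMk (hV t ht).1.1 (w t)).trans ?_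
    gcongr

theorem mixedNorm_top_two_lt_top {T : ℝ} {w : ℝ → L2 n} (hw : ContinuousOn w (Icc 0 T)) :
    mixedNorm (Icc 0 T) ⊤ 2 (fun t => w t) < ⊤ := by
  obtain ⟨K, hK⟩ := isCompact_Icc.exists_bound_of_continuousOn hw
  refine (mixedNorm_top_le measurableSet_Icc (c := ENNReal.ofReal K) fun t ht => ?_).trans_lt
    ENNReal.ofReal_lt_top
  rw [← ofReal_norm]
  exact ENNReal.ofReal_le_ofReal (hK t ht)

theorem lintegral_enorm_le_mixedNorm_top {T : ℝ} {w : ℝ → L2 n} :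
    ∫⁻ t in Icc 0 T, ‖w t‖ₑ ≤ ENNReal.ofReal T * mixedNorm (Icc 0 T) ⊤ 2 (fun t => w t) := by
  have h : ∀ᵐ t ∂volume.restrict (Icc 0 T), ‖w t‖ₑ ≤ mixedNorm (Icc 0 T) ⊤ 2 (fun t => w t) := by
    filter_upwards [ae_le_eLpNormEssSup (f := fun t => eLpNorm (w t) 2 volume)
      (μ := volume.restrict (Icc 0 T))] with t ht
    rwa [enorm_eq_self, eLpNorm_L2_two, ← eLpNorm_exponent_top] at ht
  refine (lintegral_mono_ae h).trans_eq ?_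
  rw [lintegral_const, Measure.restrict_apply_univ, Real.volume_Icc, sub_zero, mul_comm]

theorem le_two_mul_of_le_add_half {Y A : ℝ≥0∞} (hY : Y ≠ ⊤) (h : Y ≤ A + 2⁻¹ * Y) : Y ≤ 2 * A := by
  have h1 : 2⁻¹ * Y + 2⁻¹ * Y = Y := by rw [← add_mul, ENNReal.inv_two_add_inv_two, one_mul]
  have h2 : 2⁻¹ * Y ≤ A := by
    have h3 : 2⁻¹ * Y + 2⁻¹ * Y ≤ A + 2⁻¹ * Y := by rwa [h1]
    exact (ENNReal.add_le_add_iff_right (ENNReal.mul_ne_top (by simp) hY)).1 h3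
  calc Y = 2 * (2⁻¹ * Y) := by rw [← mul_assoc, ENNReal.mul_inv_cancel (by simp) (by simp), one_mul]
    _ ≤ 2 * A := by gcongr

/-- On a short interval the potential can be absorbed. -/
theorem mixedNorm_le_of_tendsto_duhamel_of_small (hn : 3 ≤ n) {U : ℝ → L2 n →L[ℂ] L2 n}
    (hU : IsometricGroup U) {T : ℝ} {C : ℝ≥0∞} (hS : StrichartzOn U T C) {V : ℝ → Space n → ℝ}
    (hV : ContinuousInLp (Icc 0 T) ((n : ℝ≥0∞) / 2) V) {w : ℝ → L2 n}
    (hw : ContinuousOn w (Icc 0 T)) {u₀ : L2 n} {G : ℕ → ℝ → L2 n}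
    (hG : ∀ k, IntegrableOn (G k) (Icc 0 T)) {B : ℝ≥0∞}
    (hB : ∀ k a b, Admissible n a b →
      mixedNorm (Icc 0 T) a b (fun t => duhamel U (G k) t) ≤ C * B)
    {c : ℂ} (hc : ‖c‖ = 1)
    (hlim : ∀ t ∈ Icc 0 T, Tendsto (fun k : ℕ => U t u₀ + duhamel U (G k) t +
      c • duhamel U (fun s => clipMul k (V s) (w s)) t) atTop (𝓝 (w t)))
    {M ε : ℝ≥0} (hε : ∀ᵐ t ∂volume.restrict (Icc 0 T), tail M (V t) ≤ ε)
    (hsmall : C * (M * ENNReal.ofReal T + ε) ≤ 2⁻¹)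
    (hfin : mixedNorm (Icc 0 T) 2 (sobExp n) (fun t => w t) < ⊤)
    {a b : ℝ≥0∞} (hab : Admissible n a b) :
    mixedNorm (Icc 0 T) a b (fun t => w t) ≤ 2 * C * (‖u₀‖ₑ + B) := by
  set X := mixedNorm (Icc 0 T) 2 (sobExp n) (fun t => w t)
  set Z := mixedNorm (Icc 0 T) ⊤ 2 (fun t => w t) with hZ
  have hZt : Z < ⊤ := mixedNorm_top_two_lt_top hw
  have key : ∀ {a b : ℝ≥0∞}, Admissible n a b → mixedNorm (Icc 0 T) a b (fun t => w t) ≤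
      C * (‖u₀‖ₑ + B) + 2⁻¹ * max X Z := by
    intro a b hab
    refine (mixedNorm_le_of_tendsto_duhamel hn hU hS hV hw hG hB hc hlim hε hab).trans ?_
    calc C * ‖u₀‖ₑ + C * B + C * (M * ∫⁻ t in Icc 0 T, ‖w t‖ₑ) + C * (ε * X)
        ≤ C * ‖u₀‖ₑ + C * B + C * (M * (ENNReal.ofReal T * max X Z)) + C * (ε * max X Z) := by
          gcongr
          · exact lintegral_enorm_le_mixedNorm_top.trans (by gcongr; exact le_max_right _ _)
          · exact le_max_left _ _
      _ = C * (‖u₀‖ₑ + B) + C * (M * ENNReal.ofReal T + ε) * max X Z := by ring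
      _ ≤ _ := by gcongr
  have hY : max X Z ≤ 2 * (C * (‖u₀‖ₑ + B)) :=
    le_two_mul_of_le_add_half (max_lt hfin hZt).ne
      (max_le (key (admissible_two_sobExp hn)) (key (admissible_top_two n)))
  calc mixedNorm (Icc 0 T) a b (fun t => w t) ≤ C * (‖u₀‖ₑ + B) + 2⁻¹ * max X Z := key hab
    _ ≤ C * (‖u₀‖ₑ + B) + 2⁻¹ * (2 * (C * (‖u₀‖ₑ + B))) := by gcongr
    _ = 2 * C * (‖u₀‖ₑ + B) := by
      rw [← mul_assoc, ENNReal.inv_mul_cancel (by simp) (by simp), one_mul, ← two_mul, mul_assoc]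

theorem continuousInLp_const {W : Space n → ℝ}
    (hW : MemLp W ((n : ℝ≥0∞) / 2) volume) (I : Set ℝ) :
    ContinuousInLp I ((n : ℝ≥0∞) / 2) (fun _ => W) := by
  intro t _
  refine ⟨hW, ?_⟩
  simp only [sub_self]
  rw [show (fun _ : Space n => (0 : ℝ)) = 0 from rfl, eLpNorm_zero]
  exact tendsto_const_nhds

theorem cauchySeq_of_enorm_sub_le {E : Type*} [NormedAddCommGroup E] {s : ℕ → E} {b : ℕ → ℝ≥0∞}
    (h : ∀ k m, k ≤ m → ‖s k - s m‖ₑ ≤ b k) (hb : Tendsto b atTop (𝓝 0)) : CauchySeq s := by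
  rw [EMetric.cauchySeq_iff']
  intro ε hε
  obtain ⟨N, hN⟩ := (hb.eventually_lt_const hε).exists
  refine ⟨N, fun m hm => ?_⟩
  rw [edist_comm, edist_eq_enorm_sub]
  exact (h N m hm).trans_lt hN

theorem defect_eq (U : ℝ → L2 n →L[ℂ] L2 n) (M : ℝ≥0) (W : Space n → ℝ) (t : ℝ) (f : L2 n) :
    defect U M W t f = freeGroup n t f - U t f -
      Complex.I • duhamel U (fun s => clipMul M W (freeGroup n s f)) t := rfl

section Transfer

variable {W : Space n → ℝ} {H : L2 n →ₗ.[ℂ] L2 n} {U : ℝ → L2 n →L[ℂ] L2 n}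

theorem integrableOn_clipMul_freeGroup (M : ℝ≥0) (W : Space n → ℝ) (f : L2 n) (T : ℝ) :
    IntegrableOn (fun s => clipMul M W (freeGroup n s f)) (Icc 0 T) :=
  ((clipMul M W).continuous.comp (continuous_freeGroup_apply f)).continuousOn.integrableOn_compact
    isCompact_Icc

theorem mixedNorm_Icc_lt_top_of_le {T : ℝ} {w : ℝ → L2 n} {q : ℝ≥0∞} {K : ℝ≥0}
    (hK : ∀ t ∈ Icc 0 T, eLpNorm (w t) q volume ≤ K) :
    mixedNorm (Icc 0 T) 2 q (fun t => w t) < ⊤ := by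
  have h : mixedNorm (Icc 0 T) 2 q (fun t => w t) ≤
      eLpNorm (fun _ => (K : ℝ≥0∞)) 2 (volume.restrict (Icc 0 T)) := by
    refine eLpNorm_mono_enorm_ae ?_
    filter_upwards [ae_restrict_mem measurableSet_Icc] with t ht using hK t ht
  refine h.trans_lt ?_
  rw [eLpNorm_const' _ (by norm_num) (by norm_num)]
  refine ENNReal.mul_lt_top (by simp) (ENNReal.rpow_lt_top_of_nonneg (by norm_num) ?_)
  rw [Measure.restrict_apply_univ]
  exact measure_Icc_lt_top.ne

theorem enorm_defect_sub_le (hn : 3 ≤ n) (hW : MemLp W ((n : ℝ≥0∞) / 2) volume)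
    (hU : IsometricGroup U) {T : ℝ} (hT : 0 < T) {C : ℝ≥0∞} (hS : StrichartzOn U T C)
    {M K : ℝ≥0} (hMK : M ≤ K) (f : L2 n) {t : ℝ} (ht : t ∈ Icc 0 T) :
    ‖defect U M W t f - defect U K W t f‖ₑ ≤
      C * (tail M W * mixedNorm (Icc 0 T) 2 (sobExp n) (fun s => freeGroup n s f)) := by
  have hi : IntegrableOn (fun s => clipMul K W (freeGroup n s f) - clipMul M W (freeGroup n s f))
      (Icc 0 T) :=
    (integrableOn_clipMul_freeGroup K W f T).sub (integrableOn_clipMul_freeGroup M W f T)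
  have e : defect U M W t f - defect U K W t f = Complex.I • duhamel U
      (fun s => clipMul K W (freeGroup n s f) - clipMul M W (freeGroup n s f)) t := by
    rw [duhamel_sub hU (integrableOn_clipMul_freeGroup K W f T)
      (integrableOn_clipMul_freeGroup M W f T) ht, defect_eq, defect_eq, smul_sub]
    abel
  rw [e, enorm_smul, show ‖Complex.I‖ₑ = 1 by rw [← ofReal_norm]; simp, one_mul]
  refine (enorm_le_mixedNorm_top hT (hU.continuousOn_duhamel hi) ht).trans ?_
  refine (hS.inhomogeneous (admissible_top_two n) (admissible_two_sobExp hn) hi).trans ?_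
  gcongr
  rw [conjExponent_two]
  have hfin : tail M W ≠ ⊤ := ((tail_le M W).trans_lt hW.2).ne
  rw [← ENNReal.coe_toNNReal hfin]
  refine mixedNorm_mul_le (ae_of_all _ fun s => ?_)
  rw [ENNReal.coe_toNNReal hfin]
  exact eLpNorm_clipMul_sub_le hn hMK hW.1 _

theorem tendsto_defect_schL2 (hn : 3 ≤ n) (hW : MemLp W ((n : ℝ≥0∞) / 2) volume)
    (hH : IsSelfAdjointRealization W H) (hU : IsUnitaryGroup H U) {T : ℝ} (hT : 0 < T) {C : ℝ≥0}
    (hS : StrichartzOn U T C) (φ : 𝓢(Space n, ℂ)) {t : ℝ} (ht : t ∈ Icc 0 T) :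
    Tendsto (fun k : ℕ => defect U k W t (schL2 n φ)) atTop (𝓝 0) := by
  have hg := hU.isometricGroup
  obtain ⟨K, hK⟩ := exists_eLpNorm_freeGroup_schL2_le φ (two_le_sobExp hn)
  set X := mixedNorm (Icc 0 T) 2 (sobExp n) (fun s => freeGroup n s (schL2 n φ)) with hX
  have hXt : X < ⊤ := mixedNorm_Icc_lt_top_of_le fun t _ => hK t
  have htail := tendsto_tail hn hW
  have h0 : Tendsto (fun k : ℕ => C * (tail k W * X)) atTop (𝓝 0) := by
    have := ENNReal.Tendsto.const_mul (a := (C : ℝ≥0∞))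
      (ENNReal.Tendsto.mul_const (b := X) htail (Or.inr hXt.ne)) (Or.inr ENNReal.coe_ne_top)
    simpa using this
  have hcau : CauchySeq fun k : ℕ => defect U k W t (schL2 n φ) := by
    refine cauchySeq_of_enorm_sub_le (fun k m hkm => ?_) h0
    exact enorm_defect_sub_le hn hW hg hT hS (by exact_mod_cast hkm) _ ht
  obtain ⟨g, hgl⟩ := cauchySeq_tendsto_of_complete hcau
  suffices g = 0 by rwa [this] at hgl
  have hort : ∀ h : H.domain, inner ℂ (h : L2 n) g = 0 := by
    intro h
    have hl : Tendsto (fun k : ℕ => inner ℂ (h : L2 n) (defect U k W t (schL2 n φ))) atTop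
        (𝓝 (inner ℂ (h : L2 n) g)) := tendsto_const_nhds.inner hgl
    refine tendsto_nhds_unique hl ?_
    have e : ∀ s, U (s - t) (h : L2 n) = U s (U (-t) h) := fun s => by
      rw [sub_eq_add_neg, hg.add]
    have hm : AEMeasurable (fun s => eLpNorm (U (s - t) (h : L2 n)) (sobExp n) volume)
        (volume.restrict (Icc 0 t)) :=
      aemeasurable_eLpNorm (hg.continuous_comp (continuous_id.sub continuous_const)
        continuous_const).aestronglyMeasurable _
    have hN : mixedNorm (Icc 0 t) 2 (sobExp n) (fun s => U (s - t) (h : L2 n)) < ⊤ := by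
      simp only [e]
      refine ((hS.mono ht.2).homogeneous (admissible_two_sobExp hn) _).trans_lt ?_
      exact ENNReal.mul_lt_top ENNReal.coe_lt_top enorm_lt_top
    have hIntg : ∫⁻ s in Icc 0 t, eLpNorm (U (s - t) (h : L2 n)) (sobExp n) volume < ⊤ := by
      refine (mixedNorm_one_le 2 (sobExp n) (by norm_num) hm).trans_lt ?_
      exact ENNReal.mul_lt_top hN (ENNReal.rpow_lt_top_of_nonneg (by norm_num) ENNReal.ofReal_ne_top)
    have hfin := ae_lt_top' hm hIntg.ne
    rw [tendsto_zero_iff_enorm_tendsto_zero]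
    refine tendsto_of_tendsto_of_tendsto_of_le_of_le tendsto_const_nhds ?_ (fun _ => zero_le)
      (fun k => enorm_inner_defect_le hn hW hH hU h φ hK k ht.1 hfin)
    have := ENNReal.Tendsto.mul_const (ENNReal.Tendsto.mul_const (b := (K : ℝ≥0∞)) htail
      (Or.inr ENNReal.coe_ne_top)) (Or.inr hIntg.ne)
    simpa using this
  have hd : Dense (H.domain : Set (L2 n)) := hH.1.dense_domain
  refine hd.eq_zero_of_inner_right ℂ fun h hh => hort ⟨h, hh⟩

theorem enorm_defect_schL2_le (hn : 3 ≤ n) (hW : MemLp W ((n : ℝ≥0∞) / 2) volume)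
    (hH : IsSelfAdjointRealization W H) (hU : IsUnitaryGroup H U) {T : ℝ} (hT : 0 < T) {C : ℝ≥0}
    (hS : StrichartzOn U T C) (M : ℝ≥0) (φ : 𝓢(Space n, ℂ)) {t : ℝ} (ht : t ∈ Icc 0 T) :
    ‖defect U M W t (schL2 n φ)‖ₑ ≤ C * (tail M W *
      mixedNorm (Icc 0 T) 2 (sobExp n) (fun s => freeGroup n s (schL2 n φ))) := by
  have h1 : Tendsto (fun k : ℕ => ‖defect U M W t (schL2 n φ) - defect U k W t (schL2 n φ)‖ₑ)
      atTop (𝓝 ‖defect U M W t (schL2 n φ) - 0‖ₑ) :=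
    (tendsto_const_nhds.sub (tendsto_defect_schL2 hn hW hH hU hT hS φ ht)).enorm
  rw [sub_zero] at h1
  refine le_of_tendsto h1 ?_
  filter_upwards [eventually_ge_atTop ⌈M⌉₊] with k hk
  exact enorm_defect_sub_le hn hW hU.isometricGroup hT hS
    ((Nat.le_ceil M).trans (by exact_mod_cast hk)) _ ht

theorem mixedNorm_freeGroup_schL2_le (hn : 3 ≤ n) (hW : MemLp W ((n : ℝ≥0∞) / 2) volume)
    (hH : IsSelfAdjointRealization W H) (hU : IsUnitaryGroup H U) {T : ℝ} (hT : 0 < T) {C : ℝ≥0}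
    (hS : StrichartzOn U T C) {M ε : ℝ≥0} (hε : tail M W ≤ ε)
    (hsmall : C * (M * ENNReal.ofReal T + ε) ≤ (2⁻¹ : ℝ≥0∞)) (φ : 𝓢(Space n, ℂ)) {a b : ℝ≥0∞}
    (hab : Admissible n a b) :
    mixedNorm (Icc 0 T) a b (fun s => freeGroup n s (schL2 n φ)) ≤ 2 * C * ‖schL2 n φ‖ₑ := by
  obtain ⟨K, hK⟩ := exists_eLpNorm_freeGroup_schL2_le φ (two_le_sobExp hn)
  have := mixedNorm_le_of_tendsto_duhamel_of_small hn hU.isometricGroup hS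
    (continuousInLp_const hW (Icc 0 T)) (w := fun s => freeGroup n s (schL2 n φ))
    (continuous_freeGroup_apply _).continuousOn (u₀ := schL2 n φ) (G := fun _ _ => 0)
    (fun _ => integrableOn_zero) (B := 0)
    (fun _ a b _ => by simp only [duhamel_zero, mixedNorm_zero, mul_zero, le_refl]) (c := Complex.I) (by simp) ?_ (ae_of_all _ fun _ => hε)
    hsmall (mixedNorm_Icc_lt_top_of_le fun t _ => hK t) hab
  · simpa only [add_zero] using this
  · intro t ht
    have h1 := (tendsto_const_nhds (x := freeGroup n t (schL2 n φ))).sub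
      (tendsto_defect_schL2 hn hW hH hU hT hS φ ht)
    rw [sub_zero] at h1
    refine h1.congr fun k => ?_
    rw [defect_eq, duhamel_zero]
    abel

theorem exists_seq_schL2_tendsto (f : L2 n) :
    ∃ φ : ℕ → 𝓢(Space n, ℂ), Tendsto (fun k => schL2 n (φ k)) atTop (𝓝 f) := by
  obtain ⟨x, hx, hl⟩ := mem_closure_iff_seq_limit.1 (denseRange_schL2 n f)
  choose φ hφ using hx
  exact ⟨φ, by simpa only [hφ] using hl⟩

theorem mixedNorm_group_le_of_schL2 {U : ℝ → L2 n →L[ℂ] L2 n} (hU : IsometricGroup U)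
    {I : Set ℝ} {C a b : ℝ≥0∞} (hC : C ≠ ⊤)
    (h : ∀ φ, mixedNorm I a b (fun s => U s (schL2 n φ)) ≤ C * ‖schL2 n φ‖ₑ) (f : L2 n) :
    mixedNorm I a b (fun s => U s f) ≤ C * ‖f‖ₑ := by
  obtain ⟨φ, hφ⟩ := exists_seq_schL2_tendsto f
  refine mixedNorm_le_of_tendsto_of_le (v := fun k s => U s (schL2 n (φ k)))
    (fun k => (hU.continuous _).aestronglyMeasurable)
    (ae_of_all _ fun t => ((U t).continuous.tendsto f).comp hφ) (fun k => h (φ k)) ?_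
  exact ENNReal.Tendsto.const_mul hφ.enorm (Or.inr hC)

theorem norm_defect_le (hU : IsometricGroup U) (M : ℝ≥0) (W : Space n → ℝ) {t : ℝ} (ht : 0 ≤ t)
    (f : L2 n) : ‖defect U M W t f‖ ≤ (2 + M * t) * ‖f‖ := by
  have h1 : ‖duhamel U (fun s => clipMul M W (freeGroup n s f)) t‖ ≤ M * ‖f‖ * |t - 0| := by
    refine intervalIntegral.norm_integral_le_of_norm_le_const fun s _ => ?_
    rw [hU.norm_map]
    refine (norm_clipMul_le _ _ _).trans_eq ?_
    rw [norm_freeGroup]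
  rw [sub_zero, abs_of_nonneg ht] at h1
  rw [defect_eq]
  refine (norm_sub_le _ _).trans ?_
  refine (add_le_add (norm_sub_le _ _) le_rfl).trans ?_
  rw [norm_freeGroup, hU.norm_map, norm_smul, Complex.norm_I, one_mul]
  linarith

theorem defect_sub (hU : IsometricGroup U) (M : ℝ≥0) (W : Space n → ℝ) {t : ℝ} (ht : 0 ≤ t)
    (f g : L2 n) : defect U M W t (f - g) = defect U M W t f - defect U M W t g := by
  simp only [defect_eq, map_sub]
  rw [duhamel_sub hU (integrableOn_clipMul_freeGroup M W f t)
    (integrableOn_clipMul_freeGroup M W g t) ⟨ht, le_rfl⟩, smul_sub]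
  abel

theorem continuous_defect (hU : IsometricGroup U) (M : ℝ≥0) (W : Space n → ℝ) {t : ℝ}
    (ht : 0 ≤ t) : Continuous (defect U M W t) := by
  refine (LipschitzWith.of_dist_le_mul (K := ⟨2 + M * t, by positivity⟩) fun f g => ?_).continuous
  rw [dist_eq_norm, dist_eq_norm, ← defect_sub hU M W ht]
  exact norm_defect_le hU M W ht _

theorem enorm_defect_le (hn : 3 ≤ n) (hW : MemLp W ((n : ℝ≥0∞) / 2) volume)
    (hH : IsSelfAdjointRealization W H) (hU : IsUnitaryGroup H U) {T : ℝ} (hT : 0 < T) {C : ℝ≥0}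
    (hS : StrichartzOn U T C) {M ε : ℝ≥0} (hε : tail M W ≤ ε)
    (hsmall : C * (M * ENNReal.ofReal T + ε) ≤ (2⁻¹ : ℝ≥0∞)) (K : ℝ≥0) (f : L2 n) {t : ℝ}
    (ht : t ∈ Icc 0 T) : ‖defect U K W t f‖ₑ ≤ C * (tail K W * (2 * C * ‖f‖ₑ)) := by
  obtain ⟨φ, hφ⟩ := exists_seq_schL2_tendsto f
  have h1 := (((continuous_defect hU.isometricGroup K W ht.1).tendsto f).comp hφ).enorm
  have hfin : tail K W ≠ ⊤ := ((tail_le K W).trans_lt hW.2).ne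
  have h2 : Tendsto (fun k => (C : ℝ≥0∞) * (tail K W * (2 * C * ‖schL2 n (φ k)‖ₑ))) atTop
      (𝓝 (C * (tail K W * (2 * C * ‖f‖ₑ)))) :=
    ENNReal.Tendsto.const_mul (ENNReal.Tendsto.const_mul (ENNReal.Tendsto.const_mul hφ.enorm
      (Or.inr (by finiteness))) (Or.inr hfin)) (Or.inr ENNReal.coe_ne_top)
  refine le_of_tendsto_of_tendsto' h1 h2 fun k => ?_
  refine (enorm_defect_schL2_le hn hW hH hU hT hS K (φ k) ht).trans ?_
  gcongr
  exact mixedNorm_freeGroup_schL2_le hn hW hH hU hT hS hε hsmall _ (admissible_two_sobExp hn)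

theorem integral_triangle_swap {E : Type*} [NormedAddCommGroup E] [NormedSpace ℝ E]
    {g : ℝ → ℝ → E} {t : ℝ} (ht : 0 ≤ t)
    (hg : Integrable (Function.uncurry g)
      ((volume.restrict (Ioc 0 t)).prod (volume.restrict (Ioc 0 t)))) :
    IntervalIntegrable (fun s => ∫ r in s..t, g s r) volume 0 t ∧
    ∫ s in (0 : ℝ)..t, ∫ r in s..t, g s r = ∫ r in (0 : ℝ)..t, ∫ s in (0 : ℝ)..r, g s r := by
  have hset : MeasurableSet {x : ℝ × ℝ | x.1 < x.2} := measurableSet_lt measurable_fst measurable_snd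
  have hi := hg.indicator hset
  have hsw := integral_integral_swap (f := fun s r => {x : ℝ × ℝ | x.1 < x.2}.indicator
    (Function.uncurry g) (s, r)) hi
  have e1 : ∀ s ∈ Ioc 0 t, ∫ r in Ioc 0 t, {x : ℝ × ℝ | x.1 < x.2}.indicator
      (Function.uncurry g) (s, r) = ∫ r in s..t, g s r := by
    intro s hs
    rw [intervalIntegral.integral_of_le hs.2,
      show (fun r => {x : ℝ × ℝ | x.1 < x.2}.indicator (Function.uncurry g) (s, r)) =
        (Ioi s).indicator (g s) from rfl, integral_indicator measurableSet_Ioi,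
      Measure.restrict_restrict measurableSet_Ioi]
    congr 2
    ext r
    simp only [mem_inter_iff, mem_Ioi, mem_Ioc]
    exact ⟨fun h => ⟨h.1, h.2.2⟩, fun h => ⟨h.1, hs.1.trans h.1, h.2⟩⟩
  have e2 : ∀ r ∈ Ioc 0 t, ∫ s in Ioc 0 t, {x : ℝ × ℝ | x.1 < x.2}.indicator
      (Function.uncurry g) (s, r) = ∫ s in (0 : ℝ)..r, g s r := by
    intro r hr
    rw [intervalIntegral.integral_of_le hr.1.le, integral_Ioc_eq_integral_Ioo (y := r),
      show (fun s => {x : ℝ × ℝ | x.1 < x.2}.indicator (Function.uncurry g) (s, r)) =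
        (Iio r).indicator (fun s => g s r) from rfl, integral_indicator measurableSet_Iio,
      Measure.restrict_restrict measurableSet_Iio]
    congr 2
    ext s
    simp only [mem_inter_iff, mem_Iio, mem_Ioc, mem_Ioo]
    exact ⟨fun h => ⟨h.2.1, h.1⟩, fun h => ⟨h.2, h.1, (h.2.le.trans hr.2)⟩⟩
  refine ⟨?_, ?_⟩
  · rw [intervalIntegrable_iff_integrableOn_Ioc_of_le ht]
    exact (integrableOn_congr_fun e1 measurableSet_Ioc).1 hi.integral_prod_left
  rw [intervalIntegral.integral_of_le ht, intervalIntegral.integral_of_le ht,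
    ← setIntegral_congr_fun measurableSet_Ioc e1, ← setIntegral_congr_fun measurableSet_Ioc e2]
  exact hsw

theorem duhamel_freeGroup_eq (hU : IsometricGroup U) (M : ℝ≥0) (W : Space n → ℝ) {F : ℝ → L2 n}
    {t : ℝ} (ht : 0 ≤ t) (hF : IntegrableOn F (Icc 0 t)) :
    duhamel (freeGroup n) F t = duhamel U F t +
      Complex.I • duhamel U (fun s => clipMul M W (duhamel (freeGroup n) F s)) t +
      ∫ s in (0 : ℝ)..t, defect U M W (t - s) (F s) := by
  have hE := isometricGroup_freeGroup n
  have hc : Continuous fun s : ℝ => t - s := continuous_const.sub continuous_id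
  have hFi : IntervalIntegrable F volume 0 t := intervalIntegrable_of_integrableOn hF ⟨ht, le_rfl⟩
  have hFI : Integrable F (volume.restrict (Ioc 0 t)) := hF.mono_set Ioc_subset_Icc_self
  set g : ℝ → ℝ → L2 n := fun s r => U (t - r) (clipMul M W (freeGroup n (r - s) (F s))) with hgdef
  have hg : Integrable (Function.uncurry g)
      ((volume.restrict (Ioc 0 t)).prod (volume.restrict (Ioc 0 t))) := by
    have h1 : Integrable (fun x : ℝ × ℝ => F x.1)
        ((volume.restrict (Ioc 0 t)).prod (volume.restrict (Ioc 0 t))) := hFI.comp_fst _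
    have h2 := hE.integrable_comp (g := fun x : ℝ × ℝ => x.2 - x.1)
      (continuous_snd.sub continuous_fst).aestronglyMeasurable h1
    exact hU.integrable_comp (g := fun x : ℝ × ℝ => t - x.2)
      (continuous_const.sub continuous_snd).aestronglyMeasurable
      ((clipMul M W).integrable_comp h2)
  have e1 : ∀ s, duhamel U (fun r => clipMul M W (freeGroup n r (F s))) (t - s) =
      ∫ r in s..t, g s r := by
    intro s
    have := intervalIntegral.integral_comp_sub_right (a := s) (b := t)
      (fun r => U (t - s - r) (clipMul M W (freeGroup n r (F s)))) s
    rw [sub_self] at this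
    rw [duhamel, ← this]
    refine intervalIntegral.integral_congr fun r _ => ?_
    simp only [hgdef, sub_sub_sub_cancel_right]
  have e2 : duhamel U (fun s => clipMul M W (duhamel (freeGroup n) F s)) t =
      ∫ r in (0 : ℝ)..t, ∫ s in (0 : ℝ)..r, g s r := by
    refine intervalIntegral.integral_congr fun r hr => ?_
    rw [uIcc_of_le ht] at hr
    have hi := hE.intervalIntegrable_comp (g := fun s => r - s)
      (continuous_const.sub continuous_id) (intervalIntegrable_of_integrableOn hF hr)
    simp only [hgdef, duhamel]
    rw [← ContinuousLinearMap.comp_apply, ← ContinuousLinearMap.intervalIntegral_comp_comm _ hi]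
    rfl
  obtain ⟨hgi, hswap⟩ := integral_triangle_swap ht hg
  have e3 : ∫ s in (0 : ℝ)..t, defect U M W (t - s) (F s) = duhamel (freeGroup n) F t -
      duhamel U F t - Complex.I • ∫ s in (0 : ℝ)..t, ∫ r in s..t, g s r := by
    have : (fun s => defect U M W (t - s) (F s)) = fun s => (freeGroup n (t - s) (F s) -
        U (t - s) (F s)) - Complex.I • ∫ r in s..t, g s r := by
      funext s
      rw [defect_eq, e1]
    rw [this, intervalIntegral.integral_sub, intervalIntegral.integral_sub,
      intervalIntegral.integral_smul]
    · rfl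
    · exact hE.intervalIntegrable_comp hc hFi
    · exact hU.intervalIntegrable_comp hc hFi
    · exact (hE.intervalIntegrable_comp hc hFi).sub (hU.intervalIntegrable_comp hc hFi)
    · exact hgi.smul Complex.I
  rw [e3, hswap, e2]
  abel

theorem tendsto_integral_defect (hn : 3 ≤ n) (hW : MemLp W ((n : ℝ≥0∞) / 2) volume)
    (hH : IsSelfAdjointRealization W H) (hU : IsUnitaryGroup H U) {T : ℝ} (hT : 0 < T) {C : ℝ≥0}
    (hS : StrichartzOn U T C) {M ε : ℝ≥0} (hε : tail M W ≤ ε)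
    (hsmall : C * (M * ENNReal.ofReal T + ε) ≤ (2⁻¹ : ℝ≥0∞)) {F : ℝ → L2 n}
    (hF : IntegrableOn F (Icc 0 T)) {t : ℝ} (ht : t ∈ Icc 0 T) :
    Tendsto (fun k : ℕ => ∫ s in (0 : ℝ)..t, defect U k W (t - s) (F s)) atTop (𝓝 0) := by
  rw [tendsto_zero_iff_enorm_tendsto_zero]
  have hFt : ∫⁻ s in Icc 0 T, ‖F s‖ₑ < ⊤ := hF.2
  have h0 : Tendsto (fun k : ℕ => C * (tail k W * (2 * C * ∫⁻ s in Icc 0 T, ‖F s‖ₑ))) atTop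
      (𝓝 0) := by
    have := ENNReal.Tendsto.const_mul (a := (C : ℝ≥0∞)) (ENNReal.Tendsto.mul_const
      (b := 2 * C * ∫⁻ s in Icc 0 T, ‖F s‖ₑ) (tendsto_tail hn hW) (Or.inr (by finiteness)))
      (Or.inr ENNReal.coe_ne_top)
    simpa using this
  refine tendsto_of_tendsto_of_tendsto_of_le_of_le tendsto_const_nhds h0 (fun _ => zero_le)
    fun k => ?_
  have hfin : tail k W ≠ ⊤ := ((tail_le k W).trans_lt hW.2).ne
  rw [intervalIntegral.integral_of_le ht.1]
  refine (enorm_integral_le_lintegral_enorm _).trans ?_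
  calc ∫⁻ s in Ioc 0 t, ‖defect U k W (t - s) (F s)‖ₑ
      ≤ ∫⁻ s in Ioc 0 t, C * (tail k W * (2 * C)) * ‖F s‖ₑ := by
        refine setLIntegral_mono' measurableSet_Ioc fun s hs => ?_
        refine (enorm_defect_le hn hW hH hU hT hS hε hsmall k (F s) (t := t - s)
          ⟨sub_nonneg.2 hs.2, by linarith [hs.1, ht.2]⟩).trans_eq (by ring)
    _ ≤ ∫⁻ s in Icc 0 T, C * (tail k W * (2 * C)) * ‖F s‖ₑ :=
        lintegral_mono_set fun s hs => ⟨hs.1.le, hs.2.trans ht.2⟩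
    _ = C * (tail k W * (2 * C)) * ∫⁻ s in Icc 0 T, ‖F s‖ₑ :=
        lintegral_const_mul' _ _ (by finiteness)
    _ = _ := by ring

theorem mixedNorm_duhamel_freeGroup_le_of_finite (hn : 3 ≤ n)
    (hW : MemLp W ((n : ℝ≥0∞) / 2) volume)
    (hH : IsSelfAdjointRealization W H) (hU : IsUnitaryGroup H U) {T : ℝ} (hT : 0 < T) {C : ℝ≥0}
    (hS : StrichartzOn U T C) {M ε : ℝ≥0} (hε : tail M W ≤ ε)
    (hsmall : C * (M * ENNReal.ofReal T + ε) ≤ (2⁻¹ : ℝ≥0∞)) {F : ℝ → L2 n}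
    (hF : IntegrableOn F (Icc 0 T))
    (hfin : mixedNorm (Icc 0 T) 2 (sobExp n) (fun t => duhamel (freeGroup n) F t) < ⊤)
    {a b p₁ q₁ : ℝ≥0∞} (hab : Admissible n a b) (hpq : Admissible n p₁ q₁) :
    mixedNorm (Icc 0 T) a b (fun t => duhamel (freeGroup n) F t) ≤
      2 * C * mixedNorm (Icc 0 T) p₁.conjExponent q₁.conjExponent (fun t => F t) := by
  have := mixedNorm_le_of_tendsto_duhamel_of_small hn hU.isometricGroup hS
    (continuousInLp_const hW (Icc 0 T)) (w := duhamel (freeGroup n) F)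
    ((isometricGroup_freeGroup n).continuousOn_duhamel hF) (u₀ := 0) (G := fun _ => F)
    (fun _ => hF) (fun _ a b hab => hS.inhomogeneous hab hpq hF) (c := Complex.I) (by simp) ?_ (ae_of_all _ fun _ => hε)
    hsmall hfin hab
  · simpa only [enorm_zero, zero_add] using this
  · intro t ht
    have h1 := (tendsto_const_nhds (x := duhamel (freeGroup n) F t)).sub
      (tendsto_integral_defect hn hW hH hU hT hS hε hsmall hF ht)
    rw [sub_zero] at h1
    refine h1.congr fun k => ?_
    rw [duhamel_freeGroup_eq hU.isometricGroup k W ht.1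
      (hF.mono_set (Icc_subset_Icc_right ht.2)), map_zero]
    abel

theorem convex_setOf_eLpNorm_le {q : ℝ≥0∞} (hq : 1 ≤ q) (K : ℝ≥0∞) :
    Convex ℝ {f : L2 n | eLpNorm f q volume ≤ K} := by
  intro f hf g hg a b ha hb hab
  have hs : ∀ (r : ℝ) (f : L2 n), 0 ≤ r → eLpNorm (⇑(r • f)) q volume =
      ENNReal.ofReal r * eLpNorm f q volume := fun r f hr => by
    rw [eLpNorm_congr_ae (Lp.coeFn_smul r f), eLpNorm_const_smul, Real.enorm_of_nonneg hr]
  refine (eLpNorm_coe_add_le _ _ hq).trans ?_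
  rw [hs a f ha, hs b g hb]
  calc _ ≤ ENNReal.ofReal a * K + ENNReal.ofReal b * K := by gcongr <;> assumption
    _ = K := by rw [← add_mul, ← ENNReal.ofReal_add ha hb, hab, ENNReal.ofReal_one, one_mul]

theorem eLpNorm_intervalIntegral_le {q : ℝ≥0∞} (hq : 1 ≤ q) {K : ℝ≥0∞} {f : ℝ → L2 n} {t : ℝ}
    (ht : 0 ≤ t) (hf : IntegrableOn f (Icc 0 t)) (h : ∀ s, eLpNorm (f s) q volume ≤ K) :
    eLpNorm (⇑(∫ s in (0 : ℝ)..t, f s)) q volume ≤ ENNReal.ofReal t * K := by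
  rcases ht.eq_or_lt with rfl | ht'
  · rw [intervalIntegral.integral_same, eLpNorm_congr_ae (Lp.coeFn_zero ..), eLpNorm_zero]
    exact zero_le
  have hm : (⨍ s in Icc 0 t, f s) ∈ {f : L2 n | eLpNorm f q volume ≤ K} :=
    (convex_setOf_eLpNorm_le hq K).set_average_mem
      ((lowerSemicontinuous_eLpNorm q).isClosed_preimage K)
      (by simp [ht']) measure_Icc_lt_top.ne (ae_of_all _ fun s => h s) hf
  have e : ∫ s in (0 : ℝ)..t, f s = t • ⨍ s in Icc 0 t, f s := by
    rw [setAverage_eq, intervalIntegral.integral_of_le ht, integral_Icc_eq_integral_Ioc]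
    simp only [Measure.real, Real.volume_Icc, sub_zero, ENNReal.toReal_ofReal ht]
    rw [smul_smul, mul_inv_cancel₀ ht'.ne', one_smul]
  rw [e, eLpNorm_congr_ae (Lp.coeFn_smul t _), eLpNorm_const_smul, Real.enorm_of_nonneg ht]
  gcongr
  exact hm

theorem exists_bounded_duhamel_approx (hn : 3 ≤ n) {F : ℝ → L2 n} {T : ℝ}
    (hF : IntegrableOn F (Icc 0 T)) {ε : ℝ≥0∞} (hε : ε ≠ 0) :
    ∃ G : ℝ → L2 n, ∫⁻ s in Icc 0 T, ‖F s - G s‖ₑ ≤ ε ∧ IntegrableOn G (Icc 0 T) ∧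
      ∃ K : ℝ≥0, ∀ t ∈ Icc 0 T, eLpNorm (duhamel (freeGroup n) G t) (sobExp n) volume ≤ K := by
  have hE := isometricGroup_freeGroup n
  have hq : 1 ≤ sobExp n := le_trans (by norm_num) (two_le_sobExp hn)
  suffices h : ∃ G : ℝ → L2 n, eLpNorm (F - G) 1 (volume.restrict (Icc 0 T)) ≤ ε ∧
      IntegrableOn G (Icc 0 T) ∧ ∃ K : ℝ≥0, ∀ t ∈ Icc 0 T,
        eLpNorm (duhamel (freeGroup n) G t) (sobExp n) volume ≤ K by
    obtain ⟨G, h1, h2⟩ := h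
    rw [eLpNorm_one_eq_lintegral_enorm] at h1
    exact ⟨G, h1, h2⟩
  refine MemLp.induction_dense (p := 1) ENNReal.one_ne_top
    (fun G : ℝ → L2 n => IntegrableOn G (Icc 0 T) ∧
      ∃ K : ℝ≥0, ∀ t ∈ Icc 0 T, eLpNorm (duhamel (freeGroup n) G t) (sobExp n) volume ≤ K)
    (μ := volume.restrict (Icc 0 T)) ?_ ?_ ?_ (memLp_one_iff_integrable.2 hF) hε
  · intro c A hA hAf δ hδ
    obtain ⟨φ, hφ⟩ := exists_seq_schL2_tendsto c
    have hl : Tendsto (fun k => ‖schL2 n (φ k) - c‖ₑ * (volume.restrict (Icc 0 T)) A) atTop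
        (𝓝 0) := by
      have := ENNReal.Tendsto.mul_const ((hφ.sub_const c).enorm) (Or.inr hAf.ne)
      simpa using this
    obtain ⟨k, hk⟩ := (hl.eventually_le_const (pos_iff_ne_zero.2 hδ)).exists
    have hi : IntegrableOn (A.indicator fun _ => schL2 n (φ k)) (Icc 0 T) :=
      (integrable_indicator_iff hA).2 (integrableOn_const hAf.ne)
    refine ⟨A.indicator fun _ => schL2 n (φ k), ?_, hi, ?_⟩
    · rw [← indicator_sub', eLpNorm_indicator_eq_eLpNorm_restrict hA, eLpNorm_one_eq_lintegral_enorm]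
      simpa using hk
    · obtain ⟨K, hK⟩ := exists_eLpNorm_freeGroup_schL2_le (φ k) (two_le_sobExp hn)
      refine ⟨(Real.toNNReal T) * K, fun t ht => ?_⟩
      have hit : IntegrableOn (fun s => freeGroup n (t - s) (A.indicator (fun _ => schL2 n (φ k)) s))
          (Icc 0 t) := hE.integrable_comp (continuous_const.sub continuous_id).aestronglyMeasurable
            (hi.mono_set (Icc_subset_Icc_right ht.2))
      refine (eLpNorm_intervalIntegral_le hq ht.1 hit (K := K) fun s => ?_).trans ?_
      · by_cases hs : s ∈ A
        · simpa only [indicator_of_mem hs] using hK (t - s)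
        · rw [indicator_of_notMem hs, map_zero, eLpNorm_congr_ae (Lp.coeFn_zero ..), eLpNorm_zero]
          exact zero_le
      · rw [ENNReal.coe_mul]
        gcongr
        exact ENNReal.ofReal_le_ofReal ht.2
  · rintro G G' ⟨hG, K, hK⟩ ⟨hG', K', hK'⟩
    refine ⟨hG.add hG', K + K', fun t ht => ?_⟩
    have e : duhamel (freeGroup n) (G + G') t = duhamel (freeGroup n) G t +
      duhamel (freeGroup n) G' t := duhamel_add hE hG hG' ht
    rw [e, ENNReal.coe_add]
    exact (eLpNorm_coe_add_le _ _ hq).trans (add_le_add (hK t ht) (hK' t ht))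
  · rintro G ⟨hG, -⟩
    exact hG.1

/-- Strichartz estimates for `e^{itH}` on a short interval imply those for `e^{itΔ}`. -/
theorem strichartzOn_freeGroup (hn : 3 ≤ n) (hW : MemLp W ((n : ℝ≥0∞) / 2) volume)
    (hH : IsSelfAdjointRealization W H) (hU : IsUnitaryGroup H U) {T : ℝ} (hT : 0 < T) {C : ℝ≥0}
    (hS : StrichartzOn U T C) {M ε : ℝ≥0} (hε : tail M W ≤ ε)
    (hsmall : C * (M * ENNReal.ofReal T + ε) ≤ (2⁻¹ : ℝ≥0∞)) :
    StrichartzOn (freeGroup n) T (2 * C) := by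
  have hE := isometricGroup_freeGroup n
  intro a b p₁ q₁ hab hpq f F hF
  have hfin : mixedNorm (Icc 0 T) 2 (sobExp n) (fun t => duhamel (freeGroup n) F t) < ⊤ := by
    have hex := fun k : ℕ => exists_bounded_duhamel_approx hn hF (ε := ((k : ℝ≥0∞) + 1)⁻¹)
      (by simp)
    choose G hG1 hG2 K hK using hex
    have hlim : ∀ t ∈ Icc 0 T, Tendsto (fun k => duhamel (freeGroup n) (G k) t) atTop
        (𝓝 (duhamel (freeGroup n) F t)) := by
      intro t ht
      rw [tendsto_iff_edist_tendsto_0]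
      have h0 : Tendsto (fun k : ℕ => ((k : ℝ≥0∞) + 1)⁻¹) atTop (𝓝 0) := by
        have := ENNReal.tendsto_inv_nat_nhds_zero.comp (tendsto_add_atTop_nat 1)
        simpa [Function.comp_def] using this
      refine tendsto_of_tendsto_of_tendsto_of_le_of_le tendsto_const_nhds h0 (fun _ => zero_le)
        fun k => ?_
      beta_reduce
      rw [edist_comm, edist_eq_enorm_sub, ← duhamel_sub hE hF (hG2 k) ht]
      refine (hE.norm_duhamel_le _ ht.1).trans (le_trans ?_ (hG1 k))
      exact lintegral_mono_set (Icc_subset_Icc_right ht.2)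
    refine (mixedNorm_le_of_tendsto (B := 2 * C * ((∫⁻ s in Icc 0 T, ‖F s‖ₑ) + 1))
      (v := fun k t => duhamel (freeGroup n) (G k) t)
      (fun k => (hE.continuousOn_duhamel (hG2 k)).aestronglyMeasurable measurableSet_Icc)
      ?_ ?_).trans_lt ?_
    · filter_upwards [ae_restrict_mem measurableSet_Icc] with t ht using hlim t ht
    · refine Frequently.of_forall fun k => ?_
      refine (mixedNorm_duhamel_freeGroup_le_of_finite hn hW hH hU hT hS hε hsmall (hG2 k)
        (mixedNorm_Icc_lt_top_of_le (hK k)) (admissible_two_sobExp hn)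
        (admissible_top_two n)).trans ?_
      rw [conjExponent_top, conjExponent_two, mixedNorm_one_two]
      gcongr
      calc ∫⁻ s in Icc 0 T, ‖G k s‖ₑ
          ≤ ∫⁻ s in Icc 0 T, (‖F s‖ₑ + ‖F s - G k s‖ₑ) := by
            refine lintegral_mono fun s => ?_
            calc ‖G k s‖ₑ = ‖F s - (F s - G k s)‖ₑ := by rw [sub_sub_cancel]
              _ ≤ _ := enorm_sub_le
        _ = (∫⁻ s in Icc 0 T, ‖F s‖ₑ) + ∫⁻ s in Icc 0 T, ‖F s - G k s‖ₑ :=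
            lintegral_add_left' hF.1.enorm _
        _ ≤ _ := by
            gcongr
            exact (hG1 k).trans (by simp)
    · have : ∫⁻ s in Icc 0 T, ‖F s‖ₑ < ⊤ := hF.2
      finiteness
  have h1 : mixedNorm (Icc 0 T) a b (fun t => freeGroup n t f) ≤ 2 * C * ‖f‖ₑ :=
    mixedNorm_group_le_of_schL2 hE (by finiteness)
      (fun φ => mixedNorm_freeGroup_schL2_le hn hW hH hU hT hS hε hsmall φ hab) f
  have h2 := mixedNorm_duhamel_freeGroup_le_of_finite hn hW hH hU hT hS hε hsmall hF hfin hab hpq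
  refine (mixedNorm_add_le hab.one_le_left hab.one_le_right
    (continuous_freeGroup_apply f).aestronglyMeasurable
    ((hE.continuousOn_duhamel hF).aestronglyMeasurable measurableSet_Icc)).trans (add_le_add h1 h2)

end Transfer

theorem exists_strichartzOn_freeGroup (hn : 3 ≤ n) {W : Space n → ℝ}
    (hW : MemLp W ((n : ℝ≥0∞) / 2) volume) (h : IsStrichartzType W) :
    ∃ T : ℝ, 0 < T ∧ ∃ C : ℝ≥0, StrichartzOn (freeGroup n) T C := by
  obtain ⟨H, U, hH, hU, hS⟩ := h
  obtain ⟨C, hC⟩ := hS 1 one_pos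
  have hS1 : StrichartzOn U 1 C := hC
  have hl : Tendsto (fun k : ℕ => (C : ℝ≥0∞) * tail k W) atTop (𝓝 0) := by
    simpa using ENNReal.Tendsto.const_mul (tendsto_tail hn hW) (Or.inr (ENNReal.coe_ne_top (r := C)))
  obtain ⟨k, hk⟩ := (hl.eventually_le_const (u := 4⁻¹) (by simp)).exists
  set T : ℝ := min 1 (4 * (C + 1) * (k + 1))⁻¹ with hT
  have hT0 : 0 < T := by positivity
  have hfin : tail k W ≠ ⊤ := ((tail_le k W).trans_lt hW.2).ne
  refine ⟨T, hT0, 2 * C, ?_⟩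
  push_cast
  refine strichartzOn_freeGroup hn hW hH hU hT0 (hS1.mono (min_le_left _ _)) (M := k)
    (ε := (tail k W).toNNReal) (ENNReal.coe_toNNReal hfin).ge ?_
  rw [ENNReal.coe_toNNReal hfin, mul_add]
  have h1 : (C : ℝ≥0∞) * (((k : ℝ≥0) : ℝ≥0∞) * ENNReal.ofReal T) ≤ 4⁻¹ := by
    have : (C : ℝ) * (k * T) ≤ 4⁻¹ := by
      have h3 : T ≤ (4 * ((C : ℝ) + 1) * (k + 1))⁻¹ := min_le_right _ _
      have hk0 : (0 : ℝ) ≤ k := Nat.cast_nonneg k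
      have hC0 : (0 : ℝ) ≤ C := C.2
      calc (C : ℝ) * (k * T) ≤ (C + 1) * ((k + 1) * (4 * ((C : ℝ) + 1) * (k + 1))⁻¹) := by
            gcongr <;> linarith
        _ = 4⁻¹ := by field_simp
    rw [← ENNReal.ofReal_coe_nnreal, ← ENNReal.ofReal_coe_nnreal, ← ENNReal.ofReal_mul (by simp),
      ← ENNReal.ofReal_mul (by simp)]
    refine (ENNReal.ofReal_le_ofReal (by simpa using this)).trans_eq ?_
    rw [ENNReal.ofReal_inv_of_pos (by norm_num)]
    norm_num
  refine (add_le_add h1 hk).trans_eq ?_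
  rw [← two_mul, show (4 : ℝ≥0∞) = 2 * 2 by norm_num, ENNReal.mul_inv (by simp) (by simp),
    ← mul_assoc, ENNReal.mul_inv_cancel (by simp) (by simp), one_mul]

/-! ### Dilations -/

theorem eLpNorm_comp_smul {c : ℝ} (hc : 0 < c) (f : Space n → ℂ) (q : ℝ≥0∞) :
    eLpNorm (fun x => f (c • x)) q volume =
      (ENNReal.ofReal c⁻¹) ^ (n * (1 / q).toReal) * eLpNorm f q volume := by
  have hme : MeasurableEmbedding fun x : Space n => c • x :=
    (Homeomorph.smulOfNeZero c hc.ne').measurableEmbedding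
  have h1 := hme.eLpNorm_map_measure (g := f) (p := q) (μ := volume)
  have h2 : (volume : Measure (Space n)).map (fun x => c • x) =
      (ENNReal.ofReal c⁻¹) ^ n • volume := by
    rw [Measure.map_addHaar_smul _ hc.ne', finrank_euclideanSpace_fin, abs_of_pos (by positivity),
      ← inv_pow, ENNReal.ofReal_pow (by positivity)]
  rw [h2, eLpNorm_smul_measure_of_ne_zero (by simp [hc])] at h1
  rw [show (fun x => f (c • x)) = f ∘ fun x => c • x from rfl, ← h1, smul_eq_mul,
    ENNReal.rpow_mul, ENNReal.rpow_natCast]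

theorem quasiMeasurePreserving_smul {c : ℝ} (hc : 0 < c) :
    Measure.QuasiMeasurePreserving (fun x : Space n => c • x) volume volume := by
  refine ⟨measurable_const_smul c, ?_⟩
  rw [Measure.map_addHaar_smul _ hc.ne']
  exact Measure.smul_absolutelyContinuous

theorem memLp_comp_smul {c : ℝ} (hc : 0 < c) (f : L2 n) :
    MemLp (fun x => f (c • x)) 2 (volume : Measure (Space n)) := by
  refine ⟨(Lp.aestronglyMeasurable f).comp_quasiMeasurePreserving (quasiMeasurePreserving_smul hc),
    ?_⟩
  rw [eLpNorm_comp_smul hc]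
  exact ENNReal.mul_lt_top (ENNReal.rpow_lt_top_of_nonneg (by positivity) ENNReal.ofReal_ne_top)
    (Lp.eLpNorm_lt_top f)

/-- The dilation `f ↦ f(c ·)` on `L²`. -/
def dilation {c : ℝ} (hc : 0 < c) : L2 n →L[ℂ] L2 n :=
  LinearMap.mkContinuous
    { toFun := fun f => (memLp_comp_smul hc f).toLp _
      map_add' := fun f g => by
        rw [← MemLp.toLp_add, MemLp.toLp_eq_toLp_iff]
        exact (quasiMeasurePreserving_smul hc).ae (Lp.coeFn_add f g)
      map_smul' := fun a f => by
        rw [RingHom.id_apply, ← MemLp.toLp_const_smul, MemLp.toLp_eq_toLp_iff]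
        exact (quasiMeasurePreserving_smul hc).ae (Lp.coeFn_smul a f) }
    ((ENNReal.ofReal c⁻¹) ^ (n * (1 / (2 : ℝ≥0∞)).toReal)).toReal fun f => by
      change ‖(memLp_comp_smul hc f).toLp _‖ ≤ _
      rw [Lp.norm_toLp, eLpNorm_comp_smul hc, ENNReal.toReal_mul, Lp.norm_def]

theorem coeFn_dilation {c : ℝ} (hc : 0 < c) (f : L2 n) :
    dilation hc f =ᵐ[volume] fun x => f (c • x) :=
  (memLp_comp_smul hc f).coeFn_toLp

theorem eLpNorm_dilation {c : ℝ} (hc : 0 < c) (f : L2 n) (q : ℝ≥0∞) :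
    eLpNorm (dilation hc f) q volume =
      (ENNReal.ofReal c⁻¹) ^ (n * (1 / q).toReal) * eLpNorm f q volume := by
  rw [eLpNorm_congr_ae (coeFn_dilation hc f), eLpNorm_comp_smul hc]

/-- The dilation `φ ↦ φ(c ·)` on Schwartz functions. -/
def dilationSchwartz {c : ℝ} (hc : 0 < c) : 𝓢(Space n, ℂ) →L[ℂ] 𝓢(Space n, ℂ) :=
  SchwartzMap.compCLMOfContinuousLinearEquiv ℂ
    (ContinuousLinearEquiv.smulLeft (R₁ := ℝ) (Units.mk0 c hc.ne'))

theorem dilationSchwartz_apply {c : ℝ} (hc : 0 < c) (φ : 𝓢(Space n, ℂ)) (x : Space n) :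
    dilationSchwartz hc φ x = φ (c • x) := rfl

theorem dilation_schL2 {c : ℝ} (hc : 0 < c) (φ : 𝓢(Space n, ℂ)) :
    dilation hc (schL2 n φ) = schL2 n (dilationSchwartz hc φ) := by
  apply Lp.ext
  refine (coeFn_dilation hc _).trans ?_
  filter_upwards [(quasiMeasurePreserving_smul hc).ae (coeFn_schL2 φ),
    coeFn_schL2 (dilationSchwartz hc φ)] with x h1 h2
  rw [h1, h2, dilationSchwartz_apply]

theorem fourier_dilationSchwartz {c : ℝ} (hc : 0 < c) (φ : 𝓢(Space n, ℂ)) (ξ : Space n) :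
    𝓕 (dilationSchwartz hc φ) ξ = ((c ^ n)⁻¹ : ℝ) • 𝓕 φ (c⁻¹ • ξ) := by
  rw [SchwartzMap.fourier_coe, SchwartzMap.fourier_coe, Real.fourier_eq, Real.fourier_eq]
  have := Measure.integral_comp_smul (volume : Measure (Space n))
    (fun y => Real.fourierChar (-inner ℝ y (c⁻¹ • ξ)) • φ y) c
  rw [finrank_euclideanSpace_fin, abs_of_pos (by positivity)] at this
  rw [← this]
  refine integral_congr_ae (ae_of_all _ fun x => ?_)
  simp only [dilationSchwartz_apply]
  rw [inner_smul_left, inner_smul_right, RCLike.conj_to_real, ← mul_assoc, mul_inv_cancel₀ hc.ne',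
    one_mul]

theorem freeSchwartz_dilationSchwartz {c : ℝ} (hc : 0 < c) (t : ℝ) (φ : 𝓢(Space n, ℂ)) :
    freeSchwartz n t (dilationSchwartz hc φ) = dilationSchwartz hc (freeSchwartz n (c ^ 2 * t) φ) := by
  apply (FourierTransform.fourierEquiv ℂ 𝓢(Space n, ℂ)).injective
  ext ξ
  change 𝓕 (freeSchwartz n t (dilationSchwartz hc φ)) ξ =
    𝓕 (dilationSchwartz hc (freeSchwartz n (c ^ 2 * t) φ)) ξ
  rw [fourier_freeSchwartz_apply, fourier_dilationSchwartz, fourier_dilationSchwartz,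
    fourier_freeSchwartz_apply]
  have : freeSymbolFun n (c ^ 2 * t) (c⁻¹ • ξ) = freeSymbolFun n t ξ := by
    rw [freeSymbolFun, freeSymbolFun, norm_smul, Real.norm_of_nonneg (by positivity)]
    congr 4
    field_simp
  rw [this]
  simp only [Complex.real_smul]
  ring

theorem freeGroup_dilation {c : ℝ} (hc : 0 < c) (t : ℝ) (f : L2 n) :
    freeGroup n t (dilation hc f) = dilation hc (freeGroup n (c ^ 2 * t) f) := by
  refine (denseRange_schL2 n).induction_on f (isClosed_eq (by fun_prop) (by fun_prop)) fun φ => ?_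
  rw [dilation_schL2, freeGroup_schL2, freeGroup_schL2, dilation_schL2,
    freeSchwartz_dilationSchwartz]

theorem eLpNorm_comp_mul_Icc {c : ℝ} (hc : 0 < c) (g : ℝ → ℝ≥0∞) (p : ℝ≥0∞) (T : ℝ) :
    eLpNorm (fun t => g (c * t)) p (volume.restrict (Icc 0 T)) =
      (ENNReal.ofReal c⁻¹) ^ (1 / p).toReal * eLpNorm g p (volume.restrict (Icc 0 (c * T))) := by
  have hme : MeasurableEmbedding fun x : ℝ => c * x :=
    (Homeomorph.mulLeft₀ c hc.ne').measurableEmbedding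
  have h1 := hme.eLpNorm_map_measure (g := g) (p := p) (μ := volume.restrict (Icc 0 T))
  have hpre : (fun x => c * x) ⁻¹' (Icc 0 (c * T)) = Icc 0 T := by
    ext x
    simp only [mem_preimage, mem_Icc, mul_nonneg_iff_of_pos_left hc, mul_le_mul_iff_right₀ hc]
  have h2 : (volume.restrict (Icc 0 T)).map (fun x => c * x) =
      (ENNReal.ofReal c⁻¹) • volume.restrict (Icc 0 (c * T)) := by
    rw [← hpre, ← hme.restrict_map, Real.map_volume_mul_left hc.ne', Measure.restrict_smul,
      abs_of_pos (by positivity)]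
  rw [h2, eLpNorm_smul_measure_of_ne_zero (by simp [hc])] at h1
  rw [show (fun t => g (c * t)) = g ∘ fun t => c * t from rfl, ← h1, smul_eq_mul]

theorem eLpNorm_const_mul {α : Type*} [MeasurableSpace α] {k : ℝ≥0∞} (hk0 : k ≠ 0) (hkt : k ≠ ⊤)
    (g : α → ℝ≥0∞) (p : ℝ≥0∞) (μ : Measure α) :
    eLpNorm (fun r => k * g r) p μ = k * eLpNorm g p μ := by
  have h : ∀ (k : ℝ≥0∞), k ≠ ⊤ → ∀ g : α → ℝ≥0∞,
      eLpNorm (fun r => k * g r) p μ ≤ k * eLpNorm g p μ := fun k hk g => by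
    lift k to ℝ≥0 using hk
    exact eLpNorm_le_nnreal_smul_eLpNorm_of_ae_le_mul' (ae_of_all _ fun x => le_rfl) p
  refine (h k hkt g).antisymm ?_
  have h2 := h k⁻¹ (ENNReal.inv_ne_top.2 hk0) fun r => k * g r
  simp only [← mul_assoc, ENNReal.inv_mul_cancel hk0 hkt, one_mul] at h2
  calc k * eLpNorm g p μ ≤ k * (k⁻¹ * eLpNorm (fun r => k * g r) p μ) := by gcongr
    _ = _ := by rw [← mul_assoc, ENNReal.mul_inv_cancel hk0 hkt, one_mul]

theorem mixedNorm_smul {c : ℂ} (hc : c ≠ 0) (I : Set ℝ) (p q : ℝ≥0∞) (u : ℝ → L2 n) :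
    mixedNorm I p q (fun t => ⇑(c • u t)) = ‖c‖ₑ * mixedNorm I p q (fun t => u t) := by
  rw [mixedNorm, mixedNorm, ← eLpNorm_const_mul (by simpa using hc) enorm_ne_top]
  simp only [eLpNorm_coe_smul]

theorem mixedNorm_dilation {c : ℝ} (hc : 0 < c) (p q : ℝ≥0∞) (T : ℝ) (u : ℝ → L2 n) :
    mixedNorm (Icc 0 T) p q (fun t => dilation hc (u (c ^ 2 * t))) =
      (ENNReal.ofReal c⁻¹) ^ (2 * (1 / p).toReal + n * (1 / q).toReal) *
        mixedNorm (Icc 0 (c ^ 2 * T)) p q (fun t => u t) := by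
  have hκ : ENNReal.ofReal c⁻¹ ≠ 0 := by simp [hc]
  have hs : (fun t => eLpNorm (dilation hc (u (c ^ 2 * t))) q volume) = fun t =>
      (fun r => (ENNReal.ofReal c⁻¹) ^ (n * (1 / q).toReal) * eLpNorm (u r) q volume) (c ^ 2 * t) := by
    funext t
    rw [eLpNorm_dilation]
  rw [mixedNorm, hs, eLpNorm_comp_mul_Icc (g := fun r => (ENNReal.ofReal c⁻¹) ^
    (n * (1 / q).toReal) * eLpNorm (u r) q volume) (by positivity), eLpNorm_const_mul
    (by simp [ENNReal.rpow_eq_zero_iff, hc]) (by finiteness), ← mul_assoc, ← mixedNorm]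
  congr 1
  rw [← inv_pow, ENNReal.ofReal_pow (by positivity), ← ENNReal.rpow_natCast, ← ENNReal.rpow_mul,
    ENNReal.rpow_add _ _ hκ ENNReal.ofReal_ne_top]
  norm_num

theorem Admissible.toReal_eq {p q : ℝ≥0∞} (h : Admissible n p q) :
    2 * (1 / p).toReal + n * (1 / q).toReal = n / 2 := by
  obtain ⟨hp, hq, h, -⟩ := h
  have hp0 : p ≠ 0 := (lt_of_lt_of_le (by norm_num) hp).ne'
  have hq0 : q ≠ 0 := (lt_of_lt_of_le (by norm_num) hq).ne'
  have := congrArg ENNReal.toReal h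
  rw [ENNReal.toReal_add (by simp [hp0]) (ENNReal.div_ne_top (by simp) (by simp [hq0])),
    ENNReal.toReal_inv, ENNReal.toReal_div, ENNReal.toReal_mul, ENNReal.toReal_div] at this
  simp only [ENNReal.toReal_natCast, ENNReal.toReal_ofNat] at this
  rw [one_div, one_div, ENNReal.toReal_inv, ENNReal.toReal_inv]
  rw [div_eq_mul_inv, mul_inv] at this
  linarith

theorem toReal_one_div_conjExponent {p : ℝ≥0∞} (hp : 2 ≤ p) :
    (1 / p.conjExponent).toReal = 1 - (1 / p).toReal := by
  have h := (holderConjugate_of_two_le hp).inv_add_inv_eq_one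
  have hp0 : p ≠ 0 := (lt_of_lt_of_le (by norm_num) hp).ne'
  have := congrArg ENNReal.toReal h
  rw [ENNReal.toReal_add (by simp [hp0]) (by simp [conjExponent_ne_zero]), ENNReal.toReal_one] at this
  rw [one_div, one_div]
  linarith

theorem integrableOn_comp_mul {c : ℝ} (hc : 0 < c) {F : ℝ → L2 n} {T : ℝ}
    (hF : IntegrableOn F (Icc 0 (c * T))) : IntegrableOn (fun t => F (c * t)) (Icc 0 T) := by
  rcases lt_or_ge T 0 with h | h
  · rw [Icc_eq_empty h.not_ge]
    exact integrableOn_empty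
  rw [← intervalIntegrable_iff_integrableOn_Icc_of_le h]
  rw [← intervalIntegrable_iff_integrableOn_Icc_of_le (by positivity)] at hF
  have := hF.comp_mul_left (c := c)
  rwa [zero_div, mul_div_cancel_left₀ _ hc.ne'] at this

theorem StrichartzOn.dilate {T : ℝ} {C : ℝ≥0∞} (h : StrichartzOn (freeGroup n) T C) {c : ℝ}
    (hc : 0 < c) : StrichartzOn (freeGroup n) (c ^ 2 * T) C := by
  intro a b p₁ q₁ hab hpq f F hF
  have hc2 : 0 < c ^ 2 := by positivity
  set κ := ENNReal.ofReal c⁻¹ with hκ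
  have hκ0 : κ ≠ 0 := by simp [hκ, hc]
  have hκt : κ ≠ ⊤ := ENNReal.ofReal_ne_top
  set G : ℝ → L2 n := fun s => dilation hc ((c ^ 2 : ℂ) • F (c ^ 2 * s)) with hG
  have hGi : IntegrableOn G (Icc 0 T) :=
    (dilation hc).integrable_comp ((integrableOn_comp_mul hc2 hF).smul (c ^ 2 : ℂ))
  have key := h a b p₁ q₁ hab hpq (dilation hc f) G hGi
  have e1 : mixedNorm (Icc 0 T) a b (fun t => ⇑(freeGroup n t (dilation hc f) +
      duhamel (freeGroup n) G t)) = mixedNorm (Icc 0 T) a b (fun t => dilation hc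
        ((fun τ => freeGroup n τ f + duhamel (freeGroup n) F τ) (c ^ 2 * t))) := by
    refine mixedNorm_congr_ae ?_
    filter_upwards [ae_restrict_mem measurableSet_Icc] with t ht
    have hD : duhamel (freeGroup n) G t = dilation hc (duhamel (freeGroup n) F (c ^ 2 * t)) := by
      have hct : c ^ 2 * t ∈ Icc 0 (c ^ 2 * T) :=
        ⟨mul_nonneg hc2.le ht.1, mul_le_mul_of_nonneg_left ht.2 hc2.le⟩
      rw [duhamel, duhamel, ← (dilation hc).intervalIntegral_comp_comm
        ((isometricGroup_freeGroup n).intervalIntegrable_comp (g := fun s => c ^ 2 * t - s)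
          (continuous_const.sub continuous_id) (intervalIntegrable_of_integrableOn hF hct))]
      have h1 := intervalIntegral.smul_integral_comp_mul_left (a := 0) (b := t)
        (fun x => dilation hc (freeGroup n (c ^ 2 * t - x) (F x))) (c ^ 2)
      rw [mul_zero] at h1
      rw [← h1, ← intervalIntegral.integral_smul]
      refine intervalIntegral.integral_congr fun s _ => ?_
      simp only [hG]
      rw [freeGroup_dilation, map_smul, map_smul, mul_sub]
      norm_cast
    rw [hD, freeGroup_dilation, map_add]
  have e2 : mixedNorm (Icc 0 T) p₁.conjExponent q₁.conjExponent (fun t => G t) =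
      κ ^ (n / 2 : ℝ) *
        mixedNorm (Icc 0 (c ^ 2 * T)) p₁.conjExponent q₁.conjExponent (fun t => F t) := by
    rw [hG, mixedNorm_dilation hc _ _ _ (fun r => (c ^ 2 : ℂ) • F r),
      mixedNorm_smul (by simp [hc.ne']), ← mul_assoc, toReal_one_div_conjExponent hpq.1,
      toReal_one_div_conjExponent hpq.2.1]
    congr 1
    have h1 : 2 * (1 - (1 / p₁).toReal) + n * (1 - (1 / q₁).toReal) = n / 2 + 2 := by
      have := hpq.toReal_eq
      linarith
    have h2 : ‖(c ^ 2 : ℂ)‖ₑ = (κ ^ (2 : ℝ))⁻¹ := by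
      rw [hκ, ← ENNReal.inv_rpow, ENNReal.ofReal_inv_of_pos hc, inv_inv, ← ofReal_norm, norm_pow,
        Complex.norm_real, Real.norm_of_nonneg hc.le, ENNReal.ofReal_pow hc.le]
      norm_num
    rw [h1, h2, ENNReal.rpow_add _ _ hκ0 hκt, mul_assoc, ENNReal.mul_inv_cancel
      (by simp [hκ0]) (by finiteness), mul_one]
  have e3 : ‖dilation hc f‖ₑ = κ ^ (n / 2 : ℝ) * ‖f‖ₑ := by
    rw [← eLpNorm_L2_two, eLpNorm_dilation, eLpNorm_L2_two]
    congr 2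
    norm_num
    ring
  rw [e1, mixedNorm_dilation hc a b T (fun τ => freeGroup n τ f + duhamel (freeGroup n) F τ),
    hab.toReal_eq, e2, e3, mul_left_comm C, mul_left_comm C,
    ← mul_add] at key
  exact (ENNReal.mul_le_mul_iff_right (ENNReal.rpow_pos (pos_iff_ne_zero.2 hκ0) hκt).ne'
    (by finiteness)).1 key

theorem StrichartzOn.of_pos {T : ℝ} (hT : 0 < T) {C : ℝ≥0∞} (h : StrichartzOn (freeGroup n) T C)
    (T' : ℝ) : StrichartzOn (freeGroup n) T' C := by
  rcases lt_or_ge 0 T' with h' | h'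
  · have := h.dilate (c := √(T' / T)) (by positivity)
    rwa [Real.sq_sqrt (by positivity), div_mul_cancel₀ _ hT.ne'] at this
  · exact h.mono (h'.trans hT.le)

/-! ### The free Strichartz constant -/

theorem mixedNorm_comp_add (a b : ℝ) (p q : ℝ≥0∞) (u : ℝ → Space n → ℂ) :
    mixedNorm (Icc 0 (b - a)) p q (fun t => u (t + a)) = mixedNorm (Icc a b) p q u := by
  have hme : MeasurableEmbedding fun x : ℝ => x + a := (Homeomorph.addRight a).measurableEmbedding
  have hpre : (fun x => x + a) ⁻¹' (Icc a b) = Icc 0 (b - a) := by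
    ext x
    simp only [mem_preimage, mem_Icc, le_add_iff_nonneg_left, le_sub_iff_add_le]
  have h2 : (volume.restrict (Icc 0 (b - a))).map (fun x => x + a) = volume.restrict (Icc a b) := by
    rw [← hpre, ← hme.restrict_map, map_add_right_eq_self]
  rw [mixedNorm, mixedNorm, ← h2, hme.eLpNorm_map_measure]
  rfl

theorem mixedNorm_univ_le {p q : ℝ≥0∞} {u : ℝ → L2 n} {B : ℝ≥0∞}
    (hu : AEStronglyMeasurable u volume)
    (h : ∀ N : ℝ, 0 < N → mixedNorm (Icc (-N) N) p q (fun t => u t) ≤ B) :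
    mixedNorm univ p q (fun t => u t) ≤ B := by
  have : eLpNorm (fun t => eLpNorm (u t) q volume) p volume ≤
      liminf (fun k : ℕ => eLpNorm ((Icc (-(k + 1 : ℝ)) (k + 1 : ℝ)).indicator
        (fun t => eLpNorm (u t) q volume)) p volume) atTop := by
    refine eLpNorm_le_of_le_liminf
      (fun k => (aemeasurable_eLpNorm hu q).indicator measurableSet_Icc) (ae_of_all _ fun t => ?_)
    refine le_of_eq (Tendsto.liminf_eq ?_).symm
    refine tendsto_const_nhds.congr' ?_
    obtain ⟨k, hk⟩ := exists_nat_ge |t|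
    filter_upwards [eventually_ge_atTop k] with j hj
    have : (k : ℝ) ≤ j := by exact_mod_cast hj
    have := abs_le.1 hk
    rw [indicator_of_mem]
    exact ⟨by linarith, by linarith⟩
  rw [mixedNorm, Measure.restrict_univ]
  refine this.trans (liminf_le_of_frequently_le' (Frequently.of_forall fun k => ?_))
  rw [eLpNorm_indicator_eq_eLpNorm_restrict measurableSet_Icc]
  exact h _ (by positivity)

theorem mixedNorm_freeGroup_univ_le {C : ℝ≥0∞} (h : ∀ T, StrichartzOn (freeGroup n) T C)
    {a b : ℝ≥0∞} (hab : Admissible n a b) (f : L2 n) :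
    mixedNorm univ a b (fun t => freeGroup n t f) ≤ C * ‖f‖ₑ := by
  refine mixedNorm_univ_le (continuous_freeGroup_apply f).aestronglyMeasurable fun N _ => ?_
  rw [← mixedNorm_comp_add]
  simp only [freeGroup_add]
  refine ((h _).homogeneous hab _).trans_eq ?_
  rw [← ofReal_norm, norm_freeGroup, ofReal_norm]

theorem duhamel_freeGroup_shift {F : ℝ → L2 n} (hF : Integrable F) (N t : ℝ) :
    duhamel (freeGroup n) F (t + -N) = duhamel (freeGroup n) (fun s => F (s + -N)) t -
      freeGroup n t (freeGroup n (-N) (duhamel (freeGroup n) (fun s => F (s + -N)) N)) := by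
  have hE := isometricGroup_freeGroup n
  have hi : ∀ r, Integrable fun s => freeGroup n (r - s) (F s) := fun r =>
    hE.integrable_comp (g := fun s => r - s)
      (continuous_const.sub continuous_id).aestronglyMeasurable hF
  have h1 : ∀ r, duhamel (freeGroup n) (fun s => F (s + -N)) r =
      ∫ s in (-N)..(r + -N), freeGroup n (r + -N - s) (F s) := by
    intro r
    have := intervalIntegral.integral_comp_add_right (a := 0) (b := r)
      (fun s => freeGroup n (r + -N - s) (F s)) (-N)
    rw [zero_add] at this
    rw [← this]
    refine intervalIntegral.integral_congr fun s _ => ?_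
    simp only [add_sub_add_right_eq_sub]
  rw [h1, h1, ← freeGroup_add, add_neg_cancel,
    ← (freeGroup n (t + -N)).intervalIntegral_comp_comm (hi _).intervalIntegrable]
  have e : ∀ s, freeGroup n (t + -N) (freeGroup n (0 - s) (F s)) =
      freeGroup n (t + -N - s) (F s) := fun s => by
    rw [← freeGroup_add]
    congr 2
    ring
  simp only [e]
  rw [eq_sub_iff_add_eq, add_comm]
  exact intervalIntegral.integral_add_adjacent_intervals (hi _).intervalIntegrable
    (hi _).intervalIntegrable

theorem continuous_duhamel_freeGroup {F : ℝ → L2 n} (hF : Integrable F) :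
    Continuous (duhamel (freeGroup n) F) := by
  have hE := isometricGroup_freeGroup n
  have hi : Integrable fun s => freeGroup n (-s) (F s) :=
    hE.integrable_comp continuous_neg.aestronglyMeasurable hF
  have h1 : Continuous fun t => freeGroup n t (∫ s in (0 : ℝ)..t, freeGroup n (-s) (F s)) :=
    hE.continuous_comp continuous_id
      (intervalIntegral.continuous_primitive (fun _ _ => hi.intervalIntegrable) 0)
  exact h1.congr fun t => (hE.duhamel_eq hF.intervalIntegrable).symm

theorem mixedNorm_duhamel_freeGroup_univ_le {C : ℝ≥0∞} (h : ∀ T, StrichartzOn (freeGroup n) T C)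
    {a b p₁ q₁ : ℝ≥0∞} (hab : Admissible n a b) (hpq : Admissible n p₁ q₁) {F : ℝ → L2 n}
    (hF : Integrable F) :
    mixedNorm univ a b (fun t => duhamel (freeGroup n) F t) ≤
      (C + C * C) * mixedNorm univ p₁.conjExponent q₁.conjExponent (fun t => F t) := by
  have hE := isometricGroup_freeGroup n
  refine mixedNorm_univ_le (continuous_duhamel_freeGroup hF).aestronglyMeasurable fun N hN => ?_
  rw [← mixedNorm_comp_add]
  simp only [duhamel_freeGroup_shift hF N, sub_eq_add_neg]
  set G : ℝ → L2 n := fun s => F (s + -N)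
  have hG : Integrable G := hF.comp_add_right _
  have hB : mixedNorm (Icc 0 (N - -N)) p₁.conjExponent q₁.conjExponent (fun t => G t) ≤
      mixedNorm univ p₁.conjExponent q₁.conjExponent (fun t => F t) := by
    rw [mixedNorm_comp_add (-N) N _ _ (fun t => F t)]
    exact mixedNorm_mono_set (subset_univ _) _ _ _
  set B := mixedNorm univ p₁.conjExponent q₁.conjExponent (fun t => F t)
  rw [sub_neg_eq_add] at hB
  set g := freeGroup n (-N) (duhamel (freeGroup n) G N)
  have hg : ‖g‖ₑ ≤ C * B := by
    rw [← ofReal_norm, norm_freeGroup, ofReal_norm]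
    refine (enorm_le_mixedNorm_top (a := 0) (b := N + N) (by linarith)
      (continuous_duhamel_freeGroup hG).continuousOn ⟨hN.le, by linarith⟩).trans ?_
    refine ((h _).inhomogeneous (admissible_top_two n) hpq hG.integrableOn).trans ?_
    gcongr
  refine (mixedNorm_add_le hab.one_le_left hab.one_le_right
    (continuous_duhamel_freeGroup hG).aestronglyMeasurable
    (continuous_freeGroup_apply g).neg.aestronglyMeasurable).trans ?_
  rw [add_mul]
  refine add_le_add ?_ ?_
  · refine ((h _).inhomogeneous hab hpq hG.integrableOn).trans ?_
    gcongr
    simpa using hB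
  · simp only [Pi.neg_apply]
    rw [mixedNorm_neg, mul_assoc]
    refine ((h _).homogeneous hab g).trans ?_
    gcongr

theorem isFreeStrichartzConstant_of_strichartzOn {C : ℝ≥0∞}
    (h : ∀ T, StrichartzOn (freeGroup n) T C) : IsFreeStrichartzConstant n (C + C * C) := by
  intro I hI p q hpq
  refine ⟨fun f => ?_, fun p₁ q₁ hpq₁ F hF hFI => ?_⟩
  · refine (mixedNorm_mono_set (subset_univ _) _ _ _).trans
      ((mixedNorm_freeGroup_univ_le h hpq f).trans ?_)
    gcongr
    exact le_self_add
  · refine (mixedNorm_mono_set (subset_univ _) _ _ _).trans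
      ((mixedNorm_duhamel_freeGroup_univ_le h hpq hpq₁ hF).trans_eq ?_)
    have hind : I.indicator F = F := indicator_eq_self.2 fun t ht => by
      by_contra h
      exact ht (hFI t h)
    conv_lhs => rw [← hind]
    rw [mixedNorm_indicator _ hI.measurableSet, inter_univ]

theorem one_le_of_isFreeStrichartzConstant {C : ℝ≥0∞} (h : IsFreeStrichartzConstant n C) :
    1 ≤ C := by
  obtain ⟨f, hf⟩ : ∃ f : L2 n, f ≠ 0 := by
    refine ⟨indicatorConstLp 2 (measurableSet_ball (x := 0) (ε := 1)) measure_ball_lt_top.ne 1, ?_⟩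
    rw [← norm_ne_zero_iff, norm_indicatorConstLp (by norm_num) (by norm_num), norm_one, one_mul]
    refine (Real.rpow_pos_of_pos ?_ _).ne'
    exact ENNReal.toReal_pos (Metric.measure_ball_pos _ _ one_pos).ne' measure_ball_lt_top.ne
  have h1 := (h (Icc 0 1) ordConnected_Icc ⊤ 2 (admissible_top_two n)).1 f
  have h2 := enorm_le_mixedNorm_top (a := 0) (b := 1) zero_lt_one
    (continuous_freeGroup_apply f).continuousOn (left_mem_Icc.2 zero_le_one)
  rw [freeGroup_zero] at h2
  have h3 : 1 * ‖f‖ₑ ≤ C * ‖f‖ₑ := by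
    rw [one_mul]
    exact h2.trans h1
  exact (ENNReal.mul_le_mul_iff_left (by simpa using hf) enorm_ne_top).1 h3

theorem one_le_freeStrichartzConstant (n : ℕ) : 1 ≤ freeStrichartzConstant n :=
  le_sInf fun _ hC => one_le_of_isFreeStrichartzConstant hC

theorem le_sInf_mul {S : Set ℝ≥0∞} (hS : S.Nonempty) (h1 : 1 ≤ sInf S) {X Y : ℝ≥0∞}
    (h : ∀ C ∈ S, X ≤ C * Y) : X ≤ sInf S * Y := by
  rcases eq_or_ne Y 0 with rfl | hY0
  · obtain ⟨C, hC⟩ := hS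
    simpa using h C hC
  rcases eq_or_ne Y ⊤ with rfl | hYt
  · rw [ENNReal.mul_top (lt_of_lt_of_le one_pos h1).ne']
    exact le_top
  rw [← ENNReal.div_le_iff hY0 hYt]
  exact le_sInf fun C hC => (ENNReal.div_le_iff hY0 hYt).2 (h C hC)

theorem isFreeStrichartzConstant_freeStrichartzConstant {C : ℝ≥0∞}
    (h : IsFreeStrichartzConstant n C) :
    IsFreeStrichartzConstant n (freeStrichartzConstant n) := by
  have hne : {C | IsFreeStrichartzConstant n C}.Nonempty := ⟨C, h⟩
  have h1 := one_le_freeStrichartzConstant n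
  intro I hI p q hpq
  refine ⟨fun f => le_sInf_mul hne h1 fun C hC => (hC I hI p q hpq).1 f,
    fun p₁ q₁ hpq₁ F hF hFI => le_sInf_mul hne h1 fun C hC =>
      (hC I hI p q hpq).2 p₁ q₁ hpq₁ F hF hFI⟩

/-- An `L^{n/2}` potential of Strichartz type forces the free Strichartz constant to be finite. -/
theorem freeStrichartzConstant_spec (hn : 3 ≤ n) {W : Space n → ℝ}
    (hW : MemLp W ((n : ℝ≥0∞) / 2) volume) (h : IsStrichartzType W) :
    IsFreeStrichartzConstant n (freeStrichartzConstant n) ∧ freeStrichartzConstant n ≠ ⊤ := by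
  obtain ⟨T, hT, C, hC⟩ := exists_strichartzOn_freeGroup hn hW h
  have := isFreeStrichartzConstant_of_strichartzOn (hC.of_pos hT)
  refine ⟨isFreeStrichartzConstant_freeStrichartzConstant this,
    ((sInf_le this).trans_lt ?_).ne⟩
  finiteness

theorem IsFreeStrichartzConstant.strichartzOn {C : ℝ≥0∞} (h : IsFreeStrichartzConstant n C)
    (T : ℝ) : StrichartzOn (freeGroup n) T C := by
  intro a b p₁ q₁ hab hpq f F hF
  have hE := isometricGroup_freeGroup n
  have hI := h (Icc 0 T) ordConnected_Icc a b hab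
  have hGi : Integrable ((Icc 0 T).indicator F) := hF.integrable_indicator measurableSet_Icc
  have h2 := hI.2 p₁ q₁ hpq ((Icc 0 T).indicator F) hGi fun t ht => indicator_of_notMem ht _
  rw [mixedNorm_indicator _ measurableSet_Icc, inter_self] at h2
  refine (mixedNorm_add_le hab.one_le_left hab.one_le_right
    (continuous_freeGroup_apply f).aestronglyMeasurable
    ((hE.continuousOn_duhamel hF).aestronglyMeasurable measurableSet_Icc)).trans
    (add_le_add (hI.1 f) (le_trans (le_of_eq ?_) h2))
  refine mixedNorm_congr_ae ?_
  filter_upwards [ae_restrict_mem measurableSet_Icc] with t ht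
  have : duhamel (freeGroup n) F t = duhamel (freeGroup n) ((Icc 0 T).indicator F) t := by
    refine duhamel_congr _ ht.1 ?_
    filter_upwards [ae_restrict_mem measurableSet_Icc] with s hs
    rw [indicator_of_mem (Icc_subset_Icc_right ht.2 hs)]
  rw [this]
  rfl

/-! ### Truncation of sources -/

theorem measurable_of_measurable_edist {α E : Type*} [MeasurableSpace α] [PseudoEMetricSpace E]
    [SecondCountableTopology E] [MeasurableSpace E] [BorelSpace E] {f : α → E}
    (h : ∀ c, Measurable fun a => edist (f a) c) : Measurable f := by
  refine measurable_of_isClosed' fun S hS hne _ => ?_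
  have : Nonempty S := hne.to_subtype
  set d : ℕ → E := fun i => (TopologicalSpace.denseSeq S i : E)
  have hd : S = closure (range d) := by
    apply Subset.antisymm
    · intro x hx
      have := TopologicalSpace.denseRange_denseSeq S ⟨x, hx⟩
      have h2 := image_closure_subset_closure_image continuous_subtype_val (mem_image_of_mem _ this)
      rwa [← range_comp] at h2
    · exact closure_minimal (range_subset_iff.2 fun i => (TopologicalSpace.denseSeq S i).2) hS
  have e : f ⁻¹' S = {a | ⨅ i, edist (f a) (d i) = 0} := by
    ext a
    rw [mem_preimage, mem_ofPred_eq, hd, Metric.mem_closure_iff_infEDist_zero, Metric.infEDist,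
      iInf_range]
  rw [e]
  exact (Measurable.iInf fun i => h (d i)) (measurableSet_singleton 0)

theorem measurable_eLpNorm_section {f : ℝ × Space n → ℂ} (hf : Measurable f) {q : ℝ≥0∞}
    (hq0 : q ≠ 0) (hqt : q ≠ ⊤) : Measurable fun t => eLpNorm (fun x => f (t, x)) q volume := by
  simp only [eLpNorm_eq_lintegral_rpow_enorm_toReal hq0 hqt]
  exact (Measurable.lintegral_prod_right' (hf.enorm.pow_const _)).pow_const _

/-- `f` cut off where `|x| > k` or `|f| > k`. -/
def cutoff (k : ℕ) (x : Space n) (z : ℂ) : ℂ := if ‖x‖ ≤ k ∧ ‖z‖ ≤ k then z else 0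

theorem measurable_cutoff (k : ℕ) : Measurable fun y : Space n × ℂ => cutoff k y.1 y.2 := by
  refine Measurable.ite ?_ measurable_snd measurable_const
  exact (measurableSet_le measurable_fst.norm measurable_const).inter
    (measurableSet_le measurable_snd.norm measurable_const)

theorem cutoff_eq_or (k : ℕ) (x : Space n) (z : ℂ) : cutoff k x z = z ∨ cutoff k x z = 0 := by
  unfold cutoff
  split_ifs <;> simp

theorem norm_cutoff_le (k : ℕ) (x : Space n) (z : ℂ) : ‖cutoff k x z‖ ≤ ‖z‖ := by
  rcases cutoff_eq_or k x z with h | h <;> simp [h]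

theorem norm_sub_cutoff_le (k : ℕ) (x : Space n) (z : ℂ) : ‖z - cutoff k x z‖ ≤ ‖z‖ := by
  rcases cutoff_eq_or k x z with h | h <;> simp [h]

theorem norm_cutoff_sub_cutoff_le {k m : ℕ} (h : k ≤ m) (x : Space n) (z : ℂ) :
    ‖cutoff k x z - cutoff m x z‖ ≤ ‖z - cutoff k x z‖ := by
  have hkm : (k : ℝ) ≤ m := by exact_mod_cast h
  unfold cutoff
  split_ifs with h1 h2 h2
  · simp
  · exact absurd ⟨h1.1.trans hkm, h1.2.trans hkm⟩ h2
  · simp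
  · simp

theorem norm_cutoff_le_indicator (k : ℕ) (x : Space n) (z : ℂ) :
    ‖cutoff k x z‖ ≤ ‖(Metric.closedBall (0 : Space n) k).indicator (fun _ => (k : ℂ)) x‖ := by
  unfold cutoff
  split_ifs with h
  · rw [indicator_of_mem (by simpa using h.1)]
    simpa using h.2
  · simp

theorem tendsto_cutoff (x : Space n) (z : ℂ) :
    Tendsto (fun k => cutoff k x z) atTop (𝓝 z) := by
  refine tendsto_const_nhds.congr' ?_
  filter_upwards [eventually_ge_atTop ⌈max ‖x‖ ‖z‖⌉₊] with k hk
  have : max ‖x‖ ‖z‖ ≤ k := (Nat.le_ceil _).trans (by exact_mod_cast hk)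
  rw [cutoff, if_pos ⟨(le_max_left _ _).trans this, (le_max_right _ _).trans this⟩]

/-- Bounded, compactly supported functions `G k` that approximate the source `F`, whose values are
in `L^q`. -/
structure SourceApprox (I : Set ℝ) (q : ℝ≥0∞) (F : ℝ → Space n → ℂ) (G : ℕ → ℝ → L2 n) : Prop where
  aestronglyMeasurable : ∀ k, AEStronglyMeasurable (G k) (volume.restrict I)
  bounded : ∀ k, ∃ K : ℝ, ∀ t, ‖G k t‖ ≤ K
  aemeasurable : AEMeasurable (fun t => eLpNorm (F t) q volume) (volume.restrict I)
  aemeasurable_sub : ∀ k, AEMeasurable (fun t => eLpNorm (fun x => F t x - G k t x) q volume)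
    (volume.restrict I)
  memLp : ∀ᵐ t ∂volume.restrict I, MemLp (F t) q volume
  le : ∀ᵐ t ∂volume.restrict I, ∀ k, eLpNorm (G k t) q volume ≤ eLpNorm (F t) q volume
  sub_le : ∀ᵐ t ∂volume.restrict I, ∀ k,
    eLpNorm (fun x => F t x - G k t x) q volume ≤ eLpNorm (F t) q volume
  sub_le_sub : ∀ᵐ t ∂volume.restrict I, ∀ k m, k ≤ m →
    eLpNorm (⇑(G k t - G m t)) q volume ≤ eLpNorm (fun x => F t x - G k t x) q volume
  tendsto : ∀ᵐ t ∂volume.restrict I,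
    Tendsto (fun k => eLpNorm (fun x => F t x - G k t x) q volume) atTop (𝓝 0)

theorem memLp_cutoff {f : ℝ × Space n → ℂ} (hf : Measurable f) (k : ℕ) (t : ℝ) :
    MemLp (fun x => cutoff k x (f (t, x))) 2 (volume : Measure (Space n)) := by
  refine (memLp_indicator_const 2 (measurableSet_closedBall (x := (0 : Space n)) (ε := k)) (k : ℂ)
    (Or.inr measure_closedBall_lt_top.ne)).mono ?_
    (ae_of_all _ fun x => norm_cutoff_le_indicator k x _)
  exact ((measurable_cutoff k).comp (measurable_id.prodMk
    (hf.comp measurable_prodMk_left))).aestronglyMeasurable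

/-- The section of `f` at time `t`, cut off as in `cutoff`, as an element of `L²`. -/
def cutoffL2 {f : ℝ × Space n → ℂ} (hf : Measurable f) (k : ℕ) (t : ℝ) : L2 n :=
  (memLp_cutoff hf k t).toLp _

theorem coeFn_cutoffL2 {f : ℝ × Space n → ℂ} (hf : Measurable f) (k : ℕ) (t : ℝ) :
    cutoffL2 hf k t =ᵐ[volume] fun x => cutoff k x (f (t, x)) :=
  (memLp_cutoff hf k t).coeFn_toLp

theorem measurable_cutoff_comp {f : ℝ × Space n → ℂ} (hf : Measurable f) (k : ℕ) :
    Measurable fun y : ℝ × Space n => cutoff k y.2 (f y) := by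
  have h := (measurable_cutoff (n := n) k).comp (measurable_snd.prodMk hf)
  exact h

theorem stronglyMeasurable_cutoffL2 {f : ℝ × Space n → ℂ} (hf : Measurable f) (k : ℕ) :
    StronglyMeasurable (cutoffL2 hf k) := by
  borelize (L2 n)
  have : Fact ((2 : ℝ≥0∞) ≠ ⊤) := ⟨by norm_num⟩
  refine (measurable_of_measurable_edist fun c => ?_).stronglyMeasurable
  have h1 : ∀ t, edist (cutoffL2 hf k t) c =
      eLpNorm (fun x => cutoff k x (f (t, x)) - c x) 2 volume := by
    intro t
    rw [Lp.edist_def]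
    refine eLpNorm_congr_ae ?_
    filter_upwards [coeFn_cutoffL2 hf k t] with x hx
    rw [Pi.sub_apply, hx]
  simp only [h1]
  exact measurable_eLpNorm_section (f := fun y => cutoff k y.2 (f y) - c y.2)
    ((measurable_cutoff_comp hf k).sub ((Lp.stronglyMeasurable c).measurable.comp measurable_snd))
    (by norm_num) (by norm_num)

theorem exists_norm_cutoffL2_le {f : ℝ × Space n → ℂ} (hf : Measurable f) (k : ℕ) :
    ∃ K : ℝ, ∀ t, ‖cutoffL2 hf k t‖ ≤ K := by
  refine ⟨(eLpNorm ((Metric.closedBall (0 : Space n) k).indicator fun _ => (k : ℂ)) 2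
    volume).toReal, fun t => ?_⟩
  rw [cutoffL2, Lp.norm_toLp]
  refine ENNReal.toReal_mono ?_ (eLpNorm_mono fun x => norm_cutoff_le_indicator k x _)
  exact (memLp_indicator_const 2 (measurableSet_closedBall (x := (0 : Space n)) (ε := k)) (k : ℂ)
    (Or.inr measure_closedBall_lt_top.ne)).2.ne

theorem tendsto_eLpNorm_sub_of_eq_cutoff {g : Space n → ℂ} {q : ℝ≥0∞} (hq0 : q ≠ 0) (hqt : q ≠ ⊤)
    (hg : MemLp g q volume) {G : ℕ → L2 n} (h : ∀ᵐ x, ∀ k, G k x = cutoff k x (g x)) :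
    Tendsto (fun k => eLpNorm (fun x => g x - G k x) q volume) atTop (𝓝 0) := by
  have h1 := tendsto_eLpNorm_sub_of_dominated hq0 hqt (f := fun k => ⇑(G k)) (g := g)
    (G := fun x => ‖g x‖ₑ) (fun k => Lp.aestronglyMeasurable _) hg.1
    (by rw [eLpNorm_enorm]; exact hg.2.ne) (fun k => ?_) ?_
  · refine h1.congr fun k => ?_
    rw [← eLpNorm_neg]
    congr 1
    funext x
    simp
  · filter_upwards [h] with x hx
    rw [hx, ← enorm_neg, neg_sub, enorm_le_iff_norm_le]
    exact norm_sub_cutoff_le k x _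
  · filter_upwards [h] with x hx
    simp only [hx]
    exact tendsto_cutoff x _

theorem aemeasurable_eLpNorm_section {I : Set ℝ} {q : ℝ≥0∞} (hq0 : q ≠ 0) (hqt : q ≠ ⊤)
    {F : ℝ → Space n → ℂ} {f : ℝ × Space n → ℂ} (hf : Measurable f)
    (hfF : ∀ᵐ t ∂volume.restrict I, ∀ᵐ x, F t x = f (t, x)) :
    AEMeasurable (fun t => eLpNorm (F t) q volume) (volume.restrict I) := by
  refine ⟨_, measurable_eLpNorm_section hf hq0 hqt, ?_⟩
  filter_upwards [hfF] with t ht using eLpNorm_congr_ae ht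

theorem ae_memLp_of_mixedNorm_lt_top {I : Set ℝ} {p q : ℝ≥0∞} (hp0 : p ≠ 0) (hpt : p ≠ ⊤)
    (hq0 : q ≠ 0) (hqt : q ≠ ⊤) {F : ℝ → Space n → ℂ} {f : ℝ × Space n → ℂ} (hf : Measurable f)
    (hfF : ∀ᵐ t ∂volume.restrict I, ∀ᵐ x, F t x = f (t, x)) (hF : mixedNorm I p q F < ⊤) :
    ∀ᵐ t ∂volume.restrict I, MemLp (F t) q volume := by
  have hIntg := lintegral_rpow_enorm_lt_top_of_eLpNorm_lt_top hp0 hpt hF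
  simp only [enorm_eq_self] at hIntg
  have hm1 := aemeasurable_eLpNorm_section hq0 hqt hf hfF
  filter_upwards [hfF, ae_lt_top' (hm1.pow_const _) hIntg.ne] with t ht hlt
  refine ⟨⟨fun x => f (t, x), (hf.comp measurable_prodMk_left).stronglyMeasurable, ht⟩, ?_⟩
  exact (ENNReal.rpow_lt_top_iff_of_pos (ENNReal.toReal_pos hp0 hpt)).1 hlt

theorem exists_sourceApprox {I : Set ℝ} {p q : ℝ≥0∞} (hp : 2 ≤ p) (hq : 2 ≤ q)
    {F : ℝ → Space n → ℂ} (hF : IsSource I p q F) :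
    ∃ G, SourceApprox I q.conjExponent F G := by
  have hq0 := conjExponent_ne_zero q
  have hqt := conjExponent_ne_top hq
  obtain ⟨⟨f, hfm, hfF'⟩, hFn⟩ := hF
  have hf : Measurable f := hfm.measurable
  have hfF : ∀ᵐ t ∂volume.restrict I, ∀ᵐ x, F t x = f (t, x) := Measure.ae_ae_of_ae_prod hfF'
  have hGf : ∀ t, ∀ᵐ x, ∀ k, cutoffL2 hf k t x = cutoff k x (f (t, x)) := fun t =>
    ae_all_iff.2 fun k => coeFn_cutoffL2 hf k t
  have hGF : ∀ᵐ t ∂volume.restrict I, ∀ᵐ x, ∀ k, cutoffL2 hf k t x = cutoff k x (F t x) := by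
    filter_upwards [hfF] with t ht
    filter_upwards [ht, hGf t] with x h1 h2 k
    rw [h2, h1]
  have hmem := ae_memLp_of_mixedNorm_lt_top (conjExponent_ne_zero p) (conjExponent_ne_top hp)
    hq0 hqt hf hfF hFn
  refine ⟨cutoffL2 hf, ⟨fun k => (stronglyMeasurable_cutoffL2 hf k).aestronglyMeasurable,
    exists_norm_cutoffL2_le hf, aemeasurable_eLpNorm_section hq0 hqt hf hfF, fun k => ?_, hmem,
    ?_, ?_, ?_, ?_⟩⟩
  · refine aemeasurable_eLpNorm_section hq0 hqt (hf.sub (measurable_cutoff_comp hf k)) ?_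
    filter_upwards [hfF] with t ht
    filter_upwards [ht, hGf t] with x h1 h2
    rw [h1, h2]
    rfl
  · filter_upwards [hGF] with t ht k
    refine eLpNorm_mono_ae ?_
    filter_upwards [ht] with x hx
    rw [hx]
    exact norm_cutoff_le k x _
  · filter_upwards [hGF] with t ht k
    refine eLpNorm_mono_ae ?_
    filter_upwards [ht] with x hx
    rw [hx]
    exact norm_sub_cutoff_le k x _
  · filter_upwards [hGF] with t ht k m hkm
    refine eLpNorm_mono_ae ?_
    filter_upwards [ht, Lp.coeFn_sub (cutoffL2 hf k t) (cutoffL2 hf m t)] with x hx h2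
    rw [h2, Pi.sub_apply, hx, hx]
    exact norm_cutoff_sub_cutoff_le hkm x _
  · filter_upwards [hGF, hmem] with t ht hmt
    exact tendsto_eLpNorm_sub_of_eq_cutoff hq0 hqt hmt ht

namespace SourceApprox
variable {I : Set ℝ} {p q : ℝ≥0∞} {F : ℝ → Space n → ℂ} {G : ℕ → ℝ → L2 n}

theorem mixedNorm_le (h : SourceApprox I q F G) (p : ℝ≥0∞) (k : ℕ) :
    mixedNorm I p q (fun t => G k t) ≤ mixedNorm I p q F := by
  refine eLpNorm_mono_enorm_ae ?_
  filter_upwards [h.le] with t ht using ht k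

theorem mixedNorm_sub_le (h : SourceApprox I q F G) (p : ℝ≥0∞) {k m : ℕ} (hkm : k ≤ m) :
    mixedNorm I p q (fun t => ⇑(G k t - G m t)) ≤ mixedNorm I p q (fun t x => F t x - G k t x) := by
  refine eLpNorm_mono_enorm_ae ?_
  filter_upwards [h.sub_le_sub] with t ht using ht k m hkm

theorem tendsto_mixedNorm (h : SourceApprox I q F G) (hp0 : p ≠ 0) (hpt : p ≠ ⊤)
    (hF : mixedNorm I p q F < ⊤) :
    Tendsto (fun k => mixedNorm I p q (fun t x => F t x - G k t x)) atTop (𝓝 0) := by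
  refine tendsto_eLpNorm_zero_of_dominated hp0 hpt h.aemeasurable_sub hF.ne (fun k => ?_) h.tendsto
  filter_upwards [h.sub_le] with t ht using ht k

theorem integrableOn (h : SourceApprox I q F G) {T : ℝ} (hT : Icc 0 T ⊆ I) (k : ℕ) :
    IntegrableOn (G k) (Icc 0 T) := by
  obtain ⟨K, hK⟩ := h.bounded k
  exact Integrable.of_bound ((h.aestronglyMeasurable k).mono_measure (Measure.restrict_mono_set _ hT)) K
    (ae_of_all _ hK)

end SourceApprox

/-! ### Iteration of the estimates over short intervals -/

theorem integrableOn_comp_add {F : ℝ → L2 n} {a b T : ℝ} (ha : 0 ≤ a) (hb : b ≤ T)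
    (hF : IntegrableOn F (Icc 0 T)) : IntegrableOn (fun s => F (s + a)) (Icc 0 (b - a)) := by
  have h1 : IntegrableOn F (Icc a b) := hF.mono_set (Icc_subset_Icc ha hb)
  have hme : MeasurableEmbedding fun x : ℝ => x + a := (Homeomorph.addRight a).measurableEmbedding
  rw [← map_add_right_eq_self volume a, hme.integrableOn_map_iff] at h1
  refine h1.mono_set fun x hx => ?_
  exact ⟨by linarith [hx.1], by linarith [hx.2]⟩

theorem duhamel_freeGroup_add {F : ℝ → L2 n} {a t T : ℝ} (ha : 0 ≤ a) (ht : 0 ≤ t)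
    (htT : t + a ≤ T) (hF : IntegrableOn F (Icc 0 T)) :
    duhamel (freeGroup n) F (t + a) = freeGroup n t (duhamel (freeGroup n) F a) +
      duhamel (freeGroup n) (fun s => F (s + a)) t := by
  have hE := isometricGroup_freeGroup n
  have hi : ∀ r b c, b ∈ Icc 0 T → c ∈ Icc 0 T →
      IntervalIntegrable (fun s => freeGroup n (r - s) (F s)) volume b c := fun r b c hb hc =>
    hE.intervalIntegrable_comp (g := fun s => r - s) (continuous_const.sub continuous_id)
      ((intervalIntegrable_of_integrableOn hF hb).symm.trans
        (intervalIntegrable_of_integrableOn hF hc))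
  have h0 : (0 : ℝ) ∈ Icc 0 T := ⟨le_rfl, by linarith⟩
  have haT : a ∈ Icc 0 T := ⟨ha, by linarith⟩
  have htaT : t + a ∈ Icc 0 T := ⟨by linarith, htT⟩
  have h1 : duhamel (freeGroup n) (fun s => F (s + a)) t =
      ∫ s in a..(t + a), freeGroup n (t + a - s) (F s) := by
    have := intervalIntegral.integral_comp_add_right (a := 0) (b := t)
      (fun s => freeGroup n (t + a - s) (F s)) a
    rw [zero_add] at this
    rw [← this]
    refine intervalIntegral.integral_congr fun s _ => ?_
    simp only [add_sub_add_right_eq_sub]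
  have h2 : freeGroup n t (duhamel (freeGroup n) F a) =
      ∫ s in (0 : ℝ)..a, freeGroup n (t + a - s) (F s) := by
    rw [duhamel, ← (freeGroup n t).intervalIntegral_comp_comm (hi a 0 a h0 haT)]
    refine intervalIntegral.integral_congr fun s _ => ?_
    beta_reduce
    rw [← freeGroup_add, add_sub_assoc]
  rw [h1, h2]
  exact (intervalIntegral.integral_add_adjacent_intervals (hi _ _ _ h0 haT)
    (hi _ _ _ haT htaT)).symm

theorem ContinuousInLp.comp_add {V : ℝ → Space n → ℝ} {r : ℝ≥0∞} {a b T : ℝ} (ha : 0 ≤ a)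
    (hb : b ≤ T) (hV : ContinuousInLp (Icc 0 T) r V) :
    ContinuousInLp (Icc 0 (b - a)) r (fun t => V (t + a)) := by
  have hm : MapsTo (fun t => t + a) (Icc 0 (b - a)) (Icc 0 T) := fun t ht =>
    ⟨by linarith [ht.1], by linarith [ht.2]⟩
  intro t ht
  refine ⟨(hV _ (hm ht)).1, (hV _ (hm ht)).2.comp ?_⟩
  exact (continuous_add_const a).continuousWithinAt.tendsto_nhdsWithin hm

/-- All Duhamel integrals of `G` over subintervals of `[0, T]` are bounded by `C B`. -/
def SourceBound (T : ℝ) (C : ℝ≥0∞) (G : ℝ → L2 n) (B : ℝ≥0∞) : Prop :=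
  ∀ a b, 0 ≤ a → b ≤ T → ∀ p q, Admissible n p q →
    mixedNorm (Icc 0 (b - a)) p q (fun t => duhamel (freeGroup n) (fun s => G (s + a)) t) ≤ C * B

namespace SourceBound
variable {T : ℝ} {C B B' : ℝ≥0∞} {G G' : ℝ → L2 n}

theorem of_mixedNorm_le (hC : ∀ T, StrichartzOn (freeGroup n) T C) {p₁ q₁ : ℝ≥0∞}
    (hpq : Admissible n p₁ q₁) (hG : IntegrableOn G (Icc 0 T))
    (hB : mixedNorm (Icc 0 T) p₁.conjExponent q₁.conjExponent (fun t => G t) ≤ B) :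
    SourceBound T C G B := by
  intro a b ha hb p q hpq'
  refine ((hC _).inhomogeneous hpq' hpq (integrableOn_comp_add ha hb hG)).trans ?_
  gcongr
  rw [mixedNorm_comp_add a b _ _ (fun t => G t)]
  exact (mixedNorm_mono_set (Icc_subset_Icc ha hb) _ _ _).trans hB

theorem add (h : SourceBound T C G B) (h' : SourceBound T C G' B') (hG : IntegrableOn G (Icc 0 T))
    (hG' : IntegrableOn G' (Icc 0 T)) : SourceBound T C (fun t => G t + G' t) (B + B') := by
  intro a b ha hb p q hpq
  have hE := isometricGroup_freeGroup n
  have hi := integrableOn_comp_add ha hb hG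
  have hi' := integrableOn_comp_add ha hb hG'
  have e : mixedNorm (Icc 0 (b - a)) p q
      (fun t => duhamel (freeGroup n) (fun s => G (s + a) + G' (s + a)) t) =
      mixedNorm (Icc 0 (b - a)) p q (fun t => ⇑(duhamel (freeGroup n) (fun s => G (s + a)) t +
        duhamel (freeGroup n) (fun s => G' (s + a)) t)) := by
    refine mixedNorm_congr_ae ?_
    filter_upwards [ae_restrict_mem measurableSet_Icc] with t ht
    rw [duhamel_add hE hi hi' ht]
  rw [e, mul_add]
  exact (mixedNorm_add_le hpq.one_le_left hpq.one_le_right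
    ((hE.continuousOn_duhamel hi).aestronglyMeasurable measurableSet_Icc)
    ((hE.continuousOn_duhamel hi').aestronglyMeasurable measurableSet_Icc)).trans
    (add_le_add (h a b ha hb p q hpq) (h' a b ha hb p q hpq))

theorem smul (h : SourceBound T C G B) {c : ℂ} (hc : ‖c‖ = 1) :
    SourceBound T C (fun t => c • G t) B := by
  intro a b ha hb p q hpq
  simp only [duhamel_smul]
  rw [mixedNorm_smul_of_norm_one _ _ _ _ hc]
  exact h a b ha hb p q hpq

end SourceBound

/-- On `[a, b]` the potential is, up to a bounded part, small enough to be absorbed. -/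
def Good (C : ℝ≥0∞) (V : ℝ → Space n → ℝ) (a b : ℝ) : Prop :=
  ∃ M ε : ℝ≥0, (∀ᵐ t ∂volume.restrict (Icc a b), tail M (V t) ≤ ε) ∧
    C * (M * ENNReal.ofReal (b - a) + ε) ≤ 2⁻¹

/-- `[0, b]` is a union of `k` consecutive good intervals. -/
inductive GoodChain (C : ℝ≥0∞) (V : ℝ → Space n → ℝ) : ℕ → ℝ → Prop
  | zero : GoodChain C V 0 0
  | succ {k : ℕ} {a b : ℝ} : GoodChain C V k a → a ≤ b → Good C V a b → GoodChain C V (k + 1) b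

theorem GoodChain.nonneg {C : ℝ≥0∞} {V : ℝ → Space n → ℝ} {k : ℕ} {b : ℝ}
    (h : GoodChain C V k b) : 0 ≤ b := by
  induction h with
  | zero => exact le_rfl
  | succ _ hab _ ih => exact ih.trans hab

theorem good_self (C : ℝ≥0∞) (V : ℝ → Space n → ℝ) (a : ℝ) : Good C V a a := by
  refine ⟨0, 0, ?_, by simp⟩
  have : volume.restrict (Icc a a) = 0 := by simp
  rw [this]
  exact ae_zero.symm ▸ trivial

theorem GoodChain.le {C : ℝ≥0∞} {V : ℝ → Space n → ℝ} {k m : ℕ} {b : ℝ}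
    (h : GoodChain C V k b) (hkm : k ≤ m) : GoodChain C V m b := by
  induction hkm with
  | refl => exact h
  | step _ ih => exact ih.succ le_rfl (good_self C V b)

theorem GoodChain.mono {C : ℝ≥0∞} {V W : ℝ → Space n → ℝ} (hVW : ∀ M t, tail M (W t) ≤ tail M (V t))
    {k : ℕ} {b : ℝ} (h : GoodChain C V k b) : GoodChain C W k b := by
  induction h with
  | zero => exact .zero
  | succ _ hab hg ih =>
    obtain ⟨M, ε, h1, h2⟩ := hg
    refine ih.succ hab ⟨M, ε, ?_, h2⟩
    filter_upwards [h1] with t ht using (hVW M t).trans ht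

/-- `u` is the limit of `e^{itΔ} u₀ + ∫₀ᵗ e^{i(t-s)Δ} (G_k - i V_k u) ds`, where `V_k` are the
truncations of `V`. -/
structure LimitSolution (T : ℝ) (V : ℝ → Space n → ℝ) (u₀ : L2 n) (G : ℕ → ℝ → L2 n)
    (u : ℝ → L2 n) : Prop where
  continuousOn : ContinuousOn u (Icc 0 T)
  finite : mixedNorm (Icc 0 T) 2 (sobExp n) (fun t => u t) < ⊤
  tendsto : ∀ t ∈ Icc 0 T, Tendsto (fun k : ℕ => freeGroup n t u₀ +
    duhamel (freeGroup n) (G k) t +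
    (-Complex.I) • duhamel (freeGroup n) (fun s => clipMul k (V s) (u s)) t) atTop (𝓝 (u t))

namespace LimitSolution
variable {T : ℝ} {V : ℝ → Space n → ℝ} {u₀ : L2 n} {G : ℕ → ℝ → L2 n} {u : ℝ → L2 n}

theorem apply_zero (h : LimitSolution T V u₀ G u) (hT : 0 ≤ T) : u 0 = u₀ := by
  have h0 := h.tendsto 0 ⟨le_rfl, hT⟩
  simp only [duhamel, intervalIntegral.integral_same, smul_zero, add_zero, freeGroup_zero] at h0
  exact tendsto_nhds_unique h0 tendsto_const_nhds

theorem mixedNorm_le_of_good (hn : 3 ≤ n) {C : ℝ≥0∞} (hC : ∀ T, StrichartzOn (freeGroup n) T C)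
    (hV : ContinuousInLp (Icc 0 T) ((n : ℝ≥0∞) / 2) V) (hG : ∀ k, IntegrableOn (G k) (Icc 0 T))
    {B : ℝ≥0∞} (hB : ∀ k, SourceBound T C (G k) B) (h : LimitSolution T V u₀ G u) {a b : ℝ}
    (ha : 0 ≤ a) (hab : a ≤ b) (hb : b ≤ T) (hg : Good C V a b) {p q : ℝ≥0∞}
    (hpq : Admissible n p q) :
    mixedNorm (Icc a b) p q (fun t => u t) ≤ 2 * C * (‖u a‖ₑ + B) := by
  obtain ⟨M, ε, hε, hsmall⟩ := hg
  have hE := isometricGroup_freeGroup n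
  have hm : MapsTo (fun t => t + a) (Icc 0 (b - a)) (Icc 0 T) := fun t ht =>
    ⟨by linarith [ht.1], by linarith [ht.2]⟩
  have hcl : ∀ K : ℝ≥0, IntegrableOn (fun s => clipMul K (V s) (u s)) (Icc 0 T) := fun K =>
    (continuousOn_clipMul_comp hn hV K h.continuousOn).integrableOn_compact isCompact_Icc
  rw [← mixedNorm_comp_add a b p q (fun t => u t)]
  refine mixedNorm_le_of_tendsto_duhamel_of_small hn hE (hC _) (hV.comp_add ha hb)
    (w := fun t => u (t + a)) (h.continuousOn.comp (continuous_add_const a).continuousOn hm)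
    (u₀ := u a) (G := fun k s => G k (s + a)) (fun k => integrableOn_comp_add ha hb (hG k))
    (fun k p q hpq => hB k a b ha hb p q hpq) (c := -Complex.I) (by simp) ?_ ?_ hsmall ?_ hpq
  · intro t ht
    have h1 := h.tendsto a ⟨ha, hab.trans hb⟩
    have h2 := h.tendsto (t + a) (hm ht)
    have h3 := ((freeGroup n t).continuous.tendsto (u a)).comp h1
    have h4 := (h2.sub h3).add_const (freeGroup n t (u a))
    rw [sub_add_cancel] at h4
    refine h4.congr fun k => ?_
    simp only [Function.comp_apply]
    rw [duhamel_freeGroup_add ha ht.1 (hm ht).2 (hG k),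
      duhamel_freeGroup_add ha ht.1 (hm ht).2 (hcl k), map_add, map_add, map_smul, freeGroup_add,
      smul_add]
    abel
  · have hme : MeasurableEmbedding fun x : ℝ => x + a :=
      (Homeomorph.addRight a).measurableEmbedding
    have hpre : (fun x => x + a) ⁻¹' (Icc a b) = Icc 0 (b - a) := by
      ext x
      simp only [mem_preimage, mem_Icc, le_add_iff_nonneg_left, le_sub_iff_add_le]
    rw [← map_add_right_eq_self volume a, hme.restrict_map, hpre, hme.ae_map_iff] at hε
    exact hε
  · rw [mixedNorm_comp_add a b _ _ (fun t => u t)]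
    exact (mixedNorm_mono_set (Icc_subset_Icc ha hb) _ _ _).trans_lt h.finite

theorem mixedNorm_le_of_goodChain (hn : 3 ≤ n) {C : ℝ≥0∞} (hC1 : 1 ≤ C)
    (hC : ∀ T, StrichartzOn (freeGroup n) T C)
    (hV : ContinuousInLp (Icc 0 T) ((n : ℝ≥0∞) / 2) V) (hG : ∀ k, IntegrableOn (G k) (Icc 0 T))
    {B : ℝ≥0∞} (hB : ∀ k, SourceBound T C (G k) B) (h : LimitSolution T V u₀ G u) {k : ℕ} {b : ℝ}
    (hk : GoodChain C V k b) (hb : b ≤ T) :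
    (∀ p q, Admissible n p q → mixedNorm (Icc 0 b) p q (fun t => u t) ≤
      k * (1 + 2 * C) ^ k * (‖u₀‖ₑ + B)) ∧ ‖u b‖ₑ + B ≤ (1 + 2 * C) ^ k * (‖u₀‖ₑ + B) := by
  induction hk with
  | zero =>
    refine ⟨fun p q _ => ?_, by rw [h.apply_zero hb, pow_zero, one_mul]⟩
    have : volume.restrict (Icc (0 : ℝ) 0) = 0 := by simp
    rw [mixedNorm, this, eLpNorm_measure_zero]
    exact zero_le
  | @succ k a b hch hab hg ih =>
    obtain ⟨ih1, ih2⟩ := ih (hab.trans hb)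
    set A := ‖u₀‖ₑ + B
    have ha := hch.nonneg
    have hIntg : ∀ p q, Admissible n p q →
        mixedNorm (Icc a b) p q (fun t => u t) ≤ 2 * C * ((1 + 2 * C) ^ k * A) := by
      intro p q hpq
      refine (h.mixedNorm_le_of_good hn hC hV hG hB ha hab hb hg hpq).trans ?_
      gcongr
    have hD : 2 * C * ((1 + 2 * C) ^ k * A) ≤ (1 + 2 * C) ^ (k + 1) * A := by
      calc 2 * C * ((1 + 2 * C) ^ k * A) ≤ (1 + 2 * C) * ((1 + 2 * C) ^ k * A) :=
            mul_le_mul' le_add_self le_rfl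
        _ = _ := by ring
    have h1D : (1 + 2 * C) ^ k ≤ (1 + 2 * C) ^ (k + 1) :=
      pow_le_pow_right₀ le_self_add (Nat.le_succ k)
    refine ⟨fun p q hpq => ?_, ?_⟩
    · have hu : Icc 0 b = Icc 0 a ∪ Icc a b := (Icc_union_Icc_eq_Icc ha hab).symm
      rw [hu]
      refine (mixedNorm_union_le hpq.one_le_left measurableSet_Icc measurableSet_Icc ?_).trans ?_
      · rw [← hu]
        exact (h.continuousOn.mono (Icc_subset_Icc_right hb)).aestronglyMeasurable measurableSet_Icc
      · calc _ ≤ k * (1 + 2 * C) ^ (k + 1) * A + (1 + 2 * C) ^ (k + 1) * A := by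
              refine add_le_add ((ih1 p q hpq).trans ?_) ((hIntg p q hpq).trans hD)
              gcongr
          _ = _ := by
              push_cast
              ring
    · have hub : ‖u b‖ₑ ≤ 2 * C * ((1 + 2 * C) ^ k * A) := by
        rcases hab.eq_or_lt with rfl | hlt
        · refine (le_self_add.trans ih2).trans ?_
          refine le_mul_of_one_le_left' ?_
          exact hC1.trans (le_mul_of_one_le_left' (by norm_num))
        · exact (enorm_le_mixedNorm_top hlt (h.continuousOn.mono (Icc_subset_Icc ha hb))
            ⟨hab, le_rfl⟩).trans (hIntg ⊤ 2 (admissible_top_two n))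
      have hBA : B ≤ (1 + 2 * C) ^ k * A := le_add_self.trans ih2
      calc ‖u b‖ₑ + B ≤ 2 * C * ((1 + 2 * C) ^ k * A) + (1 + 2 * C) ^ k * A := add_le_add hub hBA
        _ = _ := by ring

end LimitSolution

/-! ### Uniform smallness of the tails and existence of good chains -/

theorem tail_le_add (hn : 3 ≤ n) (M : ℝ≥0) {V W : Space n → ℝ}
    (hV : AEStronglyMeasurable V volume) (hW : AEStronglyMeasurable W volume) :
    tail M V ≤ tail M W + eLpNorm (fun x => V x - W x) ((n : ℝ≥0∞) / 2) volume := by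
  have hm : AEStronglyMeasurable (fun x => W x - clip M (W x)) volume :=
    hW.sub ((continuous_clip M).comp_aestronglyMeasurable hW)
  have h1 := eLpNorm_add_le (p := (n : ℝ≥0∞) / 2) hm.norm (hV.sub hW).norm (one_le_half hn)
  rw [show (fun x => ‖W x - clip M (W x)‖) = fun x => ‖(fun y => W y - clip M (W y)) x‖ from rfl,
    eLpNorm_norm, eLpNorm_norm] at h1
  refine le_trans (eLpNorm_mono_real fun x => ?_) h1
  exact abs_sub_clip_le_add M (V x) (W x)

theorem exists_tail_le (hn : 3 ≤ n) {V : ℝ → Space n → ℝ} {T : ℝ}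
    (hV : ContinuousInLp (Icc 0 T) ((n : ℝ≥0∞) / 2) V) {ε : ℝ≥0∞} (hε : 0 < ε) :
    ∃ M : ℕ, ∀ t ∈ Icc 0 T, tail M (V t) ≤ ε := by
  refine isCompact_Icc.induction_on (p := fun s => ∃ M : ℕ, ∀ t ∈ s, tail M (V t) ≤ ε)
    ⟨0, fun t ht => ht.elim⟩ ?_ ?_ ?_
  · rintro s s' hs ⟨M, hM⟩
    exact ⟨M, fun t ht => hM t (hs ht)⟩
  · rintro s s' ⟨M, hM⟩ ⟨M', hM'⟩
    refine ⟨max M M', fun t ht => ?_⟩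
    rcases ht with ht | ht
    · exact (tail_anti (by exact_mod_cast le_max_left M M') _).trans (hM t ht)
    · exact (tail_anti (by exact_mod_cast le_max_right M M') _).trans (hM' t ht)
  · intro t ht
    have hε2 : 0 < ε / 2 := ENNReal.half_pos hε.ne'
    obtain ⟨M, hM⟩ := ((tendsto_tail hn (hV t ht).1).eventually_le_const hε2).exists
    refine ⟨_, inter_mem ((hV t ht).2.eventually_le_const hε2) self_mem_nhdsWithin, M, ?_⟩
    rintro s ⟨hs, hsI⟩
    refine (tail_le_add hn M (hV s hsI).1.1 (hV t ht).1.1).trans ?_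
    exact (add_le_add hM hs).trans_eq (ENNReal.add_halves ε)

theorem exists_eLpNorm_le (hn : 3 ≤ n) {V : ℝ → Space n → ℝ} {T : ℝ}
    (hV : ContinuousInLp (Icc 0 T) ((n : ℝ≥0∞) / 2) V) :
    ∃ A : ℝ≥0, ∀ t ∈ Icc 0 T, eLpNorm (V t) ((n : ℝ≥0∞) / 2) volume ≤ A := by
  refine isCompact_Icc.induction_on
    (p := fun s => ∃ A : ℝ≥0, ∀ t ∈ s, eLpNorm (V t) ((n : ℝ≥0∞) / 2) volume ≤ A)
    ⟨0, fun t ht => ht.elim⟩ ?_ ?_ ?_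
  · rintro s s' hs ⟨M, hM⟩
    exact ⟨M, fun t ht => hM t (hs ht)⟩
  · rintro s s' ⟨M, hM⟩ ⟨M', hM'⟩
    refine ⟨max M M', fun t ht => ?_⟩
    rcases ht with ht | ht
    · exact (hM t ht).trans (by exact_mod_cast le_max_left M M')
    · exact (hM' t ht).trans (by exact_mod_cast le_max_right M M')
  · intro t ht
    refine ⟨_, inter_mem ((hV t ht).2.eventually_le_const one_pos) self_mem_nhdsWithin,
      (eLpNorm (V t) ((n : ℝ≥0∞) / 2) volume).toNNReal + 1, ?_⟩
    rintro s ⟨hs, hsI⟩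
    rw [ENNReal.coe_add, ENNReal.coe_toNNReal (hV t ht).1.2.ne, ENNReal.coe_one]
    have := tail_le_add hn 0 (hV s hsI).1.1 (hV t ht).1.1
    rw [tail_zero, tail_zero] at this
    exact this.trans (add_le_add le_rfl hs)

/-- The supremum over `[0, T]` of the tails of `V`. -/
def supTail (T : ℝ) (V : ℝ → Space n → ℝ) (k : ℕ) : ℝ≥0∞ := ⨆ t ∈ Icc 0 T, tail k (V t)

theorem tail_le_supTail {T : ℝ} (V : ℝ → Space n → ℝ) (k : ℕ) {t : ℝ} (ht : t ∈ Icc 0 T) :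
    tail k (V t) ≤ supTail T V k :=
  le_iSup₂ (f := fun t (_ : t ∈ Icc 0 T) => tail k (V t)) t ht

theorem tendsto_supTail (hn : 3 ≤ n) {V : ℝ → Space n → ℝ} {T : ℝ}
    (hV : ContinuousInLp (Icc 0 T) ((n : ℝ≥0∞) / 2) V) :
    Tendsto (supTail T V) atTop (𝓝 0) := by
  rw [ENNReal.tendsto_nhds_zero]
  intro ε hε
  obtain ⟨M, hM⟩ := exists_tail_le hn hV hε
  filter_upwards [eventually_ge_atTop M] with k hk
  exact iSup₂_le fun t ht => (tail_anti (by exact_mod_cast hk) _).trans (hM t ht)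

theorem supTail_ne_top (hn : 3 ≤ n) {V : ℝ → Space n → ℝ} {T : ℝ}
    (hV : ContinuousInLp (Icc 0 T) ((n : ℝ≥0∞) / 2) V) (k : ℕ) : supTail T V k ≠ ⊤ := by
  obtain ⟨A, hA⟩ := exists_eLpNorm_le hn hV
  exact ((iSup₂_le fun t ht => (tail_le _ _).trans (hA t ht)).trans_lt ENNReal.coe_lt_top).ne

theorem exists_forall_goodChain (hn : 3 ≤ n) {C : ℝ≥0∞} (hC1 : 1 ≤ C) (hC : C ≠ ⊤)
    {V : ℝ → Space n → ℝ} {T : ℝ} (hV : ContinuousInLp (Icc 0 T) ((n : ℝ≥0∞) / 2) V) :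
    ∃ N : ℕ, ∀ b ∈ Icc 0 T, GoodChain C V N b := by
  lift C to ℝ≥0 using hC
  have hC0 : (0 : ℝ) < C := lt_of_lt_of_le one_pos (by exact_mod_cast hC1)
  have hC0' : 0 < C := by exact_mod_cast hC0
  obtain ⟨M, hM⟩ := exists_tail_le hn hV (ε := ((4 * C)⁻¹ : ℝ≥0)) (by positivity)
  set δ : ℝ := (4 * (C : ℝ) * (M + 1))⁻¹ with hδ
  have hδ0 : 0 < δ := by positivity
  obtain ⟨N, hN⟩ := exists_nat_ge (T / δ)
  have hNT : T ≤ N * δ := (div_le_iff₀ hδ0).1 hN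
  refine ⟨N, fun b hb => ?_⟩
  have key : ∀ i : ℕ, GoodChain (C : ℝ≥0∞) V i (min (i * δ) b) := by
    intro i
    induction i with
    | zero =>
      simp only [Nat.cast_zero, zero_mul, min_eq_left hb.1]
      exact .zero
    | succ i ih =>
      have hle : (i : ℝ) * δ ≤ ((i + 1 : ℕ) : ℝ) * δ := by
        push_cast
        nlinarith
      refine ih.succ (min_le_min_right _ hle) ⟨M, (4 * C)⁻¹, ?_, ?_⟩
      · filter_upwards [ae_restrict_mem measurableSet_Icc] with t ht
        refine hM t ⟨le_trans (le_min (by positivity) hb.1) ht.1, ht.2.trans ?_⟩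
        exact (min_le_right _ _).trans hb.2
      · have hd : min (((i + 1 : ℕ) : ℝ) * δ) b - min ((i : ℝ) * δ) b ≤ δ := by
          push_cast
          rcases le_total ((i : ℝ) * δ) b with h | h
          · rw [min_eq_left h]
            linarith [min_le_left (((i : ℝ) + 1) * δ) b]
          · rw [min_eq_right h]
            linarith [min_le_right (((i : ℝ) + 1) * δ) b]
        have h1 : (C : ℝ) * (M * δ + (4 * (C : ℝ))⁻¹) ≤ 2⁻¹ := by
          have : (C : ℝ) * (M * δ) ≤ 4⁻¹ := by
            rw [hδ]
            have : (M : ℝ) ≤ M + 1 := by linarith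
            calc (C : ℝ) * (M * (4 * (C : ℝ) * (M + 1))⁻¹)
                ≤ C * ((M + 1) * (4 * (C : ℝ) * (M + 1))⁻¹) := by
                  gcongr
              _ = 4⁻¹ := by field_simp
          have h2 : (C : ℝ) * (4 * (C : ℝ))⁻¹ = 4⁻¹ := by field_simp
          rw [mul_add, h2]
          linarith
        calc (C : ℝ≥0∞) * (((M : ℝ≥0) : ℝ≥0∞) * ENNReal.ofReal
              (min (((i + 1 : ℕ) : ℝ) * δ) b - min ((i : ℝ) * δ) b) + ((4 * C)⁻¹ : ℝ≥0))
            ≤ C * (((M : ℝ≥0) : ℝ≥0∞) * ENNReal.ofReal δ + ((4 * C)⁻¹ : ℝ≥0)) := by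
              gcongr
          _ = ENNReal.ofReal (C * (M * δ + (4 * (C : ℝ))⁻¹)) := by
              rw [ENNReal.ofReal_mul (by positivity), ENNReal.ofReal_add (by positivity)
                (by positivity), ENNReal.ofReal_mul (by positivity), ENNReal.ofReal_coe_nnreal]
              congr 2
              · simp
              · rw [← ENNReal.ofReal_coe_nnreal]
                push_cast
                rfl
          _ ≤ ENNReal.ofReal 2⁻¹ := ENNReal.ofReal_le_ofReal h1
          _ = 2⁻¹ := by
              rw [ENNReal.ofReal_inv_of_pos (by norm_num)]
              norm_num
  have := key N
  rwa [min_eq_right (hb.2.trans hNT)] at this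

theorem good_of_ae_le {C : ℝ≥0∞} (hC1 : 1 ≤ C) (hC : C ≠ ⊤) {V : ℝ → Space n → ℝ} {a b : ℝ}
    (h : ∀ᵐ t ∂volume.restrict (Icc a b),
      eLpNorm (V t) ((n : ℝ≥0∞) / 2) volume ≤ (2 * C)⁻¹) : Good C V a b := by
  have hC0 : C ≠ 0 := (lt_of_lt_of_le one_pos hC1).ne'
  have hfin : (2 * C)⁻¹ ≠ ⊤ := ENNReal.inv_ne_top.2 (mul_ne_zero (by norm_num) hC0)
  refine ⟨0, ((2 * C)⁻¹).toNNReal, ?_, ?_⟩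
  · filter_upwards [h] with t ht
    rwa [tail_zero, ENNReal.coe_toNNReal hfin]
  · rw [ENNReal.coe_toNNReal hfin, ENNReal.coe_zero, zero_mul, zero_add,
      ENNReal.mul_inv (by simp) (by simp), mul_left_comm, ENNReal.mul_inv_cancel hC0 hC, mul_one]

theorem exists_forall_goodChain_Ici (hn : 3 ≤ n) {C : ℝ≥0∞} (hC1 : 1 ≤ C) (hC : C ≠ ⊤)
    {V : ℝ → Space n → ℝ} (hV : ContinuousInLp (Ici 0) ((n : ℝ≥0∞) / 2) V) {T₀ : ℝ} (hT₀ : 0 < T₀)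
    (h : ∀ t, T₀ < t → eLpNorm (V t) ((n : ℝ≥0∞) / 2) volume ≤ (2 * C)⁻¹) :
    ∃ N : ℕ, ∀ b, 0 ≤ b → GoodChain C V N b := by
  have hV' : ContinuousInLp (Icc 0 T₀) ((n : ℝ≥0∞) / 2) V := fun t ht =>
    ⟨(hV t ht.1).1, (hV t ht.1).2.mono_left (nhdsWithin_mono _ Icc_subset_Ici_self)⟩
  obtain ⟨N, hN⟩ := exists_forall_goodChain hn hC1 hC hV'
  refine ⟨N + 1, fun b hb => ?_⟩
  rcases le_or_gt b T₀ with hbT | hbT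
  · exact (hN b ⟨hb, hbT⟩).le (Nat.le_succ N)
  · refine (hN T₀ ⟨hT₀.le, le_rfl⟩).succ hbT.le (good_of_ae_le hC1 hC ?_)
    rw [← Measure.restrict_congr_set Ioc_ae_eq_Icc]
    filter_upwards [ae_restrict_mem measurableSet_Ioc] with t ht using h t ht.1

theorem goodChain_of_cover {ι : Type*} [DecidableEq ι] {C : ℝ≥0∞} (hC1 : 1 ≤ C) (hC : C ≠ ⊤)
    {V : ℝ → Space n → ℝ} {J : ι → Set ℝ} (hJ : ∀ j, (J j).OrdConnected)
    (h : ∀ j, ∀ᵐ t ∂volume.restrict (J j), eLpNorm (V t) ((n : ℝ≥0∞) / 2) volume ≤ (2 * C)⁻¹)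
    (k : ℕ) : ∀ (s : Finset ι) (T : ℝ), s.card ≤ k → 0 ≤ T → Ico 0 T ⊆ ⋃ j ∈ s, J j →
      GoodChain C V k T := by
  induction k with
  | zero =>
    intro s T hs hT hcov
    rcases hT.eq_or_lt with rfl | hT
    · exact .zero
    · have hs0 : s = ∅ := Finset.card_eq_zero.1 (Nat.le_zero.1 hs)
      have := hcov ⟨le_rfl, hT⟩
      simp [hs0] at this
  | succ k ih =>
    intro s T hs hT hcov
    rcases hT.eq_or_lt with rfl | hT
    · exact GoodChain.zero.le (Nat.zero_le _)
    have hex : ∃ j ∈ s, ∃ᶠ t in 𝓝[<] T, t ∈ J j := by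
      by_contra hcon
      push Not at hcon
      have h1 : ∀ᶠ t in 𝓝[<] T, ∀ j ∈ s, t ∉ J j :=
        (Filter.eventually_all_finset s).2 fun j hj => by simpa using hcon j hj
      obtain ⟨t, ht1, ht2⟩ := (h1.and (Ioo_mem_nhdsLT hT)).exists
      obtain ⟨j, hj, hjt⟩ := mem_iUnion₂.1 (hcov ⟨ht2.1.le, ht2.2⟩)
      exact ht1 j hj hjt
    obtain ⟨j, hj, hfr⟩ := hex
    set A := J j ∩ Ico 0 T with hA
    have hAfr : ∀ t < T, ∃ y ∈ A, t < y := by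
      intro t ht
      obtain ⟨y, hy, hyt⟩ := (hfr.and_eventually
        (Ioo_mem_nhdsLT (max_lt hT ht))).exists
      exact ⟨y, ⟨hy, (le_max_left _ _).trans hyt.1.le, hyt.2⟩, (le_max_right _ _).trans_lt hyt.1⟩
    have hAne : A.Nonempty := by
      obtain ⟨y, hy, -⟩ := hAfr 0 hT
      exact ⟨y, hy⟩
    have hAb : BddBelow A := ⟨0, fun y hy => hy.2.1⟩
    set b := sInf A
    have hb0 : 0 ≤ b := le_csInf hAne fun y hy => hy.2.1
    have hbT : b ≤ T := by
      obtain ⟨y, hy⟩ := hAne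
      exact (csInf_le hAb hy).trans hy.2.2.le
    have hsub : Ioo b T ⊆ J j := by
      intro t ht
      obtain ⟨x, hx, hxt⟩ := exists_lt_of_csInf_lt hAne ht.1
      obtain ⟨y, hy, hty⟩ := hAfr t ht.2
      exact (hJ j).out hx.1 hy.1 ⟨hxt.le, hty.le⟩
    refine (ih (s.erase j) b ?_ hb0 ?_).succ hbT (good_of_ae_le hC1 hC ?_)
    · rw [Finset.card_erase_of_mem hj]
      omega
    · intro t ht
      obtain ⟨i, hi, hit⟩ := mem_iUnion₂.1 (hcov ⟨ht.1, ht.2.trans_le hbT⟩)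
      refine mem_iUnion₂.2 ⟨i, Finset.mem_erase.2 ⟨?_, hi⟩, hit⟩
      rintro rfl
      exact ht.2.not_ge (csInf_le hAb ⟨hit, ht.1, ht.2.trans_le hbT⟩)
    · rw [← Measure.restrict_congr_set Ioo_ae_eq_Icc]
      exact ae_mono (Measure.restrict_mono_set _ hsub) (h j)

theorem SmallPartition.goodChain {I : Set ℝ} {V : ℝ → Space n → ℝ} {k : ℕ}
    (h : SmallPartition I V k) (hC : freeStrichartzConstant n ≠ ⊤) {T : ℝ} (hT : 0 ≤ T)
    (hI : Ico 0 T ⊆ I) : GoodChain (freeStrichartzConstant n) V k T := by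
  obtain ⟨J, hJ, -, hU, hs⟩ := h
  refine goodChain_of_cover (one_le_freeStrichartzConstant n) hC hJ (fun j => ?_) k Finset.univ T
    (by simp) hT ?_
  · filter_upwards [ae_le_eLpNormEssSup (f := fun t => eLpNorm (V t) ((n : ℝ≥0∞) / 2) volume)
      (μ := volume.restrict (J j))] with t ht
    rw [enorm_eq_self, ← eLpNorm_exponent_top] at ht
    exact ht.trans (hs j)
  · simpa [hU] using hI

/-! ### The weak form of the integral equation -/

theorem eq_of_pair_schL2_eq {f g : L2 n} (h : ∀ φ, pair n f (schL2 n φ) = pair n g (schL2 n φ)) :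
    f = g := by
  rw [← sub_eq_zero]
  refine (denseRange_schL2 n).eq_zero_of_inner_right ℂ fun ψ => ?_
  have e : inner ℂ (schL2 n ψ) (f - g) = pair n (f - g) (schL2 n (conjSchwartz ψ)) := by
    rw [L2.inner_def, pair_apply]
    refine integral_congr_ae ?_
    filter_upwards [coeFn_schL2 ψ, coeFn_schL2 (conjSchwartz ψ)] with x h1 h2
    rw [h1, h2, conjSchwartz_apply, RCLike.inner_apply]
  rw [e, map_sub, _root_.sub_apply, h, sub_self]

theorem enorm_pair_le {p q : ℝ≥0∞} (hpq : p.HolderConjugate q) (f g : L2 n) :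
    ‖pair n f g‖ₑ ≤ eLpNorm f p volume * eLpNorm g q volume := by
  rw [pair_apply]
  exact (enorm_integral_le_lintegral_enorm _).trans (lintegral_enorm_mul_le hpq
    (Lp.aestronglyMeasurable f) (Lp.aestronglyMeasurable g))

theorem tendsto_pair {p q : ℝ≥0∞} (hpq : p.HolderConjugate q) {f : Space n → ℂ}
    (hf : MemLp f p volume) {g : ℕ → L2 n} (h : L2 n) (hh : eLpNorm h q volume < ⊤)
    (hg : Tendsto (fun k => eLpNorm (fun x => f x - g k x) p volume) atTop (𝓝 0)) :
    Tendsto (fun k => pair n (g k) h) atTop (𝓝 (∫ x, f x * h x)) := by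
  rw [tendsto_iff_edist_tendsto_0]
  have h0 : Tendsto (fun k => eLpNorm (fun x => f x - g k x) p volume * eLpNorm h q volume) atTop
      (𝓝 0) := by
    simpa using ENNReal.Tendsto.mul_const hg (Or.inr hh.ne)
  refine tendsto_of_tendsto_of_tendsto_of_le_of_le tendsto_const_nhds h0 (fun _ => zero_le)
    fun k => ?_
  beta_reduce
  rw [edist_comm, edist_eq_enorm_sub, pair_apply, ← integral_sub
    (integrable_mul_of_holder hpq hf ⟨Lp.aestronglyMeasurable h, hh⟩)
    (integrable_mul_of_holder holderConjugate_two_two (Lp.memLp (g k)) (Lp.memLp h))]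
  refine (enorm_integral_le_lintegral_enorm _).trans ?_
  simp only [← sub_mul]
  exact lintegral_enorm_mul_le hpq (hf.1.sub (Lp.aestronglyMeasurable _)) (Lp.aestronglyMeasurable h)

theorem eLpNorm_clipMul_le (hn : 3 ≤ n) (M : ℝ≥0) {W : Space n → ℝ}
    (hW : AEStronglyMeasurable W volume) (f : L2 n) :
    eLpNorm (clipMul M W f) (sobExp n).conjExponent volume ≤
      eLpNorm W ((n : ℝ≥0∞) / 2) volume * eLpNorm f (sobExp n) volume := by
  have h := eLpNorm_clipMul_sub_le hn (zero_le : (0 : ℝ≥0) ≤ M) hW f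
  rw [tail_zero] at h
  have h0 : clipMul 0 W f = 0 := by
    have := norm_clipMul_le 0 W f
    simpa using this
  rwa [h0, sub_zero] at h

theorem memLp_potential_mul (hn : 3 ≤ n) {W : Space n → ℝ}
    (hW : MemLp W ((n : ℝ≥0∞) / 2) volume) {f : L2 n} (hf : eLpNorm f (sobExp n) volume < ⊤) :
    MemLp (fun x => (W x : ℂ) * f x) (sobExp n).conjExponent volume := by
  refine ⟨(Complex.continuous_ofReal.comp_aestronglyMeasurable hW.1).mul
    (Lp.aestronglyMeasurable f), ?_⟩
  exact (eLpNorm_mul_le hn hW.1 (Lp.aestronglyMeasurable f)).trans_lt (ENNReal.mul_lt_top hW.2 hf)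

theorem ae_eLpNorm_lt_top {I : Set ℝ} {q : ℝ≥0∞} {u : ℝ → L2 n}
    (hu : AEStronglyMeasurable u (volume.restrict I))
    (h : mixedNorm I 2 q (fun t => u t) < ⊤) :
    ∀ᵐ t ∂volume.restrict I, eLpNorm (u t) q volume < ⊤ := by
  have hIntg := lintegral_rpow_enorm_lt_top_of_eLpNorm_lt_top (by norm_num) (by norm_num) h
  simp only [enorm_eq_self] at hIntg
  filter_upwards [ae_lt_top' ((aemeasurable_eLpNorm hu q).pow_const _) hIntg.ne] with t ht
  exact (ENNReal.rpow_lt_top_iff_of_pos (by norm_num)).1 ht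

theorem holderConjugate_conjExponent_left {q : ℝ≥0∞} (hq : 2 ≤ q) :
    q.conjExponent.HolderConjugate q :=
  (holderConjugate_of_two_le hq).symm

theorem tendsto_integral_pair (hn : 3 ≤ n) {T : ℝ} {V : ℝ → Space n → ℝ}
    (hV : ContinuousInLp (Icc 0 T) ((n : ℝ≥0∞) / 2) V) {p q : ℝ≥0∞} (hpq : Admissible n p q)
    {F : ℝ → Space n → ℂ} {G : ℕ → ℝ → L2 n} (hG : SourceApprox (Icc 0 T) q.conjExponent F G)
    (hF : mixedNorm (Icc 0 T) p.conjExponent q.conjExponent F < ⊤) {u : ℝ → L2 n}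
    (hu : ContinuousOn u (Icc 0 T))
    (hfin : mixedNorm (Icc 0 T) 2 (sobExp n) (fun t => u t) < ⊤) (φ : 𝓢(Space n, ℂ)) {t : ℝ}
    (ht : t ∈ Icc 0 T) :
    Tendsto (fun k : ℕ => ∫ s in (0 : ℝ)..t,
      pair n (G k s - clipMul k (V s) (u s)) (freeGroup n (t - s) (schL2 n φ))) atTop
      (𝓝 (∫ s in (0 : ℝ)..t,
        ∫ x, (F s x - (V s x : ℂ) * u s x) * freeGroup n (t - s) (schL2 n φ) x)) := by
  have hE := isometricGroup_freeGroup n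
  obtain ⟨A, hA⟩ := exists_eLpNorm_le hn hV
  obtain ⟨K₁, hK₁⟩ := exists_eLpNorm_freeGroup_schL2_le φ hpq.2.1
  obtain ⟨K₂, hK₂⟩ := exists_eLpNorm_freeGroup_schL2_le φ (two_le_sobExp hn)
  have hsub : Ioc 0 t ⊆ Icc 0 T := fun s hs => ⟨hs.1.le, hs.2.trans ht.2⟩
  have hm := Measure.restrict_mono_set (volume : Measure ℝ) hsub
  have hum : AEStronglyMeasurable u (volume.restrict (Icc 0 T)) :=
    hu.aestronglyMeasurable measurableSet_Icc
  set b : ℝ → ℝ≥0∞ := fun s => eLpNorm (F s) q.conjExponent volume * K₁ +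
    A * eLpNorm (u s) (sobExp n) volume * K₂ with hb
  have hbm : AEMeasurable b (volume.restrict (Icc 0 T)) :=
    (hG.aemeasurable.mul_const _).add (((aemeasurable_eLpNorm hum _).const_mul _).mul_const _)
  have hbi : ∫⁻ s in Icc 0 T, b s ≠ ⊤ := by
    rw [lintegral_add_left' (hG.aemeasurable.mul_const _), lintegral_mul_const' _ _ (by finiteness),
      lintegral_mul_const' _ _ (by finiteness), lintegral_const_mul' _ _ (by finiteness)]
    have h1 := (mixedNorm_one_le (a := 0) (b := T) p.conjExponent q.conjExponent
      (one_le_conjExponent p) hG.aemeasurable).trans_lt (ENNReal.mul_lt_top hF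
        (ENNReal.rpow_lt_top_of_nonneg ?_ ENNReal.ofReal_ne_top))
    · have h2 := (mixedNorm_one_le (a := 0) (b := T) 2 (sobExp n) (by norm_num)
        (aemeasurable_eLpNorm hum _)).trans_lt (ENNReal.mul_lt_top hfin
          (ENNReal.rpow_lt_top_of_nonneg (by norm_num) ENNReal.ofReal_ne_top))
      finiteness
    · have h1 := ENNReal.toReal_mono (conjExponent_ne_top hpq.1) (one_le_conjExponent p)
      rw [ENNReal.toReal_one] at h1
      exact sub_nonneg.2 ((div_le_one (by linarith)).2 h1)
  rw [intervalIntegral.integral_of_le ht.1]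
  simp only [intervalIntegral.integral_of_le ht.1]
  have hclm : ∀ K : ℝ≥0, AEStronglyMeasurable (fun s => clipMul K (V s) (u s))
      (volume.restrict (Icc 0 T)) := fun K =>
    (continuousOn_clipMul_comp hn hV K hu).aestronglyMeasurable measurableSet_Icc
  have hEc : Continuous fun s => freeGroup n (t - s) (schL2 n φ) :=
    (continuous_freeGroup_apply _).comp (continuous_const.sub continuous_id)
  refine tendsto_integral_of_dominated_convergence (fun s => (b s).toReal) (fun k => ?_) ?_
    (fun k => ?_) ?_
  · have h1 := (((hG.aestronglyMeasurable k).sub (hclm k)).mono_measure hm)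
    exact (pair n).aestronglyMeasurable_comp₂ h1 hEc.aestronglyMeasurable
  · exact integrable_toReal_of_lintegral_ne_top (hbm.mono_measure hm)
      ((lintegral_mono' hm le_rfl).trans_lt hbi.lt_top).ne
  · filter_upwards [ae_mono hm hG.le, ae_restrict_mem measurableSet_Ioc,
      ae_mono hm (ae_lt_top' hbm hbi)] with s hs hst hbs
    rw [← toReal_enorm]
    refine ENNReal.toReal_mono hbs.ne ?_
    rw [map_sub, _root_.sub_apply]
    refine (enorm_sub_le).trans (add_le_add ?_ ?_)
    · refine (enorm_pair_le (holderConjugate_conjExponent_left hpq.2.1) _ _).trans ?_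
      gcongr
      · exact hs k
      · exact hK₁ _
    · refine (enorm_pair_le (holderConjugate_conjExponent_left (two_le_sobExp hn)) _ _).trans ?_
      gcongr
      · refine (eLpNorm_clipMul_le hn _ (hV s (hsub hst)).1.1 _).trans ?_
        gcongr
        exact hA s (hsub hst)
      · exact hK₂ _
  · filter_upwards [ae_mono hm hG.memLp, ae_mono hm hG.tendsto, ae_restrict_mem measurableSet_Ioc,
      ae_mono hm (ae_eLpNorm_lt_top hum hfin)] with s hs1 hs2 hst hus
    have hVs := (hV s (hsub hst)).1
    set h := freeGroup n (t - s) (schL2 n φ)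
    have hh1 : eLpNorm h q volume < ⊤ := (hK₁ _).trans_lt ENNReal.coe_lt_top
    have hh2 : eLpNorm h (sobExp n) volume < ⊤ := (hK₂ _).trans_lt ENNReal.coe_lt_top
    have hVu := memLp_potential_mul hn hVs hus
    have hc1 := holderConjugate_conjExponent_left hpq.2.1
    have hc2 := holderConjugate_conjExponent_left (two_le_sobExp hn)
    have e : ∫ x, (F s x - (V s x : ℂ) * u s x) * h x =
        (∫ x, F s x * h x) - ∫ x, (V s x : ℂ) * u s x * h x := by
      rw [← integral_sub (integrable_mul_of_holder hc1 hs1 ⟨Lp.aestronglyMeasurable h, hh1⟩)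
        (integrable_mul_of_holder hc2 hVu ⟨Lp.aestronglyMeasurable h, hh2⟩)]
      simp only [sub_mul]
    rw [e]
    simp only [map_sub, _root_.sub_apply]
    refine (tendsto_pair hc1 hs1 h hh1 hs2).sub (tendsto_pair hc2 hVu h hh2 ?_)
    have h0 : Tendsto (fun k : ℕ => tail k (V s) * eLpNorm (u s) (sobExp n) volume) atTop (𝓝 0) := by
      simpa using ENNReal.Tendsto.mul_const (tendsto_tail hn hVs) (Or.inr hus.ne)
    exact tendsto_of_tendsto_of_tendsto_of_le_of_le tendsto_const_nhds h0 (fun _ => zero_le)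
      fun k => eLpNorm_sub_clipMul_le hn k hVs.1 (u s)

theorem pair_duhamel_freeGroup {H : ℝ → L2 n} {T t : ℝ} (hH : IntegrableOn H (Icc 0 T))
    (ht : t ∈ Icc 0 T) (ψ : L2 n) :
    pair n (duhamel (freeGroup n) H t) ψ =
      ∫ s in (0 : ℝ)..t, pair n (H s) (freeGroup n (t - s) ψ) := by
  have hi := (isometricGroup_freeGroup n).intervalIntegrable_comp (g := fun s => t - s)
    (continuous_const.sub continuous_id) (intervalIntegrable_of_integrableOn hH ht)
  have h1 := ((pair n).flip ψ).intervalIntegral_comp_comm hi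
  simp only [ContinuousLinearMap.flip_apply] at h1
  rw [duhamel, ← h1]
  simp only [pair_freeGroup]

theorem pair_approximation {T t : ℝ} {u₀ : L2 n} {G H : ℝ → L2 n} (hG : IntegrableOn G (Icc 0 T))
    (hH : IntegrableOn H (Icc 0 T)) (ht : t ∈ Icc 0 T) (ψ : L2 n) :
    pair n (freeGroup n t u₀ + duhamel (freeGroup n) (fun s => Complex.I • G s) t +
      (-Complex.I) • duhamel (freeGroup n) H t) ψ =
    pair n u₀ (freeGroup n t ψ) +
      Complex.I * ∫ s in (0 : ℝ)..t, pair n (G s - H s) (freeGroup n (t - s) ψ) := by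
  rw [← pair_duhamel_freeGroup (H := fun s => G s - H s) (hG.sub hH) ht,
    duhamel_sub (isometricGroup_freeGroup n) hG hH ht, duhamel_smul]
  simp only [map_add, map_smul, map_sub, _root_.add_apply, _root_.smul_apply, _root_.sub_apply,
    smul_eq_mul, pair_freeGroup]
  ring

theorem mixedNorm_clipMul_sub_le (hn : 3 ≤ n) {T : ℝ} {V : ℝ → Space n → ℝ}
    (hV : ContinuousInLp (Icc 0 T) ((n : ℝ≥0∞) / 2) V) {k m : ℕ} (hkm : k ≤ m) (u : ℝ → L2 n) :
    mixedNorm (Icc 0 T) 2 (sobExp n).conjExponent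
      (fun s => ⇑(clipMul m (V s) (u s) - clipMul k (V s) (u s))) ≤
      supTail T V k * mixedNorm (Icc 0 T) 2 (sobExp n) (fun t => u t) := by
  have hfin := supTail_ne_top hn hV k
  rw [← ENNReal.coe_toNNReal hfin]
  refine mixedNorm_mul_le ?_
  filter_upwards [ae_restrict_mem measurableSet_Icc] with s hs
  rw [ENNReal.coe_toNNReal hfin]
  refine (eLpNorm_clipMul_sub_le hn (by exact_mod_cast hkm) (hV s hs).1.1 _).trans ?_
  gcongr
  exact tail_le_supTail V k hs

theorem integrableOn_clipMul_comp (hn : 3 ≤ n) {T : ℝ} {V : ℝ → Space n → ℝ}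
    (hV : ContinuousInLp (Icc 0 T) ((n : ℝ≥0∞) / 2) V) {u : ℝ → L2 n}
    (hu : ContinuousOn u (Icc 0 T)) (M : ℝ≥0) :
    IntegrableOn (fun s => clipMul M (V s) (u s)) (Icc 0 T) :=
  (continuousOn_clipMul_comp hn hV M hu).integrableOn_compact isCompact_Icc

theorem IsMildSolution.limitSolution (hn : 3 ≤ n) {T : ℝ} (hT : 0 < T) {C : ℝ≥0∞} (hCt : C ≠ ⊤)
    (hC : StrichartzOn (freeGroup n) T C) {V : ℝ → Space n → ℝ}
    (hV : ContinuousInLp (Icc 0 T) ((n : ℝ≥0∞) / 2) V) {p q : ℝ≥0∞} (hpq : Admissible n p q)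
    {F : ℝ → Space n → ℂ} {G : ℕ → ℝ → L2 n} (hG : SourceApprox (Icc 0 T) q.conjExponent F G)
    (hF : mixedNorm (Icc 0 T) p.conjExponent q.conjExponent F < ⊤) {u₀ : L2 n} {u : ℝ → L2 n}
    (hu : IsMildSolution (Icc 0 T) V u₀ F u) :
    LimitSolution T V u₀ (fun k s => Complex.I • G k s) u := by
  have hE := isometricGroup_freeGroup n
  have hfin := hu.finite T ⟨hT.le, le_rfl⟩
  have hGi := hG.integrableOn (T := T) subset_rfl
  have hci := integrableOn_clipMul_comp hn hV hu.continuousOn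
  refine ⟨hu.continuousOn, hfin, fun t ht => ?_⟩
  set y : ℕ → L2 n := fun k => freeGroup n t u₀ +
    duhamel (freeGroup n) (fun s => Complex.I • G k s) t +
    (-Complex.I) • duhamel (freeGroup n) (fun s => clipMul k (V s) (u s)) t with hy
  set e : ℕ → ℝ≥0∞ := fun k => C * mixedNorm (Icc 0 T) p.conjExponent q.conjExponent
      (fun t x => F t x - G k t x) +
    C * (supTail T V k * mixedNorm (Icc 0 T) 2 (sobExp n) (fun t => u t))
  have he : Tendsto e atTop (𝓝 0) := by
    have h1 := ENNReal.Tendsto.const_mul (hG.tendsto_mixedNorm (conjExponent_ne_zero p)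
      (conjExponent_ne_top hpq.1) hF) (Or.inr hCt)
    have h2 := ENNReal.Tendsto.const_mul (ENNReal.Tendsto.mul_const (tendsto_supTail hn hV)
      (Or.inr hfin.ne)) (Or.inr hCt)
    simpa using h1.add h2
  have hcau : CauchySeq y := by
    refine cauchySeq_of_enorm_sub_le (fun k m hkm => ?_) he
    have hi1 : IntegrableOn (fun s => G k s - G m s) (Icc 0 T) := (hGi k).sub (hGi m)
    have hi2 : IntegrableOn (fun s => clipMul m (V s) (u s) - clipMul k (V s) (u s)) (Icc 0 T) :=
      (hci m).sub (hci k)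
    have e1 : y k - y m = Complex.I • duhamel (freeGroup n) (fun s => G k s - G m s) t +
        Complex.I • duhamel (freeGroup n)
          (fun s => clipMul m (V s) (u s) - clipMul k (V s) (u s)) t := by
      rw [duhamel_sub hE (hGi k) (hGi m) ht, duhamel_sub hE (hci m) (hci k) ht]
      simp only [hy, duhamel_smul, smul_sub, neg_smul]
      abel
    have hI : ‖Complex.I‖ₑ = 1 := by rw [← ofReal_norm, Complex.norm_I, ENNReal.ofReal_one]
    rw [e1]
    refine (enorm_add_le _ _).trans (add_le_add ?_ ?_)
    · rw [enorm_smul, hI, one_mul]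
      refine (enorm_le_mixedNorm_top hT (hE.continuousOn_duhamel hi1) ht).trans ?_
      refine (hC.inhomogeneous (admissible_top_two n) hpq hi1).trans ?_
      gcongr
      exact hG.mixedNorm_sub_le _ hkm
    · rw [enorm_smul, hI, one_mul]
      refine (enorm_le_mixedNorm_top hT (hE.continuousOn_duhamel hi2) ht).trans ?_
      refine (hC.inhomogeneous (admissible_top_two n) (admissible_two_sobExp hn) hi2).trans ?_
      gcongr
      rw [conjExponent_two]
      exact mixedNorm_clipMul_sub_le hn hV hkm u
  obtain ⟨g, hg⟩ := cauchySeq_tendsto_of_complete hcau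
  suffices g = u t by rwa [this] at hg
  refine eq_of_pair_schL2_eq fun φ => ?_
  have h1 : Tendsto (fun k => pair n (y k) (schL2 n φ)) atTop (𝓝 (pair n g (schL2 n φ))) :=
    (((pair n).flip (schL2 n φ)).continuous.tendsto g).comp hg
  refine tendsto_nhds_unique h1 ?_
  have h2 := ((tendsto_integral_pair hn hV hpq hG hF hu.continuousOn hfin φ ht).const_mul
    Complex.I).const_add (pair n u₀ (freeGroup n t (schL2 n φ)))
  have h3 : pair n (u t) (schL2 n φ) = pair n u₀ (freeGroup n t (schL2 n φ)) + Complex.I *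
      ∫ s in (0 : ℝ)..t, ∫ x, (F s x - (V s x : ℂ) * u s x) *
        freeGroup n (t - s) (schL2 n φ) x := by
    rw [pair_apply, pair_apply]
    refine Eq.trans (integral_congr_ae ?_) (hu.integral_eq t ht φ)
    filter_upwards [coeFn_schL2 φ] with x hx
    rw [hx]
  rw [h3]
  exact h2.congr fun k => (pair_approximation (hGi k) (hci k) ht _).symm

/-! ### Bounded potentials -/

/-- The iterates of the Volterra operator `w ↦ -i ∫₀ᵗ e^{i(t-s)Δ} V_M(s) w(s) ds`, where `V_M` is the
truncated potential. -/
def volterraIter (M : ℝ≥0) (V : ℝ → Space n → ℝ) (h : ℝ → L2 n) : ℕ → ℝ → L2 n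
  | 0 => h
  | m + 1 => fun t =>
    (-Complex.I) • duhamel (freeGroup n) (fun s => clipMul M (V s) (volterraIter M V h m s)) t

theorem continuousOn_volterraIter (hn : 3 ≤ n) {T : ℝ} {V : ℝ → Space n → ℝ}
    (hV : ContinuousInLp (Icc 0 T) ((n : ℝ≥0∞) / 2) V) (M : ℝ≥0) {h : ℝ → L2 n}
    (hh : ContinuousOn h (Icc 0 T)) (m : ℕ) :
    ContinuousOn (volterraIter M V h m) (Icc 0 T) := by
  induction m with
  | zero => exact hh
  | succ m ih =>
    have := (isometricGroup_freeGroup n).continuousOn_duhamel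
      (integrableOn_clipMul_comp hn hV ih M)
    exact this.const_smul (-Complex.I)

theorem norm_volterraIter_le {T : ℝ} {V : ℝ → Space n → ℝ} (M : ℝ≥0) {h : ℝ → L2 n} {H : ℝ}
    (hH : ∀ t ∈ Icc 0 T, ‖h t‖ ≤ H) (m : ℕ) : ∀ t ∈ Icc 0 T,
      ‖volterraIter M V h m t‖ ≤ H * ((M * t) ^ m / m.factorial) := by
  induction m with
  | zero => simpa [volterraIter] using hH
  | succ m ih =>
    intro t ht
    have hb : ∀ᵐ s, s ∈ Ioc 0 t → ‖freeGroup n (t - s) (clipMul M (V s)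
        (volterraIter M V h m s))‖ ≤ M * (H * ((M * s) ^ m / m.factorial)) := by
      refine ae_of_all _ fun s hs => ?_
      rw [norm_freeGroup]
      refine (norm_clipMul_le _ _ _).trans ?_
      gcongr
      exact ih s ⟨hs.1.le, hs.2.trans ht.2⟩
    have h1 := intervalIntegral.norm_integral_le_of_norm_le ht.1 hb
      (Continuous.intervalIntegrable (by fun_prop) _ _)
    rw [volterraIter, norm_smul, norm_neg, Complex.norm_I, one_mul]
    refine h1.trans_eq ?_
    have e : ∀ s : ℝ, (M : ℝ) * (H * ((M * s) ^ m / m.factorial)) =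
        (M ^ (m + 1) * H / m.factorial) * s ^ m := fun s => by
      rw [mul_pow]
      ring
    simp only [e]
    rw [intervalIntegral.integral_const_mul, integral_pow, Nat.factorial_succ, zero_pow (by simp)]
    push_cast
    field_simp
    ring

theorem exists_volterra (hn : 3 ≤ n) {T : ℝ} (hT : 0 ≤ T) {V : ℝ → Space n → ℝ}
    (hV : ContinuousInLp (Icc 0 T) ((n : ℝ≥0∞) / 2) V) (M : ℝ≥0) {h : ℝ → L2 n}
    (hh : ContinuousOn h (Icc 0 T)) :
    ∃ u : ℝ → L2 n, ContinuousOn u (Icc 0 T) ∧ ∀ t ∈ Icc 0 T,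
      u t = h t + (-Complex.I) • duhamel (freeGroup n) (fun s => clipMul M (V s) (u s)) t := by
  obtain ⟨H, hH⟩ := isCompact_Icc.exists_bound_of_continuousOn hh
  have hH0 : 0 ≤ H := (norm_nonneg _).trans (hH 0 ⟨le_rfl, hT⟩)
  set w := volterraIter M V h with hw
  set b : ℕ → ℝ := fun m => H * ((M * T) ^ m / m.factorial) with hb
  have hbs : Summable b := (Real.summable_pow_div_factorial _).mul_left H
  have hwb : ∀ m, ∀ t ∈ Icc 0 T, ‖w m t‖ ≤ b m := fun m t ht => by
    refine (norm_volterraIter_le M hH m t ht).trans ?_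
    have := ht.1
    have := ht.2
    simp only [hb]
    gcongr
  have hwc := continuousOn_volterraIter hn hV M hh
  refine ⟨fun t => ∑' m, w m t, continuousOn_tsum hwc hbs hwb, fun t ht => ?_⟩
  have hs : ∀ s ∈ Icc 0 T, HasSum (fun m => w m s) (∑' m, w m s) := fun s hs =>
    (Summable.of_norm_bounded hbs fun m => hwb m s hs).hasSum
  have hsub : ∀ s ∈ uIoc 0 t, s ∈ Icc 0 T := fun s hs => by
    rw [uIoc_of_le ht.1] at hs
    exact ⟨hs.1.le, hs.2.trans ht.2⟩
  have hD : HasSum (fun m => duhamel (freeGroup n) (fun s => clipMul M (V s) (w m s)) t)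
      (duhamel (freeGroup n) (fun s => clipMul M (V s) (∑' m, w m s)) t) := by
    refine intervalIntegral.hasSum_integral_of_dominated_convergence (fun m _ => M * b m)
      (fun m => ?_) (fun m => ae_of_all _ fun s hs' => ?_) (ae_of_all _ fun s _ => hbs.mul_left _)
      (by simp) (ae_of_all _ fun s hs' => ?_)
    · rw [uIoc_of_le ht.1]
      refine ((isometricGroup_freeGroup n).aestronglyMeasurable_comp (g := fun s => t - s)
        (continuous_const.sub continuous_id).aestronglyMeasurable
        (integrableOn_clipMul_comp hn hV (hwc m) M).1).mono_measure
        (Measure.restrict_mono_set _ fun s hs => ⟨hs.1.le, hs.2.trans ht.2⟩)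
    · rw [norm_freeGroup]
      refine (norm_clipMul_le _ _ _).trans ?_
      gcongr
      exact hwb m s (hsub s hs')
    · exact ((hs s (hsub s hs')).mapL (clipMul M (V s))).mapL (freeGroup n (t - s))
  have h1 := hD.const_smul (-Complex.I)
  have h2 : HasSum (fun m => w (m + 1) t) ((∑' m, w m t) - w 0 t) := by
    have := (hasSum_nat_add_iff' (f := fun m => w m t) 1).2 (hs t ht)
    simpa using this
  have h3 := h2.unique h1
  rw [← h3]
  simp [hw, volterraIter]

theorem norm_eq_of_volterra (hn : 3 ≤ n) {T : ℝ} {V : ℝ → Space n → ℝ}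
    (hV : ContinuousInLp (Icc 0 T) ((n : ℝ≥0∞) / 2) V) (M : ℝ≥0) {u₀ : L2 n} {u : ℝ → L2 n}
    (hu : ContinuousOn u (Icc 0 T)) (he : ∀ t ∈ Icc 0 T, u t = freeGroup n t u₀ +
      (-Complex.I) • duhamel (freeGroup n) (fun s => clipMul M (V s) (u s)) t) {t : ℝ}
    (ht : t ∈ Icc 0 T) : ‖u t‖ = ‖u₀‖ := by
  have hE := isometricGroup_freeGroup n
  set f : ℝ → L2 n := fun s => freeGroup n (-s) (clipMul M (V s) (u s)) with hf
  have hfc : ContinuousOn f (Icc 0 T) :=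
    hE.continuousOn_comp continuous_neg.continuousOn (continuousOn_clipMul_comp hn hV M hu)
  have hfi : IntegrableOn f (Icc 0 T) := hfc.integrableOn_compact isCompact_Icc
  set v : ℝ → L2 n := fun t => u₀ + (-Complex.I) • ∫ s in (0 : ℝ)..t, f s with hv
  have huv : ∀ t ∈ Icc 0 T, v t = freeGroup n (-t) (u t) := by
    intro t ht
    rw [he t ht, hE.duhamel_eq (intervalIntegrable_of_integrableOn
      (integrableOn_clipMul_comp hn hV hu M) ht), map_add, map_smul, freeGroup_neg_self,
      freeGroup_neg_self]
  have hvc : ContinuousOn v (Icc 0 T) := by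
    refine ContinuousOn.congr ?_ huv
    exact hE.continuousOn_comp continuous_neg.continuousOn hu
  have hder : ∀ x ∈ Ico 0 T, HasDerivWithinAt v ((-Complex.I) • f x) (Ici x) x := by
    intro x hx
    have hmem : Icc 0 T ∈ 𝓝[>] x := mem_of_superset (Ioo_mem_nhdsGT hx.2)
      fun y hy => ⟨hx.1.trans hy.1.le, hy.2.le⟩
    have h1 : HasDerivWithinAt (fun t => ∫ s in (0 : ℝ)..t, f s) (f x) (Ici x) x := by
      refine intervalIntegral.integral_hasDerivWithinAt_right (t := Ioi x)
        (intervalIntegrable_of_integrableOn hfi ⟨hx.1, hx.2.le⟩)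
        ⟨_, hmem, hfi.1⟩ ?_
      exact (hfc x ⟨hx.1, hx.2.le⟩).mono_of_mem_nhdsWithin hmem
    exact (h1.const_smul (-Complex.I)).const_add u₀
  have hconst := constant_of_has_deriv_right_zero (f := fun t => inner ℂ (v t) (v t))
    (hvc.inner hvc) fun x hx => ?_
  · have h2 := hconst t ht
    have h0 : v 0 = u₀ := by simp [hv]
    simp only [h0, inner_self_eq_norm_sq_to_K] at h2
    have h3 : ‖v t‖ = ‖u₀‖ := by
      have : ‖v t‖ ^ 2 = ‖u₀‖ ^ 2 := by exact_mod_cast h2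
      exact (pow_left_inj₀ (norm_nonneg _) (norm_nonneg _) (by norm_num)).1 this
    rwa [huv t ht, norm_freeGroup] at h3
  · have h1 := (hder x hx).inner ℂ (hder x hx)
    have hx' : x ∈ Icc 0 T := ⟨hx.1, hx.2.le⟩
    refine h1.congr_deriv ?_
    rw [huv x hx', inner_smul_right, inner_smul_left, hf]
    beta_reduce
    rw [inner_freeGroup_left, inner_freeGroup_left, neg_neg, freeGroup_self_neg, freeGroup_self_neg,
      inner_clipMul]
    simp

/-! ### Solutions as limits of the equations with truncated potentials -/

theorem abs_clip_sub_clip_clip_le (K M : ℝ≥0) (v : ℝ) :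
    |clip K v - clip M (clip K v)| ≤ |v - clip M v| := by
  have := M.coe_nonneg
  have := K.coe_nonneg
  have h1 := clip_cases K v
  have h2 := clip_cases M v
  have h3 := clip_cases M (clip K v)
  grind

theorem abs_clip_sub_le (K : ℝ≥0) (v w : ℝ) : |clip K v - clip K w| ≤ |v - w| := by
  have := K.coe_nonneg
  have h1 := clip_cases K v
  have h2 := clip_cases K w
  grind

theorem tail_clip_le (K M : ℝ≥0) (W : Space n → ℝ) : tail M (fun x => clip K (W x)) ≤ tail M W :=
  eLpNorm_mono fun x => abs_clip_sub_clip_clip_le K M (W x)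

theorem clip_abs_le_abs (K : ℝ≥0) (v : ℝ) : |clip K v| ≤ |v| := by
  have := K.coe_nonneg
  have h1 := clip_cases K v
  grind

theorem ContinuousInLp.clip {I : Set ℝ} {r : ℝ≥0∞} {V : ℝ → Space n → ℝ}
    (hV : ContinuousInLp I r V) (K : ℝ≥0) : ContinuousInLp I r (fun t x => clip K (V t x)) := by
  intro t ht
  refine ⟨(hV t ht).1.mono ((continuous_clip K).comp_aestronglyMeasurable (hV t ht).1.1)
    (ae_of_all _ fun x => clip_abs_le_abs K _), ?_⟩
  exact tendsto_of_tendsto_of_tendsto_of_le_of_le tendsto_const_nhds (hV t ht).2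
    (fun _ => zero_le) fun s => eLpNorm_mono fun x => abs_clip_sub_le K _ _

theorem clipMul_clip {K M : ℝ≥0} (h : K ≤ M) {W : Space n → ℝ}
    (hW : AEStronglyMeasurable W volume) (f : L2 n) :
    clipMul M (fun x => clip K (W x)) f = clipMul K W f := by
  refine Lp.ext ?_
  filter_upwards [coeFn_clipMul M ((continuous_clip K).comp_aestronglyMeasurable hW) f,
    coeFn_clipMul K hW f] with x h1 h2
  rw [h1, h2, clip_of_abs_le ((abs_clip_le K _).trans (by exact_mod_cast h))]

theorem integrableOn_smul {G : ℝ → L2 n} {S : Set ℝ} (hG : IntegrableOn G S) (c : ℂ) :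
    IntegrableOn (fun s => c • G s) S :=
  hG.fun_smul c

/-- Solutions of the equation with the potential truncated at level `k`. -/
structure TruncatedSolution (T : ℝ) (V : ℝ → Space n → ℝ) (k : ℕ) (u₀ : L2 n) (G : ℝ → L2 n)
    (u : ℝ → L2 n) : Prop where
  continuousOn : ContinuousOn u (Icc 0 T)
  eq : ∀ t ∈ Icc 0 T, u t = freeGroup n t u₀ + duhamel (freeGroup n) G t +
    (-Complex.I) • duhamel (freeGroup n) (fun s => clipMul k (V s) (u s)) t

namespace TruncatedSolution
variable {T : ℝ} {V : ℝ → Space n → ℝ} {k m : ℕ} {u₀ : L2 n} {G G' : ℝ → L2 n} {u v : ℝ → L2 n}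
  {C : ℝ≥0∞}

theorem limitSolution (hn : 3 ≤ n) (hCt : C ≠ ⊤) (hC : StrichartzOn (freeGroup n) T C)
    (hV : ContinuousInLp (Icc 0 T) ((n : ℝ≥0∞) / 2) V) (hG : IntegrableOn G (Icc 0 T))
    (h : TruncatedSolution T V k u₀ G u) :
    LimitSolution T (fun t x => clip k (V t x)) u₀ (fun _ => G) u := by
  have hE := isometricGroup_freeGroup n
  have hcl := integrableOn_clipMul_comp hn hV h.continuousOn k
  refine ⟨h.continuousOn, ?_, fun t ht => ?_⟩
  · have hi : IntegrableOn (fun s => G s + (-Complex.I) • clipMul k (V s) (u s)) (Icc 0 T) :=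
      hG.add (integrableOn_smul hcl _)
    have e : mixedNorm (Icc 0 T) 2 (sobExp n) (fun t => u t) =
        mixedNorm (Icc 0 T) 2 (sobExp n) (fun t => ⇑(freeGroup n t u₀ +
          duhamel (freeGroup n) (fun s => G s + (-Complex.I) • clipMul k (V s) (u s)) t)) := by
      refine mixedNorm_congr_ae ?_
      filter_upwards [ae_restrict_mem measurableSet_Icc] with t ht
      rw [duhamel_add hE hG (integrableOn_smul hcl _) ht, duhamel_smul, ← add_assoc, ← h.eq t ht]
    rw [e]
    refine (hC _ _ _ _ (admissible_two_sobExp hn) (admissible_top_two n) u₀ _ hi).trans_lt ?_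
    rw [conjExponent_top, conjExponent_two, mixedNorm_one_two]
    exact ENNReal.add_lt_top.2 ⟨ENNReal.mul_lt_top hCt.lt_top enorm_lt_top,
      ENNReal.mul_lt_top hCt.lt_top hi.2⟩
  · refine tendsto_const_nhds.congr' ?_
    filter_upwards [eventually_ge_atTop k] with j hj
    refine (h.eq t ht).trans ?_
    congr 2
    refine duhamel_congr _ ht.1 ?_
    filter_upwards [ae_restrict_mem measurableSet_Icc] with s hs
    exact (clipMul_clip (by exact_mod_cast hj) (hV s ⟨hs.1, hs.2.trans ht.2⟩).1.1 _).symm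

theorem mixedNorm_le (hn : 3 ≤ n) (hC1 : 1 ≤ C) (hCt : C ≠ ⊤)
    (hC : ∀ T, StrichartzOn (freeGroup n) T C)
    (hV : ContinuousInLp (Icc 0 T) ((n : ℝ≥0∞) / 2) V) (hG : IntegrableOn G (Icc 0 T))
    {B : ℝ≥0∞} (hB : SourceBound T C G B) (h : TruncatedSolution T V k u₀ G u) {N : ℕ}
    (hN : GoodChain C V N T) {p q : ℝ≥0∞} (hpq : Admissible n p q) :
    mixedNorm (Icc 0 T) p q (fun t => u t) ≤ N * (1 + 2 * C) ^ N * (‖u₀‖ₑ + B) :=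
  ((h.limitSolution hn hCt (hC T) hV hG).mixedNorm_le_of_goodChain hn hC1 hC (hV.clip k)
    (fun _ => hG) (fun _ => hB) (hN.mono fun M t => tail_clip_le k M (V t)) le_rfl).1 p q hpq

theorem sub (hn : 3 ≤ n) (hV : ContinuousInLp (Icc 0 T) ((n : ℝ≥0∞) / 2) V)
    (hG : IntegrableOn G (Icc 0 T)) (hG' : IntegrableOn G' (Icc 0 T))
    (h : TruncatedSolution T V k u₀ G u) (h' : TruncatedSolution T V m u₀ G' v) :
    TruncatedSolution T V k 0 (fun s => (G s - G' s) +
      Complex.I • (clipMul m (V s) (v s) - clipMul k (V s) (v s))) (fun s => u s - v s) := by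
  have hE := isometricGroup_freeGroup n
  have hu := integrableOn_clipMul_comp hn hV h.continuousOn k
  have hv := integrableOn_clipMul_comp hn hV h'.continuousOn k
  have hvm := integrableOn_clipMul_comp hn hV h'.continuousOn m
  have hi : IntegrableOn (fun s => Complex.I • (clipMul m (V s) (v s) - clipMul k (V s) (v s)))
    (Icc 0 T) := integrableOn_smul (hvm.sub hv) _
  refine ⟨h.continuousOn.sub h'.continuousOn, fun t ht => ?_⟩
  rw [duhamel_add (F := fun s => G s - G' s) hE (hG.sub hG') hi ht, duhamel_sub hE hG hG' ht, duhamel_smul,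
    duhamel_sub hE hvm hv ht]
  simp only [map_sub]
  rw [duhamel_sub hE hu hv ht, h.eq t ht, h'.eq t ht, map_zero]
  module

end TruncatedSolution

theorem mixedNorm_clipMul_le (hn : 3 ≤ n) {T : ℝ} {V : ℝ → Space n → ℝ}
    (hV : ContinuousInLp (Icc 0 T) ((n : ℝ≥0∞) / 2) V) {A : ℝ≥0}
    (hA : ∀ t ∈ Icc 0 T, eLpNorm (V t) ((n : ℝ≥0∞) / 2) volume ≤ A) (M : ℝ≥0) (u : ℝ → L2 n) :
    mixedNorm (Icc 0 T) 2 (sobExp n).conjExponent (fun s => clipMul M (V s) (u s)) ≤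
      A * mixedNorm (Icc 0 T) 2 (sobExp n) (fun t => u t) := by
  refine mixedNorm_mul_le ?_
  filter_upwards [ae_restrict_mem measurableSet_Icc] with s hs
  refine (eLpNorm_clipMul_le hn M (hV s hs).1.1 _).trans ?_
  gcongr
  exact hA s hs

/-- The solutions of the truncated equations converge, uniformly in `L²`. -/
theorem exists_limitSolution (hn : 3 ≤ n) {T : ℝ} (hT : 0 < T) {C : ℝ≥0∞} (hC1 : 1 ≤ C)
    (hCt : C ≠ ⊤) (hC : ∀ T, StrichartzOn (freeGroup n) T C) {V : ℝ → Space n → ℝ}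
    (hV : ContinuousInLp (Icc 0 T) ((n : ℝ≥0∞) / 2) V) (u₀ : L2 n) {G : ℕ → ℝ → L2 n}
    (hG : ∀ k, IntegrableOn (G k) (Icc 0 T)) {B : ℝ≥0∞} (hBt : B ≠ ⊤)
    (hB : ∀ k, SourceBound T C (G k) B) {e : ℕ → ℝ≥0∞} (he : Tendsto e atTop (𝓝 0))
    (hGe : ∀ k m, k ≤ m → SourceBound T C (fun s => G k s - G m s) (e k)) :
    ∃ (u : ℝ → L2 n) (v : ℕ → ℝ → L2 n), LimitSolution T V u₀ G u ∧
      (∀ k, TruncatedSolution T V k u₀ (G k) (v k)) ∧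
      ∀ t ∈ Icc 0 T, Tendsto (fun k => v k t) atTop (𝓝 (u t)) := by
  have hE := isometricGroup_freeGroup n
  obtain ⟨N, hN'⟩ := exists_forall_goodChain hn hC1 hCt hV
  have hN := hN' T ⟨hT.le, le_rfl⟩
  have hex : ∀ k : ℕ, ∃ v, TruncatedSolution T V k u₀ (G k) v := fun k => by
    obtain ⟨v, h1, h2⟩ := exists_volterra hn hT.le hV k
      (h := fun t => freeGroup n t u₀ + duhamel (freeGroup n) (G k) t)
      ((continuous_freeGroup_apply u₀).continuousOn.add (hE.continuousOn_duhamel (hG k)))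
    exact ⟨v, h1, h2⟩
  choose v hv using hex
  set D : ℝ≥0∞ := N * (1 + 2 * C) ^ N with hD
  have hDt : D ≠ ⊤ := ENNReal.mul_ne_top (by simp)
    (ENNReal.pow_ne_top (ENNReal.add_ne_top.2 ⟨by simp, ENNReal.mul_ne_top (by simp) hCt⟩))
  set L := D * (‖u₀‖ₑ + B) with hL
  have hLt : L ≠ ⊤ := ENNReal.mul_ne_top hDt (ENNReal.add_ne_top.2 ⟨enorm_ne_top, hBt⟩)
  have hvL : ∀ k p q, Admissible n p q → mixedNorm (Icc 0 T) p q (fun t => v k t) ≤ L :=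
    fun k p q hpq => (hv k).mixedNorm_le hn hC1 hCt hC hV (hG k) (hB k) hN hpq
  set b : ℕ → ℝ≥0∞ := fun k => D * (e k + supTail T V k * L) with hb
  have hb0 : Tendsto b atTop (𝓝 0) := by
    have h1 := ENNReal.Tendsto.const_mul (he.add (ENNReal.Tendsto.mul_const (tendsto_supTail hn hV)
      (Or.inr hLt))) (Or.inr hDt)
    simpa using h1
  have hdiff : ∀ k m, k ≤ m → ∀ p q, Admissible n p q →
      mixedNorm (Icc 0 T) p q (fun t => ⇑(v k t - v m t)) ≤ b k := by
    intro k m hkm p q hpq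
    have hi : IntegrableOn (fun s => clipMul m (V s) (v m s) - clipMul k (V s) (v m s))
      (Icc 0 T) := (integrableOn_clipMul_comp hn hV (hv m).continuousOn m).sub
        (integrableOn_clipMul_comp hn hV (hv m).continuousOn k)
    have hs : SourceBound T C (fun s => clipMul m (V s) (v m s) - clipMul k (V s) (v m s))
        (supTail T V k * L) := by
      refine SourceBound.of_mixedNorm_le hC (admissible_two_sobExp hn) hi ?_
      rw [conjExponent_two]
      refine (mixedNorm_clipMul_sub_le hn hV hkm (v m)).trans ?_
      gcongr
      exact hvL m _ _ (admissible_two_sobExp hn)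
    have := ((hv k).sub hn hV (hG k) (hG m) (hv m)).mixedNorm_le hn hC1 hCt hC hV
      (((hG k).sub (hG m)).add (integrableOn_smul hi Complex.I))
      ((hGe k m hkm).add (hs.smul Complex.norm_I) ((hG k).sub (hG m)) (integrableOn_smul hi Complex.I)) hN hpq
    rwa [enorm_zero, zero_add] at this
  have hpt : ∀ k m, k ≤ m → ∀ t ∈ Icc 0 T, ‖v k t - v m t‖ₑ ≤ b k := fun k m hkm t ht =>
    (enorm_le_mixedNorm_top hT ((hv k).continuousOn.sub (hv m).continuousOn) ht).trans
      (hdiff k m hkm _ _ (admissible_top_two n))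
  have hlim : ∀ t, ∃ g, t ∈ Icc 0 T → Tendsto (fun k => v k t) atTop (𝓝 g) := fun t => by
    by_cases ht : t ∈ Icc 0 T
    · obtain ⟨g, hg⟩ := cauchySeq_tendsto_of_complete
        (cauchySeq_of_enorm_sub_le (fun k m hkm => hpt k m hkm t ht) hb0)
      exact ⟨g, fun _ => hg⟩
    · exact ⟨0, fun h => absurd h ht⟩
  choose u hu using hlim
  have hvm : ∀ k, AEStronglyMeasurable (v k) (volume.restrict (Icc 0 T)) := fun k =>
    (hv k).continuousOn.aestronglyMeasurable measurableSet_Icc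
  have huc : ContinuousOn u (Icc 0 T) := by
    have hun : TendstoUniformlyOn v u atTop (Icc 0 T) := by
      rw [EMetric.tendstoUniformlyOn_iff]
      intro ε hε
      filter_upwards [hb0.eventually_lt_const hε] with k hk t ht
      refine lt_of_le_of_lt ?_ hk
      have h1 : Tendsto (fun m => edist (v m t) (v k t)) atTop (𝓝 (edist (u t) (v k t))) :=
        (hu t ht).edist tendsto_const_nhds
      refine le_of_tendsto h1 ?_
      filter_upwards [eventually_ge_atTop k] with m hm
      rw [edist_comm, edist_eq_enorm_sub]
      exact hpt k m hm t ht
    exact hun.continuousOn (Frequently.of_forall fun k => (hv k).continuousOn)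
  have hfin : mixedNorm (Icc 0 T) 2 (sobExp n) (fun t => u t) < ⊤ := by
    refine (mixedNorm_le_of_tendsto hvm ?_ (Frequently.of_forall fun k =>
      hvL k _ _ (admissible_two_sobExp hn))).trans_lt hLt.lt_top
    filter_upwards [ae_restrict_mem measurableSet_Icc] with t ht using hu t ht
  refine ⟨u, v, ⟨huc, hfin, fun t ht => ?_⟩, hv, hu⟩
  obtain ⟨A, hA⟩ := exists_eLpNorm_le hn hV
  have hclose : ∀ k, mixedNorm (Icc 0 T) 2 (sobExp n) (fun t => ⇑(v k t - u t)) ≤ b k := by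
    intro k
    refine mixedNorm_le_of_tendsto (v := fun m t => v k t - v m t) (fun m => (hvm k).sub (hvm m))
      ?_ (Eventually.frequently ?_)
    · filter_upwards [ae_restrict_mem measurableSet_Icc] with t ht
      exact (hu t ht).const_sub _
    · filter_upwards [eventually_ge_atTop k] with m hm
      exact hdiff k m hm _ _ (admissible_two_sobExp hn)
  have hz : Tendsto (fun k : ℕ => duhamel (freeGroup n) (fun s => clipMul k (V s) (v k s - u s)) t)
      atTop (𝓝 0) := by
    rw [tendsto_iff_edist_tendsto_0]
    have h0 : Tendsto (fun k => C * (A * b k)) atTop (𝓝 0) := by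
      simpa using ENNReal.Tendsto.const_mul (ENNReal.Tendsto.const_mul hb0
        (Or.inr (ENNReal.coe_ne_top (r := A)))) (Or.inr hCt)
    refine tendsto_of_tendsto_of_tendsto_of_le_of_le tendsto_const_nhds h0 (fun _ => zero_le)
      fun k => ?_
    have hi := integrableOn_clipMul_comp hn hV ((hv k).continuousOn.sub huc) k
    beta_reduce
    rw [edist_zero_right]
    refine (enorm_le_mixedNorm_top hT (hE.continuousOn_duhamel hi) ht).trans ?_
    refine ((hC T).inhomogeneous (admissible_top_two n) (admissible_two_sobExp hn) hi).trans ?_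
    gcongr
    rw [conjExponent_two]
    refine (mixedNorm_clipMul_le hn hV hA k _).trans ?_
    gcongr
    exact hclose k
  have h2 := (hu t ht).add (hz.const_smul Complex.I)
  rw [smul_zero, add_zero] at h2
  refine h2.congr fun k => ?_
  have hi1 := integrableOn_clipMul_comp hn hV (hv k).continuousOn k
  have hi2 := integrableOn_clipMul_comp hn hV huc k
  rw [(hv k).eq t ht]
  simp only [map_sub]
  rw [duhamel_sub hE hi1 hi2 ht]
  module

theorem LimitSolution.eqOn (hn : 3 ≤ n) {T : ℝ} (hT : 0 < T) {C : ℝ≥0∞} (hC1 : 1 ≤ C)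
    (hCt : C ≠ ⊤) (hC : ∀ T, StrichartzOn (freeGroup n) T C) {V : ℝ → Space n → ℝ}
    (hV : ContinuousInLp (Icc 0 T) ((n : ℝ≥0∞) / 2) V) {u₀ : L2 n} {G : ℕ → ℝ → L2 n}
    {u v : ℝ → L2 n} (hu : LimitSolution T V u₀ G u) (hv : LimitSolution T V u₀ G v) :
    EqOn u v (Icc 0 T) := by
  have hE := isometricGroup_freeGroup n
  have hw : LimitSolution T V 0 (fun _ _ => 0) (fun t => u t - v t) := by
    refine ⟨hu.continuousOn.sub hv.continuousOn, ?_, fun t ht => ?_⟩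
    · have hm : AEStronglyMeasurable (fun t => (-1 : ℂ) • v t) (volume.restrict (Icc 0 T)) :=
        (hv.continuousOn.aestronglyMeasurable measurableSet_Icc).fun_const_smul _
      have h1 := mixedNorm_add_le (I := Icc 0 T) (p := 2) (q := sobExp n) (by norm_num)
        (admissible_two_sobExp hn).one_le_right
        (hu.continuousOn.aestronglyMeasurable measurableSet_Icc) hm
      rw [mixedNorm_smul_of_norm_one _ _ _ _ (by simp)] at h1
      simp only [neg_smul, one_smul, ← sub_eq_add_neg] at h1
      exact h1.trans_lt (ENNReal.add_lt_top.2 ⟨hu.finite, hv.finite⟩)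
    · refine ((hu.tendsto t ht).sub (hv.tendsto t ht)).congr fun k => ?_
      simp only [map_sub]
      rw [duhamel_sub hE (integrableOn_clipMul_comp hn hV hu.continuousOn k)
        (integrableOn_clipMul_comp hn hV hv.continuousOn k) ht, duhamel_zero, map_zero]
      module
  obtain ⟨N, hN⟩ := exists_forall_goodChain hn hC1 hCt hV
  have h0 : SourceBound T C (fun _ => (0 : L2 n)) 0 := by
    refine SourceBound.of_mixedNorm_le hC (admissible_top_two n) integrableOn_zero ?_
    rw [mixedNorm_zero]
  have h1 := (hw.mixedNorm_le_of_goodChain hn hC1 hC hV (fun _ => integrableOn_zero) (fun _ => h0)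
    (hN T ⟨hT.le, le_rfl⟩) le_rfl).1 _ _ (admissible_top_two n)
  intro t ht
  have h2 := (enorm_le_mixedNorm_top hT hw.continuousOn ht).trans h1
  rw [enorm_zero, add_zero, mul_zero, nonpos_iff_eq_zero, enorm_eq_zero, sub_eq_zero] at h2
  exact h2

/-! ### Well-posedness -/

theorem ContinuousInLp.mono {I J : Set ℝ} {r : ℝ≥0∞} {V : ℝ → Space n → ℝ}
    (hV : ContinuousInLp I r V) (hJ : J ⊆ I) : ContinuousInLp J r V := fun t ht =>
  ⟨(hV t (hJ ht)).1, (hV t (hJ ht)).2.mono_left (nhdsWithin_mono _ hJ)⟩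

theorem IsSource.mono {I J : Set ℝ} {p q : ℝ≥0∞} {F : ℝ → Space n → ℂ} (hF : IsSource I p q F)
    (hJ : J ⊆ I) : IsSource J p q F :=
  ⟨hF.1.mono_measure (Measure.prod_mono (Measure.restrict_mono_set _ hJ) le_rfl),
    (mixedNorm_mono_set hJ _ _ _).trans_lt hF.2⟩

theorem sourceApprox_zero (I : Set ℝ) (q : ℝ≥0∞) :
    SourceApprox I q (fun _ _ => 0) (fun _ _ => (0 : L2 n)) := by
  have h0 : eLpNorm (⇑(0 : L2 n)) q volume = 0 := by
    rw [eLpNorm_congr_ae (Lp.coeFn_zero ..), eLpNorm_zero]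
  have h1 : eLpNorm (fun x => 0 - (0 : L2 n) x) q volume = 0 := by
    simp only [zero_sub]
    exact (eLpNorm_neg (⇑(0 : L2 n)) q volume).trans h0
  refine ⟨fun k => aestronglyMeasurable_const, fun k => ⟨0, by simp⟩, aemeasurable_const,
    fun k => aemeasurable_const, ae_of_all _ fun t => MemLp.zero, ae_of_all _ fun t k => ?_,
    ae_of_all _ fun t k => ?_, ae_of_all _ fun t k m _ => ?_, ae_of_all _ fun t => ?_⟩
  · rw [h0]; exact zero_le
  · rw [h1]; exact zero_le
  · rw [sub_self, h0]; exact zero_le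
  · simp only [h1]
    exact tendsto_const_nhds

theorem LimitSolution.isMildSolution (hn : 3 ≤ n) {T : ℝ} {V : ℝ → Space n → ℝ}
    (hV : ContinuousInLp (Icc 0 T) ((n : ℝ≥0∞) / 2) V) {p q : ℝ≥0∞} (hpq : Admissible n p q)
    {F : ℝ → Space n → ℂ} {G : ℕ → ℝ → L2 n} (hG : SourceApprox (Icc 0 T) q.conjExponent F G)
    (hF : mixedNorm (Icc 0 T) p.conjExponent q.conjExponent F < ⊤) {u₀ : L2 n} {u : ℝ → L2 n}
    (hu : LimitSolution T V u₀ (fun k s => Complex.I • G k s) u) :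
    IsMildSolution (Icc 0 T) V u₀ F u := by
  refine ⟨hu.continuousOn, fun t ht => (mixedNorm_mono_set (Icc_subset_Icc_right ht.2) _ _
    _).trans_lt hu.finite, fun t ht φ => ?_⟩
  have h1 : Tendsto (fun k : ℕ => pair n (freeGroup n t u₀ +
      duhamel (freeGroup n) (fun s => Complex.I • G k s) t +
      (-Complex.I) • duhamel (freeGroup n) (fun s => clipMul k (V s) (u s)) t) (schL2 n φ)) atTop
      (𝓝 (pair n (u t) (schL2 n φ))) :=
    (((pair n).flip (schL2 n φ)).continuous.tendsto (u t)).comp (hu.tendsto t ht)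
  have h2 := ((tendsto_integral_pair hn hV hpq hG hF hu.continuousOn hu.finite φ ht).const_mul
    Complex.I).const_add (pair n u₀ (freeGroup n t (schL2 n φ)))
  have h3 := tendsto_nhds_unique h1 (h2.congr fun k => (pair_approximation
    (hG.integrableOn subset_rfl k) (integrableOn_clipMul_comp hn hV hu.continuousOn k) ht _).symm)
  rw [pair_apply, pair_apply] at h3
  refine Eq.trans (integral_congr_ae ?_) h3
  filter_upwards [coeFn_schL2 φ] with x hx
  rw [hx]

namespace IsMildSolution
variable {I J : Set ℝ} {V : ℝ → Space n → ℝ} {u₀ : L2 n} {F : ℝ → Space n → ℂ} {u v : ℝ → L2 n}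

theorem mono (hu : IsMildSolution I V u₀ F u) (hJ : J ⊆ I) : IsMildSolution J V u₀ F u :=
  ⟨hu.continuousOn.mono hJ, fun t ht => hu.finite t (hJ ht), fun t ht => hu.integral_eq t (hJ ht)⟩

theorem congr {T : ℝ} (hu : IsMildSolution (Icc 0 T) V u₀ F u) (h : EqOn v u (Icc 0 T)) :
    IsMildSolution (Icc 0 T) V u₀ F v := by
  refine ⟨hu.continuousOn.congr h, fun t ht => ?_, fun t ht φ => ?_⟩
  · refine lt_of_eq_of_lt (mixedNorm_congr_ae ?_) (hu.finite t ht)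
    filter_upwards [ae_restrict_mem measurableSet_Icc] with s hs
    rw [h ⟨hs.1, hs.2.trans ht.2⟩]
  · rw [h ht, hu.integral_eq t ht φ]
    congr 2
    refine intervalIntegral.integral_congr fun s hs => ?_
    rw [uIcc_of_le ht.1] at hs
    beta_reduce
    rw [h ⟨hs.1, hs.2.trans ht.2⟩]

theorem of_forall_Icc (h : ∀ T, 0 < T → IsMildSolution (Icc 0 T) V u₀ F u) :
    IsMildSolution (Ici 0) V u₀ F u := by
  have hp : ∀ t ∈ Ici (0 : ℝ), 0 < t + 1 ∧ t ∈ Icc 0 (t + 1) := fun t ht => by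
    have : 0 ≤ t := ht
    exact ⟨by linarith, this, by linarith⟩
  refine ⟨fun t ht => ?_, fun t ht => (h _ (hp t ht).1).finite t (hp t ht).2,
    fun t ht => (h _ (hp t ht).1).integral_eq t (hp t ht).2⟩
  refine ((h _ (hp t ht).1).continuousOn t (hp t ht).2).mono_of_mem_nhdsWithin ?_
  exact mem_nhdsWithin.2 ⟨Iio (t + 1), isOpen_Iio, by simp, fun s hs => ⟨hs.2, hs.1.le⟩⟩

variable {T : ℝ} {C : ℝ≥0∞} {p q : ℝ≥0∞}

theorem mixedNorm_le_of_goodChain (hn : 3 ≤ n) (hT : 0 < T) (hC1 : 1 ≤ C) (hCt : C ≠ ⊤)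
    (hC : ∀ T, StrichartzOn (freeGroup n) T C)
    (hV : ContinuousInLp (Icc 0 T) ((n : ℝ≥0∞) / 2) V) (hpq : Admissible n p q)
    (hF : IsSource (Icc 0 T) p q F) (hu : IsMildSolution (Icc 0 T) V u₀ F u) {k : ℕ}
    (hk : GoodChain C V k T) {a b : ℝ≥0∞} (hab : Admissible n a b) :
    mixedNorm (Icc 0 T) a b (fun t => u t) ≤ k * (1 + 2 * C) ^ k *
      (‖u₀‖ₑ + mixedNorm (Icc 0 T) p.conjExponent q.conjExponent F) := by
  obtain ⟨G, hG⟩ := exists_sourceApprox hpq.1 hpq.2.1 hF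
  have hGi := hG.integrableOn subset_rfl
  exact ((hu.limitSolution hn hT hCt (hC T) hV hpq hG hF.2).mixedNorm_le_of_goodChain hn hC1 hC hV
    (fun k => integrableOn_smul (hGi k) _) (fun k => (SourceBound.of_mixedNorm_le hC hpq (hGi k)
      (hG.mixedNorm_le _ k)).smul Complex.norm_I) hk le_rfl).1 a b hab

theorem eqOn (hn : 3 ≤ n) (hT : 0 < T) (hC1 : 1 ≤ C) (hCt : C ≠ ⊤)
    (hC : ∀ T, StrichartzOn (freeGroup n) T C)
    (hV : ContinuousInLp (Icc 0 T) ((n : ℝ≥0∞) / 2) V) (hpq : Admissible n p q)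
    (hF : IsSource (Icc 0 T) p q F) (hu : IsMildSolution (Icc 0 T) V u₀ F u)
    (hv : IsMildSolution (Icc 0 T) V u₀ F v) : EqOn u v (Icc 0 T) := by
  obtain ⟨G, hG⟩ := exists_sourceApprox hpq.1 hpq.2.1 hF
  exact (hu.limitSolution hn hT hCt (hC T) hV hpq hG hF.2).eqOn hn hT hC1 hCt hC hV
    (hv.limitSolution hn hT hCt (hC T) hV hpq hG hF.2)

theorem norm_eq (hn : 3 ≤ n) (hT : 0 < T) (hC1 : 1 ≤ C) (hCt : C ≠ ⊤)
    (hC : ∀ T, StrichartzOn (freeGroup n) T C)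
    (hV : ContinuousInLp (Icc 0 T) ((n : ℝ≥0∞) / 2) V)
    (hu : IsMildSolution (Icc 0 T) V u₀ (fun _ _ => 0) u) {t : ℝ} (ht : t ∈ Icc 0 T) :
    ‖u t‖ = ‖u₀‖ := by
  have h1 := hu.limitSolution hn hT hCt (hC T) hV (admissible_top_two n)
    (sourceApprox_zero _ _) (by simp [mixedNorm])
  simp only [smul_zero] at h1
  have h0 : SourceBound T C (fun _ => (0 : L2 n)) 0 :=
    SourceBound.of_mixedNorm_le hC (admissible_top_two n) integrableOn_zero (mixedNorm_zero ..).le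
  obtain ⟨w, v, hw, hv, hlim⟩ := exists_limitSolution hn hT hC1 hCt hC hV u₀
    (G := fun _ _ => 0) (fun _ => integrableOn_zero) ENNReal.zero_ne_top (fun _ => h0)
    (e := fun _ => 0) tendsto_const_nhds (fun k m _ => by simpa only [sub_zero] using h0)
  rw [h1.eqOn hn hT hC1 hCt hC hV hw ht]
  refine tendsto_nhds_unique (hlim t ht).norm (tendsto_const_nhds.congr fun k => ?_)
  refine (norm_eq_of_volterra hn hV k (hv k).continuousOn (fun s hs => ?_) ht).symm
  simpa only [duhamel_zero, add_zero] using (hv k).eq s hs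

end IsMildSolution

theorem exists_isMildSolution (hn : 3 ≤ n) {T : ℝ} (hT : 0 < T) {C : ℝ≥0∞} (hC1 : 1 ≤ C)
    (hCt : C ≠ ⊤) (hC : ∀ T, StrichartzOn (freeGroup n) T C) {V : ℝ → Space n → ℝ}
    (hV : ContinuousInLp (Icc 0 T) ((n : ℝ≥0∞) / 2) V) {p q : ℝ≥0∞} (hpq : Admissible n p q)
    {F : ℝ → Space n → ℂ} (hF : IsSource (Icc 0 T) p q F) (u₀ : L2 n) :
    ∃ u, IsMildSolution (Icc 0 T) V u₀ F u := by
  obtain ⟨G, hG⟩ := exists_sourceApprox hpq.1 hpq.2.1 hF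
  have hGi := hG.integrableOn subset_rfl
  have hGs : ∀ k m, k ≤ m → SourceBound T C (fun s => Complex.I • G k s - Complex.I • G m s)
      (mixedNorm (Icc 0 T) p.conjExponent q.conjExponent (fun t x => F t x - G k t x)) := by
    intro k m hkm
    have h1 : SourceBound T C (fun s => G k s - G m s) _ := SourceBound.of_mixedNorm_le hC hpq
      ((hGi k).sub (hGi m)) (hG.mixedNorm_sub_le p.conjExponent hkm)
    have h2 := h1.smul Complex.norm_I
    simp only [smul_sub] at h2
    exact h2
  obtain ⟨u, -, hu, -, -⟩ := exists_limitSolution hn hT hC1 hCt hC hV u₀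
    (G := fun k s => Complex.I • G k s) (fun k => integrableOn_smul (hGi k) _) hF.2.ne
    (fun k => (SourceBound.of_mixedNorm_le hC hpq (hGi k) (hG.mixedNorm_le _ k)).smul
      Complex.norm_I)
    (hG.tendsto_mixedNorm (conjExponent_ne_zero p) (conjExponent_ne_top hpq.1) hF.2) hGs
  exact ⟨u, hu.isMildSolution hn hV hpq hG hF.2⟩

theorem exists_isMildSolution_Ici (hn : 3 ≤ n) {C : ℝ≥0∞} (hC1 : 1 ≤ C)
    (hCt : C ≠ ⊤) (hC : ∀ T, StrichartzOn (freeGroup n) T C) {V : ℝ → Space n → ℝ}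
    (hV : ContinuousInLp (Ici 0) ((n : ℝ≥0∞) / 2) V) {p q : ℝ≥0∞} (hpq : Admissible n p q)
    {F : ℝ → Space n → ℂ} (hF : IsSource (Ici 0) p q F) (u₀ : L2 n) :
    ∃ u, IsMildSolution (Ici 0) V u₀ F u := by
  have hI : ∀ T : ℝ, Icc 0 T ⊆ Ici 0 := fun T => Icc_subset_Ici_self
  have hpos : ∀ k : ℕ, (0 : ℝ) < k + 1 := fun k => by positivity
  choose w hw using fun k : ℕ => exists_isMildSolution hn (hpos k) hC1 hCt hC (hV.mono (hI _)) hpq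
    (hF.mono (hI _)) u₀
  have hle : ∀ k m : ℕ, k ≤ m → EqOn (w k) (w m) (Icc 0 (k + 1)) := fun k m hkm =>
    (hw k).eqOn hn (hpos k) hC1 hCt hC (hV.mono (hI _)) hpq (hF.mono (hI _))
      ((hw m).mono (Icc_subset_Icc_right (by
        have : (k : ℝ) ≤ m := by exact_mod_cast hkm
        linarith)))
  have heq : ∀ m : ℕ, EqOn (fun t => w ⌈t⌉₊ t) (w m) (Icc 0 (m + 1)) := by
    intro m t ht
    rcases le_total ⌈t⌉₊ m with h | h
    · exact hle _ _ h ⟨ht.1, (Nat.le_ceil t).trans (by linarith)⟩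
    · exact (hle _ _ h ht).symm
  refine ⟨fun t => w ⌈t⌉₊ t, IsMildSolution.of_forall_Icc fun T hT => ?_⟩
  refine ((hw ⌈T⌉₊).congr (heq _)).mono (Icc_subset_Icc_right ?_)
  linarith [Nat.le_ceil T]

theorem coe_goodChain_constant {C : ℝ≥0∞} (hCt : C ≠ ⊤) (N : ℕ) :
    (((N * (1 + 2 * C) ^ N : ℝ≥0∞).toNNReal : ℝ≥0) : ℝ≥0∞) = N * (1 + 2 * C) ^ N :=
  ENNReal.coe_toNNReal (ENNReal.mul_ne_top (by simp)
    (ENNReal.pow_ne_top (ENNReal.add_ne_top.2 ⟨by simp, ENNReal.mul_ne_top (by simp) hCt⟩)))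

theorem strichartzEstimates_Icc (hn : 3 ≤ n) {T : ℝ} (hT : 0 < T) {C : ℝ≥0∞} (hC1 : 1 ≤ C)
    (hCt : C ≠ ⊤) (hC : ∀ T, StrichartzOn (freeGroup n) T C) {V : ℝ → Space n → ℝ}
    (hV : ContinuousInLp (Icc 0 T) ((n : ℝ≥0∞) / 2) V) {k : ℕ} (hk : GoodChain C V k T) :
    StrichartzEstimates (Icc 0 T) V (k * (1 + 2 * C) ^ k) := by
  intro a b p q hab hpq u₀ F u hF hu
  rw [← mul_add]
  exact hu.mixedNorm_le_of_goodChain hn hT hC1 hCt hC hV hpq hF hk hab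

theorem strichartzEstimates_Ici (hn : 3 ≤ n) {C : ℝ≥0∞} (hC1 : 1 ≤ C)
    (hCt : C ≠ ⊤) (hC : ∀ T, StrichartzOn (freeGroup n) T C) {V : ℝ → Space n → ℝ}
    (hV : ContinuousInLp (Ici 0) ((n : ℝ≥0∞) / 2) V) {k : ℕ}
    (hk : ∀ T, 0 ≤ T → GoodChain C V k T) :
    StrichartzEstimates (Ici 0) V (k * (1 + 2 * C) ^ k) := by
  intro a b p q hab hpq u₀ F u hF hu
  have hI : ∀ T : ℝ, Icc 0 T ⊆ Ici 0 := fun T => Icc_subset_Ici_self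
  refine mixedNorm_Ici_le (hu.continuousOn.aestronglyMeasurable measurableSet_Ici) fun T hT => ?_
  refine (strichartzEstimates_Icc hn hT hC1 hCt hC (hV.mono (hI T)) (hk T hT.le) a b p q hab hpq u₀
    F u (hF.mono (hI T)) (hu.mono (hI T))).trans ?_
  gcongr
  exact mixedNorm_mono_set (hI T) _ _ _

theorem wellPosed_Icc (hn : 3 ≤ n) {T : ℝ} (hT : 0 < T) {V : ℝ → Space n → ℝ}
    (hV : ContinuousInLp (Icc 0 T) ((n : ℝ≥0∞) / 2) V) (hS : IsStrichartzType (V 0)) :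
    WellPosed (Icc 0 T) V := by
  obtain ⟨hfree, hCt⟩ := freeStrichartzConstant_spec hn (hV 0 ⟨le_rfl, hT.le⟩).1 hS
  have hC := hfree.strichartzOn
  have hC1 := one_le_freeStrichartzConstant n
  refine ⟨fun p q hpq u₀ F hF => ?_, ?_, fun k hk => ?_, fun u₀ u hu t ht => ?_⟩
  · obtain ⟨u, hu⟩ := exists_isMildSolution hn hT hC1 hCt hC hV hpq hF u₀
    exact ⟨u, hu, fun v hv => hv.eqOn hn hT hC1 hCt hC hV hpq hF hu⟩
  · obtain ⟨N, hN⟩ := exists_forall_goodChain hn hC1 hCt hV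
    refine ⟨(N * (1 + 2 * freeStrichartzConstant n) ^ N : ℝ≥0∞).toNNReal, ?_⟩
    rw [coe_goodChain_constant hCt]
    exact strichartzEstimates_Icc hn hT hC1 hCt hC hV (hN T ⟨hT.le, le_rfl⟩)
  · exact strichartzEstimates_Icc hn hT hC1 hCt hC hV (hk.goodChain hCt hT.le Ico_subset_Icc_self)
  · exact hu.norm_eq hn hT hC1 hCt hC hV ht

theorem wellPosed_Ici (hn : 3 ≤ n) {V : ℝ → Space n → ℝ}
    (hV : ContinuousInLp (Ici 0) ((n : ℝ≥0∞) / 2) V) (hS : IsStrichartzType (V 0)) {T₀ : ℝ}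
    (hT₀ : 0 < T₀) (h : ∀ t, T₀ < t →
      eLpNorm (V t) ((n : ℝ≥0∞) / 2) volume ≤ (2 * freeStrichartzConstant n)⁻¹) :
    WellPosed (Ici 0) V := by
  obtain ⟨hfree, hCt⟩ := freeStrichartzConstant_spec hn (hV 0 self_mem_Ici).1 hS
  have hC := hfree.strichartzOn
  have hC1 := one_le_freeStrichartzConstant n
  have hI : ∀ T : ℝ, Icc 0 T ⊆ Ici 0 := fun T => Icc_subset_Ici_self
  have hp : ∀ t ∈ Ici (0 : ℝ), 0 < t + 1 ∧ t ∈ Icc 0 (t + 1) := fun t ht => by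
    have : 0 ≤ t := ht
    exact ⟨by linarith, this, by linarith⟩
  refine ⟨fun p q hpq u₀ F hF => ?_, ?_, fun k hk => ?_, fun u₀ u hu t ht => ?_⟩
  · obtain ⟨u, hu⟩ := exists_isMildSolution_Ici hn hC1 hCt hC hV hpq hF u₀
    refine ⟨u, hu, fun v hv t ht => ?_⟩
    exact (hv.mono (hI _)).eqOn hn (hp t ht).1 hC1 hCt hC (hV.mono (hI _)) hpq (hF.mono (hI _))
      (hu.mono (hI _)) (hp t ht).2
  · obtain ⟨N, hN⟩ := exists_forall_goodChain_Ici hn hC1 hCt hV hT₀ h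
    refine ⟨(N * (1 + 2 * freeStrichartzConstant n) ^ N : ℝ≥0∞).toNNReal, ?_⟩
    rw [coe_goodChain_constant hCt]
    exact strichartzEstimates_Ici hn hC1 hCt hC hV hN
  · exact strichartzEstimates_Ici hn hC1 hCt hC hV fun T hT =>
      hk.goodChain hCt hT (Ico_subset_Icc_self.trans (hI T))
  · exact (hu.mono (hI _)).norm_eq hn (hp t ht).1 hC1 hCt hC (hV.mono (hI _)) (hp t ht).2

end Schrodinger
end

theorem theorem1p2 (n : ℕ) (hn : 3 ≤ n) (V : ℝ → Schrodinger.Space n → ℝ) :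
    (∀ T : ℝ, 0 < T →
      Schrodinger.ContinuousInLp (Set.Icc 0 T) ((n : ENNReal) / 2) V →
      (∀ t ∈ Set.Icc 0 T, Schrodinger.IsStrichartzType (V t)) →
      Schrodinger.WellPosed (Set.Icc 0 T) V) ∧
    (Schrodinger.ContinuousInLp (Set.Ici 0) ((n : ENNReal) / 2) V →
      (∀ t ∈ Set.Ici (0 : ℝ), Schrodinger.IsStrichartzType (V t)) →
      (∃ T₀ : ℝ, 0 < T₀ ∧ ∀ t : ℝ, T₀ < t →
        MeasureTheory.eLpNorm (V t) ((n : ENNReal) / 2) MeasureTheory.volume ≤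
          (2 * Schrodinger.freeStrichartzConstant n)⁻¹) →
      Schrodinger.WellPosed (Set.Ici 0) V) := by
  refine ⟨fun T hT hV hS => Schrodinger.wellPosed_Icc hn hT hV (hS 0 ⟨le_rfl, hT.le⟩), ?_⟩
  rintro hV hS ⟨T₀, hT₀, h⟩
  exact Schrodinger.wellPosed_Ici hn hV (hS 0 Set.self_mem_Ici) hT₀ h
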